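/- **Setting.** A *bigerm* is a pair $\phi=[\phi_1,\phi_2]$ of primitive (injective) analytic parametrizations $\phi_i:(\mathbb C,0)\to(\mathbb C^2,0)$ of the two distinct branches of a reduced plane curve germ. Bigerms $\phi,\psi$ are $\mathcal A$-*equivalent* if $\psi_i=\sigma\circ\phi_i\circ\rho_i^{-1}$ $(i=1,2)$ for analytic automorphisms $\rho_1,\rho_2$ of $(\mathbb C,0)$ and $\sigma$ of $(\mathbb C^2,0)$; they are $\mathcal H$-*equivalent* if moreover $j^1\rho_i=\alpha_it_i$ and $j^1\sigma=(ax,by)$ with $\alpha_i,a,b\ne0$. Let $m=(m_1,m_2)$ be the multiplicities. $\phi$ is in *Puiseux form* if $\phi_1=(t_1^{m_1},\sum_{i>m_1}a_{1i}t_1^i)$ and either $\delta=1$ (distinct tangents) and $\phi_2=(\sum_{i>m_2}a_{2i}t_2^i,\,t_2^{m_2})$, or $\delta=2$ (same tangent) and $\phi_2=(t_2^{m_2},\sum_{i>m_2}a_{2i}t_2^i)$. Let $\Gamma=\{(\mathrm{ord}_{t_1}\eta(\phi_1),\mathrm{ord}_{t_2}\eta(\phi_2));\ \eta\in\mathbb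 C\{x,y\}\}\cap\mathbb N^2$ and $\Lambda[\delta]=\{\nu(\omega)-m;\ \omega\in\Omega[\delta]\}\cap\mathbb N^2$, where $\nu_i(\omega)=\mathrm{ord}_{t_i}\omega(\phi_i)+1$ and $\Omega[\delta]=\{\eta_1dx+(\beta(\delta-1)y+\eta_2)dy;\ \eta_1,\eta_2\in(x,y)^2\mathbb C\{x,y\},\ \beta\in\mathbb C\}$. $\Sigma_{\Gamma,\Lambda[\delta]}$ is the set of bigerms in Puiseux form with given $\Gamma$ and $\Lambda[\delta]$. For $a\in\mathbb N^2$ let $F_i(a)=\{b\in\Lambda[\delta];\ b_i=a_i,\ b_j>a_j,\ j\neq i\}$, let $M=\{a\in\Lambda[\delta];\ F_1(a)=F_2(a)=\emptyset\}$, and write $\underline j=(j,j)$. **Theorem.** Every bigerm is $\mathcal A$-equivalent to one in some $\Sigma_{\Gamma,\Lambda[\delta]}$, $\delta\in\{1,2\}$. Let $\phi\in\Sigma_{\Gamma,\Lambda[\delta]}$. (1) After possibly exchanging the two branches (and correspondingly the two coordinates of $\Gamma$ and $\Lambda[\delta]$), $\phi$ is $\mathcal A$-equivalent to a bigerm in the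 same $\Sigma_{\Gamma,\Lambda[\delta]}$ of one of the following forms. All sums are finite, and every exponent $j$ written in the polynomial coordinate of the $i$-th branch (including $j_1,k,j_2$) satisfies $j>m_i$ and $F_i(\underline j)=\emptyset$. Distinct tangents: a) $\Big[\big(t_1^{m_1},\,t_1^{j_1}+t_1^k+\sum_{j>k,\ \underline j\notin M,\ F_1(\underline j)=\emptyset}a_{1j}t_1^j\big),\ \big(\sum_{F_2(\underline j)=\emptyset}a_{2j}t_2^j,\ t_2^{m_2}\big)\Big]$, $j_1<k$; b) $[(t_1^{m_1},t_1^{j_1}),(t_2^{j_2},t_2^{m_2})]$; c) $[(t_1^{m_1},t_1^{j_1}),(0,t_2)]$; d) $[(t_1,0),(0,t_2)]$. Same tangent: a$'$) $\Big[\big(t_1^{m_1},\,t_1^{j_1}+t_1^k+\sum_{j>k,\ \underline j\notin M,\ F_1(\underline j)=\emptyset}a_{1j}t_1^j\big),\ \big(t_2^{m_2},\sum_{F_2(\underline j)=\emptyset}a_{2j}t_2^j\big)\Big]$, $j_1<k$; b$'$) $[(t_1^{m_1},t_1^{j_1}),(t_2^{m_2},t_2^{j_2})]$ with $m_1\ne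 m_2$ or $j_1\neq j_2$; c$'$) $[(t_1^{m_1},t_1^{j_1}),(t_2^{m_1},at_2^{j_1})]$ with $a\notin\{0,1\}$; d$'$) $[(t_1^{m_1},t_1^{j_1}),(t_2,0)]$. (2) Without exchanging the branches, $\phi$ is $\mathcal A$-equivalent to a bigerm in $\Sigma_{\Gamma,\Lambda[\delta]}$ whose $i$-th branch has polynomial coordinate $P_i$, where all exponents $j$ of $P_1$ satisfy $j>m_1$, $\underline j\notin M$, $F_1(\underline j)=\emptyset$, all exponents $j$ of $P_2$ satisfy $j>m_2$, $F_2(\underline j)=\emptyset$, and one of the following holds (dots are higher order terms, all displayed exponents increase): (i) $P_1=t^{j_1}+t^k+\cdots$; (ii) $P_1=t^{j_1}$, and either $m_2=1$, $P_2=0$; or, if $\delta=1$, $P_2=t^{j_2}+\cdots$; or, if $\delta=2$, one of: $P_2=t^{j_2}+\cdots$ with $j_1m_2\ne j_2m_1$; $P_2=at^{j_2}+t^k+\cdots$ with $a\neq0$, $j_1m_2=j_2m_1$; $m_2=m_1$ and $P_2=at^{j_1}$ with $a\notin\{0,1\}$; (iii) $m_1=1$, $P_1=0$, and $P_2=t^{j_2}+t^k+\cdots$,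 or $P_2=t^{j_2}$, or ($\delta=1$ and $m_2=1$, $P_2=0$). (3) (Residual homotheties.) Let $\psi,\psi'\in\Sigma_{\Gamma,\Lambda[\delta]}$ be two bigerms of form a) (resp. a$'$)) with the same $m_1,m_2,j_1,k$, with $\underline{j_1},\underline k\notin M$, and with coefficients $a_{ij}$ and $b_{ij}$. A homothety $\sigma(x,y)=(ax,by)$, $\rho_1(t_1)=\alpha t_1$, $\rho_2(t_2)=\beta t_2$ (with $a,b,\alpha,\beta\neq0$) carries $\psi$ to $\psi'$ if and only if $a=\alpha^{m_1}$, $b=\alpha^{j_1}$, $\alpha^{k-j_1}=1$ and, in case a): $\beta^{m_2}=\alpha^{j_1}$, $a_{1j}\alpha^{j_1-j}=b_{1j}$, $a_{2j}\alpha^{m_1}\beta^{-j}=b_{2j}$ for all $j$; in case a$'$): $\beta^{m_2}=\alpha^{m_1}$, $a_{1j}\alpha^{j_1-j}=b_{1j}$, $a_{2j}\alpha^{j_1}\beta^{-j}=b_{2j}$ for all $j$. Moreover $\psi$ and $\psi'$ are $\mathcal H$-equivalent if and only if such $\alpha,\beta$ exist. -/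

import Mathlib

namespace TwoBranch

open Filter Topology Polynomial

noncomputable section

/-! ### Bigerms and the groups acting on them -/

/-- A pair of maps `(ℂ, 0) → (ℂ², 0)`; only the germs at `0` matter. -/
abbrev Bigerm : Type := (ℂ → ℂ × ℂ) × (ℂ → ℂ × ℂ)

/-- `f` is a (primitive) parametrization of an analytic branch at the origin of the plane:
it is analytic, sends `0` to `0`, and is injective near `0`. -/
def IsBranch (f : ℂ → ℂ × ℂ) : Prop :=
  AnalyticAt ℂ f 0 ∧ f 0 = 0 ∧ ∃ U ∈ 𝓝 (0 : ℂ), Set.InjOn f U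

/-- `φ` parametrizes a reduced plane curve germ with exactly two branches: both components
parametrize branches, and the two branches are distinct, i.e. meet only at the origin. -/
def IsBigerm (φ : Bigerm) : Prop :=
  IsBranch φ.1 ∧ IsBranch φ.2 ∧
    ∃ U ∈ 𝓝 (0 : ℂ), ∀ s ∈ U, ∀ t ∈ U, φ.1 s = φ.2 t → s = 0 ∧ t = 0

/-- Germs of analytic automorphisms of `(E, 0)`. -/
def IsGermAut {E : Type*} [NormedAddCommGroup E] [NormedSpace ℂ E] (f : E → E) : Prop :=
  AnalyticAt ℂ f 0 ∧ f 0 = 0 ∧ (fderiv ℂ f 0).IsInvertible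

/-- `(ρ₁, ρ₂, σ)` carries `φ` to `ψ`, i.e. `ψᵢ = σ ∘ φᵢ ∘ ρᵢ⁻¹` as germs. -/
def Carries (ρ₁ ρ₂ : ℂ → ℂ) (σ : ℂ × ℂ → ℂ × ℂ) (φ ψ : Bigerm) : Prop :=
  σ ∘ φ.1 =ᶠ[𝓝 0] ψ.1 ∘ ρ₁ ∧ σ ∘ φ.2 =ᶠ[𝓝 0] ψ.2 ∘ ρ₂

/-- `𝒜`-equivalence of bigerms: analytic changes of coordinates in the two sources and a common
one in the target. -/
def AEquiv (φ ψ : Bigerm) : Prop :=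
  ∃ (ρ₁ ρ₂ : ℂ → ℂ) (σ : ℂ × ℂ → ℂ × ℂ),
    IsGermAut ρ₁ ∧ IsGermAut ρ₂ ∧ IsGermAut σ ∧ Carries ρ₁ ρ₂ σ φ ψ

/-- `ℋ`-equivalence: `𝒜`-equivalence through `(ρ₁, ρ₂, σ)` whose `1`-jets are homotheties
`j¹ρᵢ = αᵢ tᵢ`, `j¹σ = (a x, b y)` (with `αᵢ, a, b ≠ 0`). -/
def HEquiv (φ ψ : Bigerm) : Prop :=
  ∃ (ρ₁ ρ₂ : ℂ → ℂ) (σ : ℂ × ℂ → ℂ × ℂ),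
    IsGermAut ρ₁ ∧ IsGermAut ρ₂ ∧ IsGermAut σ ∧
    (∃ a b : ℂ, ∀ v : ℂ × ℂ, fderiv ℂ σ 0 v = (a * v.1, b * v.2)) ∧
    Carries ρ₁ ρ₂ σ φ ψ

/-! ### The two cases and Puiseux form -/

/-- `distinct` is `δ = 1` (distinct tangents), `same` is `δ = 2` (same tangent). -/
inductive Tangents : Type
  | distinct
  | same

/-- The order at `0` of the germ of an analytic function of one variable. -/
def ord (g : ℂ → ℂ) : ℕ∞ := analyticOrderAt g 0

/-- The multiplicity of a branch. -/
def mult (f : ℂ → ℂ × ℂ) : ℕ∞ := min (ord fun t => (f t).1) (ord fun t => (f t).2)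

/-- `f = (t ^ m, ∑_{i > m} aᵢ t ^ i)` as a germ. -/
def PuiseuxX (f : ℂ → ℂ × ℂ) : Prop :=
  ∃ m : ℕ, 0 < m ∧ (∀ᶠ t in 𝓝 (0 : ℂ), (f t).1 = t ^ m) ∧ (m : ℕ∞) < ord fun t => (f t).2

/-- `f = (∑_{i > m} aᵢ t ^ i, t ^ m)` as a germ. -/
def PuiseuxY (f : ℂ → ℂ × ℂ) : Prop :=
  ∃ m : ℕ, 0 < m ∧ (∀ᶠ t in 𝓝 (0 : ℂ), (f t).2 = t ^ m) ∧ (m : ℕ∞) < ord fun t => (f t).1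

/-- Puiseux form of a bigerm. -/
def InPuiseuxForm : Tangents → Bigerm → Prop
  | .distinct, φ => PuiseuxX φ.1 ∧ PuiseuxY φ.2
  | .same, φ => PuiseuxX φ.1 ∧ PuiseuxX φ.2

/-! ### Values of functions and of differentials -/

/-- The semigroup of values `Γ` (its points with finite coordinates). -/
def semigroupOfValues (φ : Bigerm) : Set (ℕ × ℕ) :=
  {v | ∃ η : ℂ × ℂ → ℂ, AnalyticAt ℂ η 0 ∧ ord (η ∘ φ.1) = v.1 ∧ ord (η ∘ φ.2) = v.2}

/-- `η ∈ (x, y)² ℂ{x, y}`. -/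
def InMaxSq (η : ℂ × ℂ → ℂ) : Prop :=
  AnalyticAt ℂ η 0 ∧ η 0 = 0 ∧ fderiv ℂ η 0 = 0

/-- `A dx + B dy ∈ Ω[δ]`: `A ∈ (x, y)²` and `B = β (δ - 1) y + η` with `η ∈ (x, y)²`. -/
def InOmega (δ : Tangents) (A B : ℂ × ℂ → ℂ) : Prop :=
  InMaxSq A ∧ ∃ (β : ℂ) (η : ℂ × ℂ → ℂ),
    InMaxSq η ∧ (δ = .distinct → β = 0) ∧ B = fun p => β * p.2 + η p

/-- The coefficient of `dt` in the pull-back of `A dx + B dy` along `f`. -/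
def pullback (A B : ℂ × ℂ → ℂ) (f : ℂ → ℂ × ℂ) : ℂ → ℂ := fun t =>
  A (f t) * deriv (fun s => (f s).1) t + B (f t) * deriv (fun s => (f s).2) t

/-- `Λ[δ] = {ν(ω) - m ; ω ∈ Ω[δ]}` (its points with finite coordinates), where
`νᵢ(ω) = ord ω(φᵢ) + 1` and `m` is the pair of multiplicities. -/
def valuesOfDifferentials (δ : Tangents) (φ : Bigerm) : Set (ℕ × ℕ) :=
  {v | ∃ A B : ℂ × ℂ → ℂ, InOmega δ A B ∧
    ord (pullback A B φ.1) + 1 = v.1 + mult φ.1 ∧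
    ord (pullback A B φ.2) + 1 = v.2 + mult φ.2}

/-- The bigerms `Σ_{Γ, Λ[δ]}` in Puiseux form with given `Γ` and `Λ[δ]`. -/
def SigmaSet (δ : Tangents) (Γ Λ : Set (ℕ × ℕ)) : Set Bigerm :=
  {φ | IsBigerm φ ∧ InPuiseuxForm δ φ ∧
    semigroupOfValues φ = Γ ∧ valuesOfDifferentials δ φ = Λ}

/-- The vertical fibre `F₁(a)`. -/
def fibre₁ (Λ : Set (ℕ × ℕ)) (a : ℕ × ℕ) : Set (ℕ × ℕ) := {b ∈ Λ | b.1 = a.1 ∧ a.2 < b.2}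

/-- The horizontal fibre `F₂(a)`. -/
def fibre₂ (Λ : Set (ℕ × ℕ)) (a : ℕ × ℕ) : Set (ℕ × ℕ) := {b ∈ Λ | b.2 = a.2 ∧ a.1 < b.1}

/-- The set `M` of maximal points. -/
def maximalPoints (Λ : Set (ℕ × ℕ)) : Set (ℕ × ℕ) :=
  {a ∈ Λ | fibre₁ Λ a = ∅ ∧ fibre₂ Λ a = ∅}

/-! ### Polynomial bigerms and the normal forms -/

/-- `[(t₁ ^ m₁, P₁(t₁)), (P₂(t₂), t₂ ^ m₂)]` for distinct tangents and
`[(t₁ ^ m₁, P₁(t₁)), (t₂ ^ m₂, P₂(t₂))]` for the same tangent. -/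
def model : Tangents → ℕ → ℕ → ℂ[X] → ℂ[X] → Bigerm
  | .distinct, m₁, m₂, P₁, P₂ => (fun t => (t ^ m₁, P₁.eval t), fun t => (P₂.eval t, t ^ m₂))
  | .same, m₁, m₂, P₁, P₂ => (fun t => (t ^ m₁, P₁.eval t), fun t => (t ^ m₂, P₂.eval t))

/-- All exponents of `P` exceed `k`. -/
def Above (k : ℕ) (P : ℂ[X]) : Prop := ∀ j ∈ P.support, k < j

/-- `P = ∑ a_{1j} t ^ j` over `j > k` with `(j, j) ∉ M` and `F₁(j, j) = ∅`. -/
def Tail₁ (Λ : Set (ℕ × ℕ)) (k : ℕ) (P : ℂ[X]) : Prop :=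
  ∀ j ∈ P.support, k < j ∧ (j, j) ∉ maximalPoints Λ ∧ fibre₁ Λ (j, j) = ∅

/-- `P = ∑ a_{2j} t ^ j` over `j > k` with `F₂(j, j) = ∅`. -/
def Tail₂ (Λ : Set (ℕ × ℕ)) (k : ℕ) (P : ℂ[X]) : Prop :=
  ∀ j ∈ P.support, k < j ∧ fibre₂ Λ (j, j) = ∅

/-- Exponent `j` is admissible on the first branch: `j > m` and `F₁(j, j) = ∅`. -/
def Adm₁ (Λ : Set (ℕ × ℕ)) (m j : ℕ) : Prop := m < j ∧ fibre₁ Λ (j, j) = ∅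

/-- Exponent `j` is admissible on the second branch: `j > m` and `F₂(j, j) = ∅`. -/
def Adm₂ (Λ : Set (ℕ × ℕ)) (m j : ℕ) : Prop := m < j ∧ fibre₂ Λ (j, j) = ∅

/-- Forms a) and a'): the first branch is `(t ^ m₁, t ^ j₁ + t ^ k + ∑ a_{1j} t ^ j)`, the second
one is given by `∑ a_{2j} t ^ j`. -/
def FormA (Λ : Set (ℕ × ℕ)) (m₁ m₂ : ℕ) (P₁ P₂ : ℂ[X]) : Prop :=
  ∃ (j₁ k : ℕ) (R : ℂ[X]), j₁ < k ∧ Adm₁ Λ m₁ j₁ ∧ Adm₁ Λ m₁ k ∧ Tail₁ Λ k R ∧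
    P₁ = X ^ j₁ + X ^ k + R ∧ Tail₂ Λ m₂ P₂

/-- The list of normal forms: a), b), c), d) for distinct tangents, a'), b'), c'), d') for the
same tangent. -/
def Listed : Tangents → Set (ℕ × ℕ) → ℕ → ℕ → ℂ[X] → ℂ[X] → Prop
  | .distinct, Λ, m₁, m₂, P₁, P₂ =>
      FormA Λ m₁ m₂ P₁ P₂ ∨
      (∃ j₁ j₂ : ℕ, Adm₁ Λ m₁ j₁ ∧ Adm₂ Λ m₂ j₂ ∧ P₁ = X ^ j₁ ∧ P₂ = X ^ j₂) ∨
      (∃ j₁ : ℕ, Adm₁ Λ m₁ j₁ ∧ P₁ = X ^ j₁ ∧ m₂ = 1 ∧ P₂ = 0) ∨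
      (m₁ = 1 ∧ P₁ = 0 ∧ m₂ = 1 ∧ P₂ = 0)
  | .same, Λ, m₁, m₂, P₁, P₂ =>
      FormA Λ m₁ m₂ P₁ P₂ ∨
      (∃ j₁ j₂ : ℕ, Adm₁ Λ m₁ j₁ ∧ Adm₂ Λ m₂ j₂ ∧ P₁ = X ^ j₁ ∧ P₂ = X ^ j₂ ∧
        (m₁ ≠ m₂ ∨ j₁ ≠ j₂)) ∨
      (∃ (j₁ : ℕ) (a : ℂ), Adm₁ Λ m₁ j₁ ∧ Adm₂ Λ m₂ j₁ ∧ m₂ = m₁ ∧ a ≠ 0 ∧ a ≠ 1 ∧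
        P₁ = X ^ j₁ ∧ P₂ = C a * X ^ j₁) ∨
      (∃ j₁ : ℕ, Adm₁ Λ m₁ j₁ ∧ P₁ = X ^ j₁ ∧ m₂ = 1 ∧ P₂ = 0)

/-- `P = t ^ j + t ^ k + (higher terms)` with `j < k`. -/
def TwoOnes (P : ℂ[X]) : Prop :=
  ∃ (j k : ℕ) (R : ℂ[X]), j < k ∧ Above k R ∧ P = X ^ j + X ^ k + R

/-- Normalization of coefficients by homotheties for a fixed numbering of the branches: the
coefficients of the lowest terms of the first branch, then (if the first branch has fewer than two
terms) of the second branch, are `1`, two of them whenever this is possible. -/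
def Normalized : Tangents → ℕ → ℕ → ℂ[X] → ℂ[X] → Prop
  | .distinct, m₁, m₂, P₁, P₂ =>
      TwoOnes P₁ ∨
      (∃ j₁ : ℕ, P₁ = X ^ j₁ ∧
        ((∃ (j₂ : ℕ) (R : ℂ[X]), Above j₂ R ∧ P₂ = X ^ j₂ + R) ∨ (m₂ = 1 ∧ P₂ = 0))) ∨
      (m₁ = 1 ∧ P₁ = 0 ∧
        (TwoOnes P₂ ∨ (∃ j₂ : ℕ, P₂ = X ^ j₂) ∨ (m₂ = 1 ∧ P₂ = 0)))
  | .same, m₁, m₂, P₁, P₂ =>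
      TwoOnes P₁ ∨
      (∃ j₁ : ℕ, P₁ = X ^ j₁ ∧
        ((∃ (j₂ : ℕ) (R : ℂ[X]), j₁ * m₂ ≠ j₂ * m₁ ∧ Above j₂ R ∧ P₂ = X ^ j₂ + R) ∨
         (∃ (j₂ k : ℕ) (a : ℂ) (R : ℂ[X]), j₁ * m₂ = j₂ * m₁ ∧ a ≠ 0 ∧ j₂ < k ∧ Above k R ∧
            P₂ = C a * X ^ j₂ + X ^ k + R) ∨
         (∃ a : ℂ, m₂ = m₁ ∧ a ≠ 0 ∧ a ≠ 1 ∧ P₂ = C a * X ^ j₁) ∨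
         (m₂ = 1 ∧ P₂ = 0))) ∨
      (m₁ = 1 ∧ P₁ = 0 ∧ (TwoOnes P₂ ∨ ∃ j₂ : ℕ, P₂ = X ^ j₂))

/-- How `ρ₁ = α t₁`, `ρ₂ = β t₂`, `σ = (α ^ m₁ x, α ^ j₁ y)` must be related to preserve the
forms a) and a') with exponents `m₁, m₂, j₁, k`: `α ^ (k - j₁) = 1`, and `β` is a choice of
`α ^ (j₁ / m₂)` in case a), of `α ^ (m₁ / m₂)` in case a'). -/
def Residual : Tangents → ℕ → ℕ → ℕ → ℕ → ℂ → ℂ → Prop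
  | .distinct, _, m₂, j₁, k, α, β => α ^ (k - j₁) = 1 ∧ β ^ m₂ = α ^ j₁
  | .same, m₁, m₂, j₁, k, α, β => α ^ (k - j₁) = 1 ∧ β ^ m₂ = α ^ m₁

/-- The relation between the coefficients `a_{ij}` (of `R`, `P`) and `b_{ij}` (of `R'`, `P'`):
`a_{1j} α ^ (j₁ - j) = b_{1j}`, and `a_{2j} α ^ m₁ β ^ (-j) = b_{2j}` in case a),
`a_{2j} α ^ j₁ β ^ (-j) = b_{2j}` in case a'). -/
def CoeffRel : Tangents → ℕ → ℕ → ℂ → ℂ → ℂ[X] → ℂ[X] → ℂ[X] → ℂ[X] → Prop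
  | .distinct, m₁, j₁, α, β, R, P, R', P' => ∀ j : ℕ,
      R.coeff j * α ^ ((j₁ : ℤ) - j) = R'.coeff j ∧
      P.coeff j * (α ^ m₁ * β ^ (-(j : ℤ))) = P'.coeff j
  | .same, _, j₁, α, β, R, P, R', P' => ∀ j : ℕ,
      R.coeff j * α ^ ((j₁ : ℤ) - j) = R'.coeff j ∧
      P.coeff j * (α ^ j₁ * β ^ (-(j : ℤ))) = P'.coeff j

end

end TwoBranch

namespace TwoBranch

open Filter Topology Polynomial

noncomputable section

/-! ### Taylor series of germs of functions of one variable -/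

/-! Infinitesimally, a vector field `-B ∂/∂x + A ∂/∂y` moves a branch `(t ^ m, y)` in two ways:
tangentially, which a reparametrization undoes, and transversally, which changes `y`. The
displacement of `y` is the pull-back of the dual form `A dx + B dy` divided by `m t ^ (m - 1)`, so
its order is exactly the corresponding coordinate of `ν(ω) - m`. A point `v` of `Λ[δ]` is therefore
a one-parameter move inside the equivalence class that alters the two branches first in degrees
`v.1` and `v.2` (`exists_move`). The conditions defining `Ω[δ]` make the flow tangent to the
identity or, for a common tangent, to a shear `(x - β y, y)`, so that Puiseux form, `Γ` and `Λ[δ]`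
survive.

Elimination then goes degree by degree. A point of `F₁(j, j)` removes the coefficient of `t ^ j` on
the first branch and leaves that of the second alone; `F₂` does the converse; a point `(j, j)` of
`M` moves both coefficients at once and can remove only one, by convention the first
(`exists_reducedAt`). After finitely many degrees the rest is discarded: pairs of germs of high
order come from functions on the plane (`exists_hasConductor`), so high order terms are absorbed by
a coordinate change (`tequiv_of_high_order`). Homotheties preserve supports and normalize two
coefficients whenever possible (`exists_normalized`); primitivity and distinctness of the branches
control the degenerate cases. If only the second branch has two terms, the branches are exchanged.

For `ℋ`-equivalence the argument is reversed. Once a homothety has been divided out, `σ` is tangent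
to the identity; its logarithm is a vector field, and the values of the dual form detect the first
degree in which the two bigerms differ (`exists_mem_values`). That degree would produce a point of
`F₁`, `F₂` or `M` forbidden by the reduced form (`eq_of_carries_unipotent`). Only homotheties
remain, and these are compared coefficient by coefficient.

Convergence of flows and logarithms never enters. Both are replaced by finite sums of powers of an
operator that raises the order of power series: modulo a power of `X`, the truncated exponential of
a derivation is a substitution (`opSum_exp_eq_subst`) and the truncated logarithm of a substitution
is a derivation (`opSum_log_eq_vecField`). `perturbed_sum_succ` compares, to first order, such a sum
in the plane with the one on a branch. -/

/-- The Taylor series at `0`. -/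
def taylor (f : ℂ → ℂ) : PowerSeries ℂ :=
  PowerSeries.mk fun n => iteratedDeriv n f 0 / (n.factorial : ℂ)

theorem coeff_taylor (f : ℂ → ℂ) (n : ℕ) :
    PowerSeries.coeff n (taylor f) = iteratedDeriv n f 0 / (n.factorial : ℂ) := by
  simp [taylor]

theorem constantCoeff_taylor (f : ℂ → ℂ) : PowerSeries.constantCoeff (taylor f) = f 0 := by
  rw [← PowerSeries.coeff_zero_eq_constantCoeff_apply, coeff_taylor]; simp

theorem coeff_one_taylor (f : ℂ → ℂ) : PowerSeries.coeff 1 (taylor f) = deriv f 0 := by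
  rw [coeff_taylor]; simp

theorem taylor_congr {f g : ℂ → ℂ} (h : f =ᶠ[𝓝 0] g) : taylor f = taylor g := by
  ext n; rw [coeff_taylor, coeff_taylor, h.iteratedDeriv_eq]

theorem taylor_add {f g : ℂ → ℂ} (hf : AnalyticAt ℂ f 0) (hg : AnalyticAt ℂ g 0) :
    taylor (fun t => f t + g t) = taylor f + taylor g := by
  ext n
  rw [map_add, coeff_taylor, coeff_taylor, coeff_taylor, ← add_div]
  congr 1
  exact iteratedDeriv_add hf.contDiffAt hg.contDiffAt

theorem taylor_const_mul (c : ℂ) (f : ℂ → ℂ) : taylor (fun t => c * f t) = c • taylor f := by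
  ext n
  rw [PowerSeries.coeff_smul, coeff_taylor, coeff_taylor, iteratedDeriv_const_mul_field, smul_eq_mul,
    mul_div_assoc]

theorem taylor_neg (f : ℂ → ℂ) : taylor (fun t => - f t) = - taylor f := by
  have := taylor_const_mul (-1) f
  simpa using this

theorem taylor_sub {f g : ℂ → ℂ} (hf : AnalyticAt ℂ f 0) (hg : AnalyticAt ℂ g 0) :
    taylor (fun t => f t - g t) = taylor f - taylor g := by
  simp only [sub_eq_add_neg]
  rw [taylor_add hf (g := fun t => - g t) hg.neg, taylor_neg]

theorem taylor_mul {f g : ℂ → ℂ} (hf : AnalyticAt ℂ f 0) (hg : AnalyticAt ℂ g 0) :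
    taylor (fun t => f t * g t) = taylor f * taylor g := by
  ext n
  rw [PowerSeries.coeff_mul, coeff_taylor]
  have h : iteratedDeriv n (fun t => f t * g t) 0 = _ :=
    iteratedDeriv_mul (n := n) hf.contDiffAt hg.contDiffAt
  rw [h, Finset.Nat.sum_antidiagonal_eq_sum_range_succ_mk, Finset.sum_div]
  refine Finset.sum_congr rfl fun i hi => ?_
  have hi' : i ≤ n := Nat.lt_succ_iff.mp (Finset.mem_range.mp hi)
  simp only [coeff_taylor]
  have h1 : (i.factorial : ℂ) ≠ 0 := by exact_mod_cast i.factorial_ne_zero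
  have h2 : ((n - i).factorial : ℂ) ≠ 0 := by exact_mod_cast (n - i).factorial_ne_zero
  have h3 : (n.factorial : ℂ) ≠ 0 := by exact_mod_cast n.factorial_ne_zero
  have h4 : (n.choose i : ℂ) * i.factorial * (n - i).factorial = n.factorial := by
    exact_mod_cast Nat.choose_mul_factorial_mul_factorial hi'
  field_simp
  rw [← h4]; ring

theorem taylor_const (c : ℂ) : taylor (fun _ => c) = PowerSeries.C c := by
  ext n
  rw [coeff_taylor, iteratedDeriv_const, PowerSeries.coeff_C]
  split_ifs with h <;> simp [h]

theorem taylor_id : taylor (fun t => t) = PowerSeries.X := by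
  ext n
  rw [coeff_taylor, PowerSeries.coeff_X]
  rcases n with _ | _ | n
  · simp
  · simp
  · rw [iteratedDeriv_succ']
    have : deriv (fun t : ℂ => t) = fun _ => 1 := by ext; simp
    rw [this, iteratedDeriv_const]; simp

theorem taylor_pow {f : ℂ → ℂ} (hf : AnalyticAt ℂ f 0) (n : ℕ) :
    taylor (fun t => f t ^ n) = taylor f ^ n := by
  induction n with
  | zero => simpa using taylor_const 1
  | succ n ih => simp only [pow_succ]; rw [taylor_mul (f := fun t => f t ^ n) (hf.pow n) hf, ih]

theorem taylor_id_pow (n : ℕ) : taylor (fun t => t ^ n) = PowerSeries.X ^ n := by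
  rw [taylor_pow (f := fun t => t) analyticAt_id, taylor_id]

theorem analyticAt_polynomial_eval (P : ℂ[X]) (z : ℂ) : AnalyticAt ℂ (fun t => P.eval t) z := by
  simpa using AnalyticAt.aeval_polynomial (𝕜 := ℂ) (f := fun t : ℂ => t) analyticAt_id P

theorem taylor_polynomial (P : ℂ[X]) : taylor (fun t => P.eval t) = (P : PowerSeries ℂ) := by
  induction P using Polynomial.induction_on' with
  | add p q hp hq =>
    simp only [eval_add, Polynomial.coe_add]
    rw [taylor_add (analyticAt_polynomial_eval p 0) (analyticAt_polynomial_eval q 0), hp, hq]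
  | monomial n a =>
    simp only [eval_monomial]
    rw [taylor_const_mul, taylor_id_pow, Polynomial.coe_monomial, PowerSeries.monomial_eq_mk]
    ext k
    simp [PowerSeries.coeff_X_pow]

theorem taylor_deriv (f : ℂ → ℂ) : taylor (deriv f) = PowerSeries.derivative ℂ (taylor f) := by
  ext n
  rw [PowerSeries.coeff_derivative, coeff_taylor, coeff_taylor, iteratedDeriv_succ',
    Nat.factorial_succ]
  have h3 : (n.factorial : ℂ) ≠ 0 := by exact_mod_cast n.factorial_ne_zero
  have h4 : (n : ℂ) + 1 ≠ 0 := by exact_mod_cast n.succ_ne_zero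
  push_cast
  field_simp

theorem le_ord_iff {f : ℂ → ℂ} (hf : AnalyticAt ℂ f 0) {n : ℕ} :
    (n : ℕ∞) ≤ ord f ↔ PowerSeries.X ^ n ∣ taylor f := by
  rw [ord, natCast_le_analyticOrderAt_iff_iteratedDeriv_eq_zero hf, PowerSeries.X_pow_dvd_iff]
  refine forall₂_congr fun i _ => ?_
  rw [coeff_taylor, div_eq_zero_iff]
  simp [Nat.factorial_ne_zero]

theorem ord_eq_iff {f : ℂ → ℂ} (hf : AnalyticAt ℂ f 0) {n : ℕ} :
    ord f = n ↔ PowerSeries.X ^ n ∣ taylor f ∧ PowerSeries.coeff n (taylor f) ≠ 0 := by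
  rw [← le_ord_iff hf]
  constructor
  · intro h
    refine ⟨h.ge, fun h0 => ?_⟩
    have h1 : ((n + 1 : ℕ) : ℕ∞) ≤ ord f := by
      rw [le_ord_iff hf, PowerSeries.X_pow_dvd_iff]
      intro m hm
      rcases Nat.lt_succ_iff_lt_or_eq.mp hm with h2 | rfl
      · exact PowerSeries.X_pow_dvd_iff.mp ((le_ord_iff hf).mp h.ge) m h2
      · exact h0
    rw [h] at h1
    exact absurd (by exact_mod_cast h1) (Nat.not_succ_le_self n)
  · rintro ⟨h1, h2⟩
    refine le_antisymm ?_ h1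
    by_contra h3
    push Not at h3
    have h4 : ((n + 1 : ℕ) : ℕ∞) ≤ ord f := by
      push_cast; exact Order.add_one_le_of_lt h3
    rw [le_ord_iff hf, PowerSeries.X_pow_dvd_iff] at h4
    exact h2 (h4 n (Nat.lt_succ_self n))

theorem eventuallyEq_zero_of_taylor {f : ℂ → ℂ} (hf : AnalyticAt ℂ f 0) (h : taylor f = 0) :
    f =ᶠ[𝓝 0] 0 := by
  have : ord f = ⊤ := by
    rw [ENat.eq_top_iff_forall_ge]
    intro n
    rw [le_ord_iff hf, h]; exact dvd_zero _
  exact analyticOrderAt_eq_top.mp this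

theorem exists_eq_pow_mul {f : ℂ → ℂ} (hf : AnalyticAt ℂ f 0) {n : ℕ}
    (h : PowerSeries.X ^ n ∣ taylor f) :
    ∃ g : ℂ → ℂ, AnalyticAt ℂ g 0 ∧ (f =ᶠ[𝓝 0] fun t => t ^ n * g t) ∧
      taylor f = PowerSeries.X ^ n * taylor g := by
  obtain ⟨g, hg, h'⟩ := (natCast_le_analyticOrderAt hf).mp ((le_ord_iff hf).mpr h)
  have h2 : f =ᶠ[𝓝 0] fun t => t ^ n * g t := by
    filter_upwards [h'] with t ht
    simpa using ht
  refine ⟨g, hg, h2, ?_⟩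
  rw [taylor_congr h2, taylor_mul (f := fun t => t ^ n) (by fun_prop) hg, taylor_id_pow]

theorem hasSubst_taylor {ρ : ℂ → ℂ} (h0 : ρ 0 = 0) : PowerSeries.HasSubst (taylor ρ) :=
  PowerSeries.HasSubst.of_constantCoeff_zero' (by rw [constantCoeff_taylor, h0])

theorem X_dvd_taylor {ρ : ℂ → ℂ} (h0 : ρ 0 = 0) : PowerSeries.X ∣ taylor ρ := by
  rw [PowerSeries.X_dvd_iff, constantCoeff_taylor, h0]

theorem eq_of_forall_X_pow_dvd_sub {a b : PowerSeries ℂ}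
    (h : ∀ n : ℕ, PowerSeries.X ^ n ∣ a - b) : a = b := by
  ext n
  have := PowerSeries.X_pow_dvd_iff.mp (h (n + 1)) n (Nat.lt_succ_self n)
  rw [map_sub, sub_eq_zero] at this
  exact this

theorem subst_X_pow_dvd {a : PowerSeries ℂ} (ha : PowerSeries.X ∣ a) {n : ℕ} {f : PowerSeries ℂ}
    (h : PowerSeries.X ^ n ∣ f) : PowerSeries.X ^ n ∣ f.subst a := by
  have hs : PowerSeries.HasSubst a :=
    PowerSeries.HasSubst.of_constantCoeff_zero' (PowerSeries.X_dvd_iff.mp ha)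
  obtain ⟨g, rfl⟩ := h
  rw [PowerSeries.subst_mul hs, PowerSeries.subst_pow hs, PowerSeries.subst_X hs]
  exact (pow_dvd_pow_of_dvd ha n).mul_right _

/-- Both sides are compared modulo every `X ^ n`: for the polynomial truncation of `f` the identity
is algebraic, and the remainder `t ^ n * g` contributes a multiple of `taylor ρ ^ n` to each side.
-/
theorem taylor_comp {f ρ : ℂ → ℂ} (hf : AnalyticAt ℂ f 0) (hρ : AnalyticAt ℂ ρ 0) (h0 : ρ 0 = 0) :
    taylor (fun t => f (ρ t)) = (taylor f).subst (taylor ρ) := by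
  have hs := hasSubst_taylor h0
  refine eq_of_forall_X_pow_dvd_sub fun n => ?_
  -- write `f` as a polynomial plus `t ^ n * g`
  set P : ℂ[X] := PowerSeries.trunc n (taylor f) with hP
  have hd : PowerSeries.X ^ n ∣ taylor (fun t => f t - P.eval t) := by
    rw [taylor_sub hf (analyticAt_polynomial_eval P 0), taylor_polynomial, PowerSeries.X_pow_dvd_iff]
    intro m hm
    rw [map_sub, Polynomial.coeff_coe, hP, PowerSeries.coeff_trunc, if_pos hm, sub_self]
  obtain ⟨g, hg, hfg, hfg'⟩ :=
    exists_eq_pow_mul (hf.fun_sub (analyticAt_polynomial_eval P 0)) hd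
  rw [taylor_sub hf (analyticAt_polynomial_eval P 0), taylor_polynomial, sub_eq_iff_eq_add] at hfg'
  have hgρ : AnalyticAt ℂ (fun t => g (ρ t)) 0 :=
    AnalyticAt.fun_comp (g := g) (f := ρ) (by rwa [h0]) hρ
  have hPρ : taylor (fun t => P.eval (ρ t)) = (P : PowerSeries ℂ).subst (taylor ρ) := by
    rw [PowerSeries.subst_coe hs]
    clear_value P
    clear hP hd hfg hfg'
    induction P using Polynomial.induction_on' with
    | add p q hp hq =>
      simp only [eval_add, map_add]
      rw [taylor_add, hp, hq]
      · exact AnalyticAt.fun_comp (g := fun t => p.eval t) (analyticAt_polynomial_eval p _) hρ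
      · exact AnalyticAt.fun_comp (g := fun t => q.eval t) (analyticAt_polynomial_eval q _) hρ
    | monomial k a =>
      simp only [eval_monomial, Polynomial.aeval_monomial]
      rw [taylor_const_mul, taylor_pow hρ, Algebra.smul_def]
  have ht : Tendsto ρ (𝓝 0) (𝓝 0) := by simpa [h0] using hρ.continuousAt.tendsto
  have e : (fun t => f (ρ t)) =ᶠ[𝓝 0] fun t => ρ t ^ n * g (ρ t) + P.eval (ρ t) := by
    filter_upwards [ht.eventually hfg] with t ht
    rw [← ht]; ring
  rw [taylor_congr e, taylor_add (f := fun t => ρ t ^ n * g (ρ t)) ((hρ.pow n).mul hgρ)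
    (AnalyticAt.fun_comp (g := fun t => P.eval t) (analyticAt_polynomial_eval P _) hρ),
    taylor_mul (f := fun t => ρ t ^ n) (hρ.pow n) hgρ, taylor_pow hρ, hPρ, hfg',
    PowerSeries.subst_add hs, PowerSeries.subst_mul hs, PowerSeries.subst_pow hs,
    PowerSeries.subst_X hs, add_sub_add_right_eq_sub]
  refine dvd_sub ?_ ?_
  · exact (pow_dvd_pow_of_dvd (X_dvd_taylor h0) n).mul_right _
  · exact (pow_dvd_pow_of_dvd (X_dvd_taylor h0) n).mul_right _

theorem taylor_sum {ι : Type*} (s : Finset ι) {f : ι → ℂ → ℂ} (hf : ∀ i ∈ s, AnalyticAt ℂ (f i) 0) :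
    taylor (fun t => ∑ i ∈ s, f i t) = ∑ i ∈ s, taylor (f i) := by
  classical
  induction s using Finset.induction_on with
  | empty => simpa using taylor_const 0
  | insert i s hi ih =>
    simp only [Finset.sum_insert hi]
    rw [taylor_add (hf i (by simp)) (Finset.analyticAt_fun_sum _ fun j hj => hf j (by simp [hj])),
      ih fun j hj => hf j (by simp [hj])]

/-! ### Unipotent operators on formal power series -/

/-- A linear operator on power series that raises the order. -/
def Raises (D : Module.End ℂ (PowerSeries ℂ)) : Prop :=
  ∀ (n : ℕ) (f : PowerSeries ℂ), PowerSeries.X ^ n ∣ f → PowerSeries.X ^ (n + 1) ∣ D f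

theorem Raises.pow {D : Module.End ℂ (PowerSeries ℂ)} (hD : Raises D) (a n : ℕ) {f : PowerSeries ℂ}
    (h : PowerSeries.X ^ n ∣ f) : PowerSeries.X ^ (n + a) ∣ (D ^ a) f := by
  induction a with
  | zero => simpa using h
  | succ a ih =>
    rw [pow_succ', Module.End.mul_apply]
    exact hD _ _ ih

theorem Raises.pow_dvd {D : Module.End ℂ (PowerSeries ℂ)} (hD : Raises D) {a n : ℕ} (h : n ≤ a)
    (f : PowerSeries ℂ) : PowerSeries.X ^ n ∣ (D ^ a) f :=
  (pow_dvd_pow _ h).trans (by simpa using hD.pow a 0 (f := f) (by simp))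

/-- Truncated series `∑ cₙ Dⁿ`. -/
def opSum (c : ℕ → ℂ) (K : ℕ) (D : Module.End ℂ (PowerSeries ℂ)) : Module.End ℂ (PowerSeries ℂ) :=
  ∑ n ∈ Finset.range (K + 1), c n • D ^ n

theorem opSum_apply (c : ℕ → ℂ) (K : ℕ) (D : Module.End ℂ (PowerSeries ℂ)) (f : PowerSeries ℂ) :
    opSum c K D f = ∑ n ∈ Finset.range (K + 1), c n • (D ^ n) f := by
  simp [opSum, LinearMap.sum_apply]

theorem Raises.dvd_opSum {D : Module.End ℂ (PowerSeries ℂ)} (hD : Raises D) (c : ℕ → ℂ) (K : ℕ)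
    {n : ℕ} {f : PowerSeries ℂ} (h : PowerSeries.X ^ n ∣ f) : PowerSeries.X ^ n ∣ opSum c K D f := by
  rw [opSum_apply]
  refine Finset.dvd_sum fun a _ => dvd_smul_of_dvd _ ?_
  exact (pow_dvd_pow _ (Nat.le_add_right n a)).trans (hD.pow a n h)

/-- A linear operator on power series is not determined by its values on monomials. Stability of the
ideal `(X ^ M)` replaces continuity: it allows a series to be truncated to a finite combination of
monomials. -/
theorem dvd_sub_of_monomials {F G : Module.End ℂ (PowerSeries ℂ)} {M : ℕ}
    (h : ∀ n : ℕ, PowerSeries.X ^ M ∣ F (PowerSeries.X ^ n) - G (PowerSeries.X ^ n))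
    (hF : ∀ g, PowerSeries.X ^ M ∣ F (PowerSeries.X ^ M * g))
    (hG : ∀ g, PowerSeries.X ^ M ∣ G (PowerSeries.X ^ M * g)) (f : PowerSeries ℂ) :
    PowerSeries.X ^ M ∣ F f - G f := by
  have hd : PowerSeries.X ^ M ∣ f - (PowerSeries.trunc M f : PowerSeries ℂ) := by
    rw [PowerSeries.X_pow_dvd_iff]
    intro m hm
    rw [map_sub, Polynomial.coeff_coe, PowerSeries.coeff_trunc, if_pos hm, sub_self]
  obtain ⟨g, hg⟩ := hd
  rw [sub_eq_iff_eq_add] at hg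
  have hp : ∀ P : ℂ[X], PowerSeries.X ^ M ∣ F (P : PowerSeries ℂ) - G (P : PowerSeries ℂ) := by
    intro P
    induction P using Polynomial.induction_on' with
    | add p q hp hq =>
      rw [Polynomial.coe_add, map_add, map_add, add_sub_add_comm]
      exact dvd_add hp hq
    | monomial k a =>
      have : ((Polynomial.monomial k a : ℂ[X]) : PowerSeries ℂ) = a • PowerSeries.X ^ k := by
        rw [Polynomial.coe_monomial, PowerSeries.monomial_eq_mk]
        ext j
        simp [PowerSeries.coeff_X_pow]
      rw [this, map_smul, map_smul, ← smul_sub]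
      exact dvd_smul_of_dvd _ (h k)
  rw [hg, map_add, map_add, add_sub_add_comm]
  exact dvd_add (dvd_sub (hF g) (hG g)) (hp _)

/-- Every perturbation except the most recent one has been hit by `D` at least once, hence lies in
`(X ^ (p + 1))`. -/
theorem perturbed_iterate {D : Module.End ℂ (PowerSeries ℂ)} (hD : Raises D)
    {u r : ℕ → PowerSeries ℂ} (hu : ∀ n, u (n + 1) = D (u n) + r n) {p : ℕ}
    (hr : ∀ n, PowerSeries.X ^ p ∣ r n) (n : ℕ) :
    PowerSeries.X ^ (p + 1) ∣ u (n + 1) - ((D ^ (n + 1)) (u 0) + r n) := by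
  induction n with
  | zero => simp [hu 0]
  | succ n ih =>
    have e : u (n + 1 + 1) - ((D ^ (n + 1 + 1)) (u 0) + r (n + 1)) =
        D (u (n + 1) - ((D ^ (n + 1)) (u 0) + r n)) + D (r n) := by
      rw [hu (n + 1), pow_succ' D (n + 1), Module.End.mul_apply, map_sub, map_add]
      ring
    rw [e]
    exact dvd_add ((pow_dvd_pow _ (Nat.le_succ _)).trans (hD _ _ ih)) (hD _ _ (hr n))

theorem perturbed_sum {D : Module.End ℂ (PowerSeries ℂ)} (hD : Raises D)
    {u r : ℕ → PowerSeries ℂ} (hu : ∀ n, u (n + 1) = D (u n) + r n) {p : ℕ}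
    (hr : ∀ n, PowerSeries.X ^ p ∣ r n) (c : ℕ → ℂ) (K : ℕ) :
    PowerSeries.X ^ p ∣ ∑ n ∈ Finset.range (K + 1), c n • u n - opSum c K D (u 0) := by
  rw [opSum_apply, ← Finset.sum_sub_distrib]
  refine Finset.dvd_sum fun n _ => ?_
  rw [← smul_sub]
  refine dvd_smul_of_dvd _ ?_
  cases n with
  | zero => simp
  | succ n =>
    have h := perturbed_iterate hD hu hr n
    have := dvd_add ((pow_dvd_pow _ (Nat.le_succ p)).trans h) (hr n)
    convert this using 1
    ring

/-- The first order perturbation formula behind both the exponential and the logarithm. The term `r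
0` enters through `u 1` with weight `c 1 = 1`; in every later `u n` it has been raised by `D`, and
the other perturbations already have order `p + 1`. -/
theorem perturbed_sum_succ {D : Module.End ℂ (PowerSeries ℂ)} (hD : Raises D)
    {u r : ℕ → PowerSeries ℂ} (hu : ∀ n, u (n + 1) = D (u n) + r n) {p : ℕ}
    (hr0 : PowerSeries.X ^ p ∣ r 0) (hr : ∀ n, PowerSeries.X ^ (p + 1) ∣ r (n + 1)) {c : ℕ → ℂ}
    (hc : c 1 = 1) {K : ℕ} (hK : 0 < K) :
    PowerSeries.X ^ (p + 1) ∣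
      ∑ n ∈ Finset.range (K + 1), c n • u n - (opSum c K D (u 0) + r 0) := by
  have hr' : ∀ n, PowerSeries.X ^ p ∣ r n := by
    intro n
    cases n with
    | zero => exact hr0
    | succ n => exact (pow_dvd_pow _ (Nat.le_succ p)).trans (hr n)
  obtain ⟨K, rfl⟩ : ∃ K', K = K' + 1 := ⟨K - 1, by omega⟩
  -- `r 0` is placed at index `1`, which occurs in the range because `K` is positive.
  have e : r 0 = ∑ n ∈ Finset.range (K + 1 + 1), if n = 1 then r 0 else 0 := by
    simp
  rw [opSum_apply, e, ← Finset.sum_add_distrib, ← Finset.sum_sub_distrib]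
  refine Finset.dvd_sum fun n _ => ?_
  rcases n with _ | _ | n
  · simp
  · have h := perturbed_iterate hD hu hr' 0
    simpa [hc] using h
  · have h := dvd_add (perturbed_iterate hD hu hr' (n + 1)) (hr n)
    simp only [Nat.add_eq_zero_iff, one_ne_zero, and_false, Nat.add_eq_right, if_false, add_zero]
    rw [← smul_sub]
    refine dvd_smul_of_dvd _ ?_
    convert h using 1
    ring

/-! ### Truncated exponentials of derivations -/

/-- The derivation `e d/dX`. -/
def vecField (e : PowerSeries ℂ) : Module.End ℂ (PowerSeries ℂ) :=
  LinearMap.mulLeft ℂ e ∘ₗ (PowerSeries.derivative ℂ).toLinearMap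

theorem vecField_apply (e f : PowerSeries ℂ) :
    vecField e f = e * PowerSeries.derivative ℂ f := rfl

theorem vecField_mul (e f g : PowerSeries ℂ) :
    vecField e (f * g) = vecField e f * g + f * vecField e g := by
  simp only [vecField_apply, Derivation.leibniz, smul_eq_mul]; ring

theorem X_pow_dvd_derivative {n : ℕ} {f : PowerSeries ℂ} (h : PowerSeries.X ^ (n + 1) ∣ f) :
    PowerSeries.X ^ n ∣ PowerSeries.derivative ℂ f := by
  rw [PowerSeries.X_pow_dvd_iff] at h ⊢
  intro m hm
  rw [PowerSeries.coeff_derivative, h (m + 1) (by omega), zero_mul]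

theorem raises_vecField {e : PowerSeries ℂ} (he : PowerSeries.X ^ 2 ∣ e) : Raises (vecField e) := by
  intro n f h
  rw [vecField_apply]
  cases n with
  | zero => exact ((pow_dvd_pow _ (by omega)).trans he).mul_right _
  | succ n =>
    have := mul_dvd_mul he (X_pow_dvd_derivative h)
    rwa [← pow_add, show 2 + n = n + 1 + 1 by ring] at this

theorem leibniz_pow {D : Module.End ℂ (PowerSeries ℂ)}
    (hD : ∀ f g, D (f * g) = D f * g + f * D g) (n : ℕ) (f g : PowerSeries ℂ) :
    (D ^ n) (f * g) =
      ∑ ij ∈ Finset.HasAntidiagonal.antidiagonal n, (n.choose ij.1 : PowerSeries ℂ) * ((D ^ ij.1) f * (D ^ ij.2) g) := by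
  induction n with
  | zero => simp
  | succ n ih =>
    rw [Finset.sum_antidiagonal_choose_succ_mul (fun i j => (D ^ i) f * (D ^ j) g), pow_succ',
      Module.End.mul_apply, ih, map_sum, ← Finset.sum_add_distrib]
    refine Finset.sum_congr rfl fun ij hij => ?_
    have hs : (n.choose ij.2 : PowerSeries ℂ) = n.choose ij.1 := by
      rw [← Finset.HasAntidiagonal.mem_antidiagonal.mp hij, Nat.choose_symm_add]
    have hc : ∀ (k : ℕ) (h : PowerSeries ℂ), D ((k : PowerSeries ℂ) * h) = k * D h := by
      intro k h
      rw [← nsmul_eq_mul, map_nsmul, nsmul_eq_mul]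
    rw [hs, hc, hD, pow_succ' D ij.1, pow_succ' D ij.2, Module.End.mul_apply, Module.End.mul_apply]
    ring

/-- Coefficients of the exponential series. -/
def expCoeff (n : ℕ) : ℂ := (n.factorial : ℂ)⁻¹

/-- The product of the two truncated sums exceeds the truncated sum of the product by the terms `(Dⁱ
f / i!) (Dʲ g / j!)` with `i + j > K`, each divisible by `X ^ (i + j)`. -/
theorem opSum_exp_mul {D : Module.End ℂ (PowerSeries ℂ)} (hR : Raises D)
    (hD : ∀ f g, D (f * g) = D f * g + f * D g) (K : ℕ) (f g : PowerSeries ℂ) :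
    PowerSeries.X ^ (K + 1) ∣
      opSum expCoeff K D (f * g) - opSum expCoeff K D f * opSum expCoeff K D g := by
  set F : ℕ × ℕ → PowerSeries ℂ := fun ij =>
    (expCoeff ij.1 • (D ^ ij.1) f) * (expCoeff ij.2 • (D ^ ij.2) g) with hF
  have h1 : opSum expCoeff K D (f * g) =
      ∑ n ∈ Finset.range (K + 1), ∑ ij ∈ Finset.HasAntidiagonal.antidiagonal n, F ij := by
    rw [opSum_apply]
    refine Finset.sum_congr rfl fun n _ => ?_
    rw [leibniz_pow hD, Finset.smul_sum]
    refine Finset.sum_congr rfl fun ij hij => ?_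
    have hn := Finset.HasAntidiagonal.mem_antidiagonal.mp hij
    have h1 : (ij.1.factorial : ℂ) ≠ 0 := by exact_mod_cast ij.1.factorial_ne_zero
    have h2 : (ij.2.factorial : ℂ) ≠ 0 := by exact_mod_cast ij.2.factorial_ne_zero
    have h3 : (n.factorial : ℂ) ≠ 0 := by exact_mod_cast n.factorial_ne_zero
    have h4 : (n.choose ij.1 : ℂ) * ij.1.factorial * ij.2.factorial = n.factorial := by
      rw [← hn, Nat.choose_symm_add]; exact_mod_cast Nat.add_choose_mul_factorial_mul_factorial ij.1 ij.2
    rw [hF]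
    simp only [expCoeff]
    rw [smul_mul_smul_comm, ← nsmul_eq_mul, ← Nat.cast_smul_eq_nsmul ℂ, smul_smul]
    congr 1
    field_simp
    rw [← h4]
  have h2 : opSum expCoeff K D f * opSum expCoeff K D g =
      ∑ ij ∈ Finset.range (K + 1) ×ˢ Finset.range (K + 1), F ij := by
    rw [opSum_apply, opSum_apply, Finset.sum_mul_sum, Finset.sum_product]
  have h3 : ∑ n ∈ Finset.range (K + 1), ∑ ij ∈ Finset.HasAntidiagonal.antidiagonal n, F ij =
      ∑ ij ∈ (Finset.range (K + 1) ×ˢ Finset.range (K + 1)).filter (fun ij : ℕ × ℕ => ij.1 + ij.2 < K + 1),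
        F ij := by
    rw [← Finset.sum_fiberwise_of_maps_to (t := Finset.range (K + 1)) (g := fun ij : ℕ × ℕ => ij.1 + ij.2)]
    · refine Finset.sum_congr rfl fun n hn => Finset.sum_congr ?_ fun _ _ => rfl
      have := Finset.mem_range.mp hn
      ext ij
      simp only [Finset.HasAntidiagonal.mem_antidiagonal, Finset.mem_filter, Finset.mem_product, Finset.mem_range]
      omega
    · intro ij hij
      exact Finset.mem_range.mpr (Finset.mem_filter.mp hij).2
  rw [h1, h2, h3, ← Finset.sum_filter_add_sum_filter_not
    (Finset.range (K + 1) ×ˢ Finset.range (K + 1)) (fun ij : ℕ × ℕ => ij.1 + ij.2 < K + 1)]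
  rw [sub_add_cancel_left, dvd_neg]
  refine Finset.dvd_sum fun ij hij => ?_
  have h5 : K + 1 ≤ ij.1 + ij.2 := by
    have := (Finset.mem_filter.mp hij).2
    omega
  have := mul_dvd_mul (dvd_smul_of_dvd (expCoeff ij.1) (hR.pow_dvd le_rfl f))
    (dvd_smul_of_dvd (expCoeff ij.2) (hR.pow_dvd le_rfl g)) (a := PowerSeries.X ^ ij.1)
    (c := PowerSeries.X ^ ij.2)
  rw [← pow_add] at this
  exact (pow_dvd_pow _ h5).trans this

/-- The truncated exponential of a vector field is a substitution. -/
theorem opSum_exp_eq_subst {e : PowerSeries ℂ} (he : PowerSeries.X ^ 2 ∣ e) (K : ℕ) :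
    ∃ a : PowerSeries ℂ, PowerSeries.X ^ 2 ∣ a - PowerSeries.X ∧
      ∀ f : PowerSeries ℂ, PowerSeries.X ^ (K + 1) ∣ opSum expCoeff K (vecField e) f - f.subst a := by
  have hR := raises_vecField he
  -- Multiplicativity modulo `X ^ (K + 1)` leaves no choice: the substituted series is the image of
  -- `X`, and agreement on powers of `X` follows by induction.
  set a := opSum expCoeff K (vecField e) PowerSeries.X with ha
  have ha2 : PowerSeries.X ^ 2 ∣ a - PowerSeries.X := by
    rw [ha, opSum_apply, Finset.sum_range_succ']
    have : expCoeff 0 • ((vecField e) ^ 0) PowerSeries.X = PowerSeries.X := by simp [expCoeff]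
    rw [this, add_sub_cancel_right]
    refine Finset.dvd_sum fun n _ => dvd_smul_of_dvd _ ?_
    have := hR.pow (n + 1) 1 (f := PowerSeries.X) (by simp)
    exact (pow_dvd_pow _ (by omega)).trans this
  have haX : PowerSeries.X ∣ a := by
    have := dvd_add ((Dvd.intro_left _ (pow_succ _ 1).symm).trans ha2) (dvd_refl PowerSeries.X)
    simpa using this
  have hs : PowerSeries.HasSubst a :=
    PowerSeries.HasSubst.of_constantCoeff_zero' (PowerSeries.X_dvd_iff.mp haX)
  refine ⟨a, ha2, fun f => ?_⟩
  have := dvd_sub_of_monomials (F := opSum expCoeff K (vecField e))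
    (G := (PowerSeries.substAlgHom hs).toLinearMap) (M := K + 1) ?_ ?_ ?_ f
  · simpa [PowerSeries.coe_substAlgHom] using this
  · intro n
    simp only [AlgHom.toLinearMap_apply, map_pow, PowerSeries.substAlgHom_X]
    induction n with
    | zero =>
      have : opSum expCoeff K (vecField e) 1 = 1 := by
        rw [opSum_apply, Finset.sum_range_succ']
        have h1 : ∀ n, ((vecField e) ^ (n + 1)) 1 = 0 := by
          intro n
          rw [pow_succ, Module.End.mul_apply, vecField_apply]
          simp
        simp [h1, expCoeff]
      simp [this]
    | succ n ih =>
      have h1 := opSum_exp_mul hR (vecField_mul e) K (PowerSeries.X ^ n) PowerSeries.X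
      rw [← ha] at h1
      have h2 := dvd_add h1 (ih.mul_right a)
      rw [pow_succ PowerSeries.X n, pow_succ a n]
      convert h2 using 1
      ring
  · intro g; exact hR.dvd_opSum _ _ (Dvd.intro _ rfl)
  · intro g
    simp only [AlgHom.toLinearMap_apply, PowerSeries.coe_substAlgHom]
    exact subst_X_pow_dvd haX (Dvd.intro _ rfl)

/-! ### Truncated logarithms of substitutions -/

/-- With `a = X (1 + X v)`, the power `a ^ n` agrees with `X ^ n` modulo `X ^ (n + 1)`, and
substitution does not change the constant term of the cofactor. -/
theorem subst_sub_self_raises {a : PowerSeries ℂ} (ha : PowerSeries.X ^ 2 ∣ a - PowerSeries.X)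
    (hs : PowerSeries.HasSubst a) :
    Raises ((PowerSeries.substAlgHom hs).toLinearMap - 1) := by
  obtain ⟨v, hv⟩ := ha
  have hav : a = PowerSeries.X * (1 + PowerSeries.X * v) := by
    rw [sub_eq_iff_eq_add] at hv; rw [hv]; ring
  have haX : PowerSeries.X ∣ a := ⟨_, hav⟩
  intro n f hf
  obtain ⟨g, rfl⟩ := hf
  simp only [LinearMap.sub_apply, AlgHom.toLinearMap_apply, Module.End.one_apply, map_mul, map_pow,
    PowerSeries.substAlgHom_X]
  have h1 : PowerSeries.X ∣ PowerSeries.substAlgHom hs g - g := by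
    rw [PowerSeries.X_dvd_iff, map_sub, PowerSeries.coe_substAlgHom]
    obtain ⟨h, hh⟩ : PowerSeries.X ∣ g - PowerSeries.C (PowerSeries.constantCoeff g) := by
      rw [PowerSeries.X_dvd_iff]; simp
    rw [sub_eq_iff_eq_add] at hh
    have hX := PowerSeries.X_dvd_iff.mp haX
    have : g.subst a = a * h.subst a + PowerSeries.C (PowerSeries.constantCoeff g) := by
      conv_lhs => rw [hh]
      rw [PowerSeries.subst_add hs, PowerSeries.subst_mul hs, PowerSeries.subst_X hs,
        PowerSeries.subst_C]
      rfl
    rw [this]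
    simp [hX]
  have h2 : PowerSeries.X ^ (n + 1) ∣ a ^ n - PowerSeries.X ^ n := by
    obtain ⟨w, hw⟩ := sub_dvd_pow_sub_pow (1 + PowerSeries.X * v) 1 n
    rw [one_pow, add_sub_cancel_left] at hw
    refine ⟨v * w, ?_⟩
    rw [hav, mul_pow]
    linear_combination PowerSeries.X ^ n * hw
  have h3 : PowerSeries.X ^ (n + 1) ∣
      PowerSeries.X ^ n * (PowerSeries.substAlgHom hs g - g) := by
    rw [pow_succ]; exact mul_dvd_mul_left _ h1
  have := dvd_add (h2.mul_right (PowerSeries.substAlgHom hs g)) h3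
  convert this using 1
  ring

/-- The polynomial `s ↦ s choose n`. -/
def binomPoly (n : ℕ) : ℂ[X] := C (n.factorial : ℂ)⁻¹ * descPochhammer ℂ n

theorem binomPoly_eval (n s : ℕ) : (binomPoly n).eval (s : ℂ) = s.choose n := by
  have h3 : (n.factorial : ℂ) ≠ 0 := by exact_mod_cast n.factorial_ne_zero
  rw [binomPoly, eval_mul, eval_C, descPochhammer_eval_eq_descFactorial,
    Nat.descFactorial_eq_factorial_mul_choose]
  push_cast
  field_simp

/-- Coefficients of the logarithmic series, as derivatives at `0` of binomial coefficients. -/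
def logCoeff (n : ℕ) : ℂ := (derivative (binomPoly n)).eval 0

theorem logCoeff_zero : logCoeff 0 = 0 := by simp [logCoeff, binomPoly]

theorem logCoeff_one : logCoeff 1 = 1 := by simp [logCoeff, binomPoly]

/-- Write `N = R - 1`. The coefficients of `R ^ s f = ∑ (s choose n) Nⁿ f` up to degree `K` are
polynomials in `s`, since `Nⁿ` raises the order by `n`. Multiplicativity of `R ^ s` for all natural
`s` is thus an identity of polynomials, and its derivative at `s = 0` is the Leibniz rule. -/
theorem opSum_log_mul (R : PowerSeries ℂ →ₐ[ℂ] PowerSeries ℂ) (hR : Raises (R.toLinearMap - 1))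
    (K : ℕ) (f g : PowerSeries ℂ) :
    PowerSeries.X ^ (K + 1) ∣ opSum logCoeff K (R.toLinearMap - 1) (f * g) -
      (opSum logCoeff K (R.toLinearMap - 1) f * g + f * opSum logCoeff K (R.toLinearMap - 1) g) := by
  set N : Module.End ℂ (PowerSeries ℂ) := R.toLinearMap - 1 with hN
  set P : PowerSeries ℂ → ℕ → ℂ[X] := fun f k =>
    ∑ n ∈ Finset.range (K + 1), C (PowerSeries.coeff k ((N ^ n) f)) * binomPoly n with hP
  have hPs : ∀ f, ∀ k ≤ K, ∀ s : ℕ,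
      (P f k).eval (s : ℂ) = PowerSeries.coeff k ((R.toLinearMap ^ s) f) := by
    intro f k hk s
    have e1 : R.toLinearMap = N + 1 := by rw [hN, sub_add_cancel]
    have h1 : PowerSeries.coeff k ((R.toLinearMap ^ s) f) =
        ∑ n ∈ Finset.range (s + 1), PowerSeries.coeff k ((N ^ n) f) * s.choose n := by
      rw [e1, (Commute.one_right N).add_pow, LinearMap.sum_apply, map_sum]
      refine Finset.sum_congr rfl fun n _ => ?_
      have : (N ^ n * 1 ^ (s - n) * (s.choose n : Module.End ℂ (PowerSeries ℂ))) f =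
          (s.choose n : ℂ) • (N ^ n) f := by
        rw [one_pow, mul_one, ← nsmul_eq_mul', LinearMap.smul_apply, Nat.cast_smul_eq_nsmul]
      rw [this, PowerSeries.coeff_smul, smul_eq_mul, mul_comm]
    have h2 : (P f k).eval (s : ℂ) =
        ∑ n ∈ Finset.range (K + 1), PowerSeries.coeff k ((N ^ n) f) * s.choose n := by
      rw [hP]
      simp only [eval_finsetSum, eval_mul, eval_C, binomPoly_eval]
    rw [h1, h2]
    have h3 : ∀ n, s < n → PowerSeries.coeff k ((N ^ n) f) * (s.choose n : ℂ) = 0 := by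
      intro n hn
      rw [Nat.choose_eq_zero_of_lt hn]; simp
    have h4 : ∀ n, K < n → PowerSeries.coeff k ((N ^ n) f) * (s.choose n : ℂ) = 0 := by
      intro n hn
      rw [PowerSeries.X_pow_dvd_iff.mp (hR.pow_dvd (le_refl n) f) k (by omega), zero_mul]
    have h5 : ∀ L, L ≤ K + s → (∀ n, L < n → PowerSeries.coeff k ((N ^ n) f) * (s.choose n : ℂ) = 0) →
        ∑ n ∈ Finset.range (L + 1), PowerSeries.coeff k ((N ^ n) f) * (s.choose n : ℂ) =
        ∑ n ∈ Finset.range (K + s + 1), PowerSeries.coeff k ((N ^ n) f) * (s.choose n : ℂ) := by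
      intro L hL h
      refine Finset.sum_subset (Finset.range_mono (by omega)) fun n _ hn => h n ?_
      rw [Finset.mem_range] at hn; omega
    rw [h5 K (by omega) h4, h5 s (by omega) h3]
  have hmul : ∀ k ≤ K, P (f * g) k = ∑ ij ∈ Finset.HasAntidiagonal.antidiagonal k, P f ij.1 * P g ij.2 := by
    intro k hk
    refine Polynomial.eq_of_infinite_eval_eq _ _ ?_
    refine Set.Infinite.mono (s := Set.range (Nat.cast : ℕ → ℂ)) ?_
      (Set.infinite_range_of_injective Nat.cast_injective)
    rintro _ ⟨s, rfl⟩
    rw [Set.mem_ofPred_eq, hPs _ k hk, eval_finsetSum]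
    have hRs : (R.toLinearMap ^ s) (f * g) = (R.toLinearMap ^ s) f * (R.toLinearMap ^ s) g := by
      induction s with
      | zero => simp
      | succ s ih =>
        rw [pow_succ', Module.End.mul_apply, ih, Module.End.mul_apply, Module.End.mul_apply]
        simp
    rw [hRs, PowerSeries.coeff_mul]
    refine Finset.sum_congr rfl fun ij hij => ?_
    have := Finset.HasAntidiagonal.mem_antidiagonal.mp hij
    rw [eval_mul, hPs _ _ (by omega), hPs _ _ (by omega)]
  have hder : ∀ f k, (derivative (P f k)).eval 0 = PowerSeries.coeff k (opSum logCoeff K N f) := by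
    intro f k
    rw [hP, opSum_apply]
    simp only [eval_finsetSum, derivative_C_mul, eval_mul, eval_C, map_sum,
      PowerSeries.coeff_smul, smul_eq_mul]
    exact Finset.sum_congr rfl fun n _ => mul_comm _ _
  have hzero : ∀ f, ∀ k ≤ K, (P f k).eval 0 = PowerSeries.coeff k f := by
    intro f k hk
    simpa using hPs f k hk 0
  rw [PowerSeries.X_pow_dvd_iff]
  intro k hk
  rw [map_sub, map_add, PowerSeries.coeff_mul, PowerSeries.coeff_mul, ← hder, hmul k (by omega),
    derivative_sum, eval_finsetSum, ← Finset.sum_add_distrib, sub_eq_zero]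
  refine Finset.sum_congr rfl fun ij hij => ?_
  have := Finset.HasAntidiagonal.mem_antidiagonal.mp hij
  rw [derivative_mul, eval_add, eval_mul, eval_mul, hder, hder, hzero _ _ (by omega),
    hzero _ _ (by omega)]

/-- The truncated logarithm of a substitution is a vector field. -/
theorem opSum_log_eq_vecField {a : PowerSeries ℂ} (ha : PowerSeries.X ^ 2 ∣ a - PowerSeries.X)
    (hs : PowerSeries.HasSubst a) (K : ℕ) :
    ∃ l : PowerSeries ℂ, ∀ f : PowerSeries ℂ, PowerSeries.X ^ (K + 1) ∣
      opSum logCoeff K ((PowerSeries.substAlgHom hs).toLinearMap - 1) f -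
        l * PowerSeries.derivative ℂ f := by
  have hR := subst_sub_self_raises ha hs
  set G := opSum logCoeff K ((PowerSeries.substAlgHom hs).toLinearMap - 1) with hG
  have hmul := opSum_log_mul (PowerSeries.substAlgHom hs) hR K
  rw [← hG] at hmul
  -- This makes `G X * d/dX` stable on `(X ^ (K + 1))`: differentiation loses one order and the
  -- factor `G X` restores it.
  have hX : PowerSeries.X ∣ G PowerSeries.X := by
    have := hR.dvd_opSum logCoeff K (n := 1) (f := PowerSeries.X) (by simp)
    simpa using this
  refine ⟨G PowerSeries.X, fun f => ?_⟩
  have := dvd_sub_of_monomials (F := G) (G := vecField (G PowerSeries.X)) (M := K + 1) ?_ ?_ ?_ f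
  · simpa [vecField_apply] using this
  · intro n
    induction n with
    | zero =>
      have h1 : G 1 = 0 := by
        rw [hG, opSum_apply, Finset.sum_range_succ', logCoeff_zero]
        simp [pow_succ]
      simp [vecField_apply, h1]
    | succ n ih =>
      have h1 := hmul (PowerSeries.X ^ n) PowerSeries.X
      have h2 := dvd_add h1 (ih.mul_right PowerSeries.X)
      rw [pow_succ PowerSeries.X n, vecField_mul]
      convert h2 using 1
      rw [vecField_apply _ PowerSeries.X, PowerSeries.derivative_X]
      ring
  · intro g; exact hR.dvd_opSum _ _ (Dvd.intro _ rfl)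
  · intro g
    rw [vecField_apply]
    have := mul_dvd_mul hX (X_pow_dvd_derivative (n := K) (f := PowerSeries.X ^ (K + 1) * g)
      (Dvd.intro _ rfl))
    rwa [← pow_succ'] at this

/-! ### Germs of automorphisms -/

section GermAut

variable {E : Type*} [NormedAddCommGroup E] [NormedSpace ℂ E]

theorem IsGermAut.tendsto {f : E → E} (hf : IsGermAut f) : Tendsto f (𝓝 0) (𝓝 0) := by
  simpa [hf.2.1] using hf.1.continuousAt.tendsto

theorem IsGermAut.comp {f g : E → E} (hf : IsGermAut f) (hg : IsGermAut g) :
    IsGermAut (f ∘ g) := by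
  have hf1 : AnalyticAt ℂ f (g 0) := by rw [hg.2.1]; exact hf.1
  refine ⟨hf1.comp hg.1, by simp [hg.2.1, hf.2.1], ?_⟩
  rw [fderiv_comp _ hf1.differentiableAt hg.1.differentiableAt, hg.2.1]
  exact hf.2.2.comp hg.2.2

theorem isGermAut_id : IsGermAut (fun x : E => x) :=
  ⟨analyticAt_id, rfl, ⟨ContinuousLinearEquiv.refl ℂ E, by ext; simp⟩⟩

theorem IsGermAut.exists_inverse [CompleteSpace E] {f : E → E} (hf : IsGermAut f) :
    ∃ g : E → E, IsGermAut g ∧ (∀ᶠ x in 𝓝 0, g (f x) = x) ∧ ∀ᶠ x in 𝓝 0, f (g x) = x := by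
  obtain ⟨ha, h0, i, hi⟩ := hf
  have hs : HasStrictFDerivAt f (i : E →L[ℂ] E) 0 := by
    rw [hi]; exact ha.hasStrictFDerivAt
  set e := hs.toOpenPartialHomeomorph f with he
  have hef : (e : E → E) = f := hs.toOpenPartialHomeomorph_coe
  have hsrc : (0 : E) ∈ e.source := hs.mem_toOpenPartialHomeomorph_source
  have htgt : (0 : E) ∈ e.target := by
    have := hs.image_mem_toOpenPartialHomeomorph_target
    rwa [h0] at this
  have hg0 : e.symm 0 = 0 := by
    have := e.left_inv hsrc
    rwa [hef, h0] at this
  have hga : AnalyticAt ℂ e.symm 0 := by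
    have := e.analyticAt_symm' (i := i) hsrc (by rwa [hef]) (by rw [hef, hi])
    rwa [hef, h0] at this
  have hr : ∀ᶠ x in 𝓝 0, f (e.symm x) = x := by
    filter_upwards [e.open_target.mem_nhds htgt] with x hx
    have := e.right_inv hx
    rwa [hef] at this
  refine ⟨e.symm, ⟨hga, hg0, ?_⟩, ?_, hr⟩
  · refine ⟨i.symm, ?_⟩
    have h := e.hasStrictFDerivAt_symm (f' := i) htgt (by rw [hg0, hef]; exact hs)
    exact h.hasFDerivAt.fderiv.symm
  · filter_upwards [e.open_source.mem_nhds hsrc] with x hx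
    have := e.left_inv hx
    rwa [hef] at this

end GermAut

theorem isGermAut_iff_deriv {ρ : ℂ → ℂ} :
    IsGermAut ρ ↔ AnalyticAt ℂ ρ 0 ∧ ρ 0 = 0 ∧ deriv ρ 0 ≠ 0 := by
  refine and_congr_right fun ha => and_congr_right fun _ => ?_
  constructor
  · rintro ⟨e, he⟩ h
    have h1 : e 1 = 0 := by
      have : (e : ℂ →L[ℂ] ℂ) 1 = deriv ρ 0 := by rw [he]; rfl
      rw [h] at this
      exact this
    exact one_ne_zero (e.map_eq_zero_iff.mp h1)
  · intro h
    refine ⟨ContinuousLinearEquiv.unitsEquivAut ℂ (Units.mk0 _ h), ?_⟩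
    ext
    simp [ContinuousLinearEquiv.unitsEquivAut_apply]

theorem IsBranch.tendsto {f : ℂ → ℂ × ℂ} (hf : IsBranch f) : Tendsto f (𝓝 0) (𝓝 0) := by
  simpa [hf.2.1] using hf.1.continuousAt.tendsto

theorem IsBranch.of_eq_comp {f g : ℂ → ℂ × ℂ} {ρ : ℂ → ℂ} {σ : ℂ × ℂ → ℂ × ℂ} (hf : IsBranch f)
    (hρ : IsGermAut ρ) (hσ : IsGermAut σ) (h : σ ∘ f =ᶠ[𝓝 0] g ∘ ρ) : IsBranch g := by
  obtain ⟨ρ', hρ', -, hr⟩ := hρ.exists_inverse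
  obtain ⟨σ', hσ', hl, -⟩ := hσ.exists_inverse
  have hg : g =ᶠ[𝓝 0] σ ∘ f ∘ ρ' := by
    filter_upwards [hρ'.tendsto.eventually h, hr] with t h1 h2
    simp only [Function.comp_apply] at h1 ⊢
    rw [h1, h2]
  have ha : AnalyticAt ℂ (f ∘ ρ') 0 := AnalyticAt.comp (by rw [hρ'.2.1]; exact hf.1) hρ'.1
  have h0 : (f ∘ ρ') 0 = 0 := by simp [hρ'.2.1, hf.2.1]
  have ht : Tendsto (f ∘ ρ') (𝓝 0) (𝓝 0) := hf.tendsto.comp hρ'.tendsto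
  refine ⟨(AnalyticAt.comp (by rw [h0]; exact hσ.1) ha).congr hg.symm, ?_, ?_⟩
  · rw [hg.self_of_nhds]; simp [hρ'.2.1, hf.2.1, hσ.2.1]
  · obtain ⟨U, hU, hinj⟩ := hf.2.2
    have hmem : ∀ᶠ t in 𝓝 (0 : ℂ), ρ' t ∈ U ∧ σ' (σ (f (ρ' t))) = f (ρ' t) ∧ ρ (ρ' t) = t ∧
        g t = σ (f (ρ' t)) :=
      (hρ'.tendsto.eventually hU).and ((ht.eventually hl).and (hr.and hg))
    refine ⟨_, hmem, fun s hs t ht hst => ?_⟩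
    rw [hs.2.2.2, ht.2.2.2] at hst
    have h1 : f (ρ' s) = f (ρ' t) := by rw [← hs.2.1, ← ht.2.1, hst]
    rw [← hs.2.2.1, ← ht.2.2.1, hinj hs.1 ht.1 h1]

theorem IsBigerm.of_carries {φ ψ : Bigerm} {ρ₁ ρ₂ : ℂ → ℂ} {σ : ℂ × ℂ → ℂ × ℂ} (hφ : IsBigerm φ)
    (h₁ : IsGermAut ρ₁) (h₂ : IsGermAut ρ₂) (hσ : IsGermAut σ) (h : Carries ρ₁ ρ₂ σ φ ψ) :
    IsBigerm ψ := by
  refine ⟨hφ.1.of_eq_comp h₁ hσ h.1, hφ.2.1.of_eq_comp h₂ hσ h.2, ?_⟩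
  obtain ⟨U, hU, hd⟩ := hφ.2.2
  obtain ⟨ρ₁', hρ₁', -, hr₁⟩ := h₁.exists_inverse
  obtain ⟨ρ₂', hρ₂', -, hr₂⟩ := h₂.exists_inverse
  obtain ⟨σ', hσ', hl, -⟩ := hσ.exists_inverse
  have e₁ : ∀ᶠ t in 𝓝 (0 : ℂ), ρ₁' t ∈ U ∧ σ' (σ (φ.1 (ρ₁' t))) = φ.1 (ρ₁' t) ∧ ρ₁ (ρ₁' t) = t ∧
      σ (φ.1 (ρ₁' t)) = ψ.1 (ρ₁ (ρ₁' t)) :=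
    (hρ₁'.tendsto.eventually hU).and (((hφ.1.tendsto.comp hρ₁'.tendsto).eventually hl).and
      (hr₁.and (hρ₁'.tendsto.eventually h.1)))
  have e₂ : ∀ᶠ t in 𝓝 (0 : ℂ), ρ₂' t ∈ U ∧ σ' (σ (φ.2 (ρ₂' t))) = φ.2 (ρ₂' t) ∧ ρ₂ (ρ₂' t) = t ∧
      σ (φ.2 (ρ₂' t)) = ψ.2 (ρ₂ (ρ₂' t)) :=
    (hρ₂'.tendsto.eventually hU).and (((hφ.2.1.tendsto.comp hρ₂'.tendsto).eventually hl).and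
      (hr₂.and (hρ₂'.tendsto.eventually h.2)))
  refine ⟨_, e₁.and e₂, fun s hs t ht hst => ?_⟩
  have hs := hs.1
  have ht := ht.2
  rw [← hs.2.2.1, ← ht.2.2.1, ← hs.2.2.2, ← ht.2.2.2] at hst
  have h1 : φ.1 (ρ₁' s) = φ.2 (ρ₂' t) := by rw [← hs.2.1, ← ht.2.1, hst]
  obtain ⟨h2, h3⟩ := hd _ hs.1 _ ht.1 h1
  rw [← hs.2.2.1, ← ht.2.2.1, h2, h3, h₁.2.1, h₂.2.1]
  exact ⟨rfl, rfl⟩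

/-- In the case of a common tangent, the linear part of `σ` preserves the `x`-axis. -/
def PreservesTangent (δ : Tangents) (σ : ℂ × ℂ → ℂ × ℂ) : Prop :=
  δ = .same → ∃ b : ℂ, ∀ v : ℂ × ℂ, (fderiv ℂ σ 0 v).2 = b * v.2

/-- `𝒜`-equivalence through `σ` whose linear part preserves the common tangent, if there is one. -/
def TEquiv (δ : Tangents) (φ ψ : Bigerm) : Prop :=
  ∃ (ρ₁ ρ₂ : ℂ → ℂ) (σ : ℂ × ℂ → ℂ × ℂ),
    IsGermAut ρ₁ ∧ IsGermAut ρ₂ ∧ IsGermAut σ ∧ PreservesTangent δ σ ∧ Carries ρ₁ ρ₂ σ φ ψ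

theorem TEquiv.aequiv {δ : Tangents} {φ ψ : Bigerm} (h : TEquiv δ φ ψ) : AEquiv φ ψ := by
  obtain ⟨ρ₁, ρ₂, σ, h₁, h₂, h₃, -, h₄⟩ := h
  exact ⟨ρ₁, ρ₂, σ, h₁, h₂, h₃, h₄⟩

theorem AEquiv.tequiv {φ ψ : Bigerm} (h : AEquiv φ ψ) : TEquiv .distinct φ ψ := by
  obtain ⟨ρ₁, ρ₂, σ, h₁, h₂, h₃, h₄⟩ := h
  exact ⟨ρ₁, ρ₂, σ, h₁, h₂, h₃, (fun h => by cases h), h₄⟩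

theorem carries_comp {φ ψ χ : Bigerm} {ρ₁ ρ₂ ρ₁' ρ₂' : ℂ → ℂ} {σ σ' : ℂ × ℂ → ℂ × ℂ}
    (h₁ : IsGermAut ρ₁) (h₂ : IsGermAut ρ₂) (h : Carries ρ₁ ρ₂ σ φ ψ)
    (h' : Carries ρ₁' ρ₂' σ' ψ χ) : Carries (ρ₁' ∘ ρ₁) (ρ₂' ∘ ρ₂) (σ' ∘ σ) φ χ := by
  constructor
  · filter_upwards [h.1, h₁.tendsto.eventually h'.1] with t e1 e2
    simp only [Function.comp_apply] at e1 e2 ⊢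
    rw [e1, e2]
  · filter_upwards [h.2, h₂.tendsto.eventually h'.2] with t e1 e2
    simp only [Function.comp_apply] at e1 e2 ⊢
    rw [e1, e2]

theorem PreservesTangent.comp {δ : Tangents} {σ σ' : ℂ × ℂ → ℂ × ℂ} (h' : PreservesTangent δ σ')
    (h : PreservesTangent δ σ) (hσ' : IsGermAut σ') (hσ : IsGermAut σ) :
    PreservesTangent δ (σ' ∘ σ) := by
  intro hδ
  obtain ⟨b, hb⟩ := h hδ
  obtain ⟨b', hb'⟩ := h' hδ
  refine ⟨b' * b, fun v => ?_⟩
  rw [fderiv_comp _ (by rw [hσ.2.1]; exact hσ'.1.differentiableAt) hσ.1.differentiableAt, hσ.2.1,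
    ContinuousLinearMap.comp_apply, hb', hb, mul_assoc]

theorem TEquiv.trans {δ : Tangents} {φ ψ χ : Bigerm} (h : TEquiv δ φ ψ) (h' : TEquiv δ ψ χ) :
    TEquiv δ φ χ := by
  obtain ⟨ρ₁, ρ₂, σ, h₁, h₂, h₃, hp, h₄⟩ := h
  obtain ⟨ρ₁', ρ₂', σ', h₁', h₂', h₃', hp', h₄'⟩ := h'
  exact ⟨_, _, _, h₁'.comp h₁, h₂'.comp h₂, h₃'.comp h₃, hp'.comp hp h₃' h₃,
    carries_comp h₁ h₂ h₄ h₄'⟩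

theorem fderiv_inverse {σ σ' : ℂ × ℂ → ℂ × ℂ} (hσ : IsGermAut σ) (hσ' : IsGermAut σ')
    (h : ∀ᶠ x in 𝓝 0, σ (σ' x) = x) (v : ℂ × ℂ) : fderiv ℂ σ 0 (fderiv ℂ σ' 0 v) = v := by
  have h1 : fderiv ℂ (σ ∘ σ') 0 = ContinuousLinearMap.id ℂ (ℂ × ℂ) := by
    have h2 : σ ∘ σ' =ᶠ[𝓝 0] fun x => x := h
    rw [h2.fderiv_eq]
    exact fderiv_id
  rw [fderiv_comp _ (by rw [hσ'.2.1]; exact hσ.1.differentiableAt) hσ'.1.differentiableAt,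
    hσ'.2.1] at h1
  have := congrArg (fun L => L v) h1
  simpa using this

theorem TEquiv.symm {δ : Tangents} {φ ψ : Bigerm} (hφ : IsBigerm φ) (h : TEquiv δ φ ψ) :
    TEquiv δ ψ φ := by
  obtain ⟨ρ₁, ρ₂, σ, h₁, h₂, hσ, hp, h⟩ := h
  obtain ⟨ρ₁', hρ₁', -, hr₁⟩ := h₁.exists_inverse
  obtain ⟨ρ₂', hρ₂', -, hr₂⟩ := h₂.exists_inverse
  obtain ⟨σ', hσ', hl, hr⟩ := hσ.exists_inverse
  refine ⟨ρ₁', ρ₂', σ', hρ₁', hρ₂', hσ', ?_, ?_, ?_⟩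
  · intro hδ
    obtain ⟨b, hb⟩ := hp hδ
    refine ⟨b⁻¹, fun v => ?_⟩
    have h1 := fderiv_inverse hσ hσ' hr
    have hb0 : b ≠ 0 := by
      rintro rfl
      have h3 := hb (fderiv ℂ σ' 0 (0, 1))
      rw [h1] at h3
      simp at h3
    have h2 := hb (fderiv ℂ σ' 0 v)
    rw [h1] at h2
    rw [h2]; field_simp
  · filter_upwards [hρ₁'.tendsto.eventually h.1, hr₁,
      (hφ.1.tendsto.comp hρ₁'.tendsto).eventually hl] with t e1 e2 e3
    simp only [Function.comp_apply] at e1 e3 ⊢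
    rw [← e3, e1, e2]
  · filter_upwards [hρ₂'.tendsto.eventually h.2, hr₂,
      (hφ.2.1.tendsto.comp hρ₂'.tendsto).eventually hl] with t e1 e2 e3
    simp only [Function.comp_apply] at e1 e3 ⊢
    rw [← e3, e1, e2]

theorem TEquiv.isBigerm {δ : Tangents} {φ ψ : Bigerm} (hφ : IsBigerm φ) (h : TEquiv δ φ ψ) :
    IsBigerm ψ := by
  obtain ⟨ρ₁, ρ₂, σ, h₁, h₂, hσ, -, h⟩ := h
  exact hφ.of_carries h₁ h₂ hσ h

theorem AEquiv.trans {φ ψ χ : Bigerm} (h : AEquiv φ ψ) (h' : AEquiv ψ χ) : AEquiv φ χ :=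
  (h.tequiv.trans h'.tequiv).aequiv

/-! ### Invariance of the semigroup of values -/

theorem ord_congr {f g : ℂ → ℂ} (h : f =ᶠ[𝓝 0] g) : ord f = ord g := analyticOrderAt_congr h

theorem ord_comp_germAut {f ρ : ℂ → ℂ} (hρ : IsGermAut ρ) : ord (f ∘ ρ) = ord f := by
  have h := isGermAut_iff_deriv.mp hρ
  have := analyticOrderAt_comp_of_deriv_ne_zero (f := f) h.1 h.2.2
  rwa [h.2.1] at this

theorem ord_comp_of_eq {f g : ℂ → ℂ × ℂ} {ρ : ℂ → ℂ} {σ : ℂ × ℂ → ℂ × ℂ} (hρ : IsGermAut ρ)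
    (h : σ ∘ f =ᶠ[𝓝 0] g ∘ ρ) (η : ℂ × ℂ → ℂ) : ord ((η ∘ σ) ∘ f) = ord (η ∘ g) := by
  rw [← ord_comp_germAut (f := η ∘ g) hρ]
  refine ord_congr ?_
  filter_upwards [h] with t ht
  simp only [Function.comp_apply] at ht ⊢
  rw [ht]

theorem semigroupOfValues_subset {φ ψ : Bigerm} (h : AEquiv φ ψ) :
    semigroupOfValues ψ ⊆ semigroupOfValues φ := by
  obtain ⟨ρ₁, ρ₂, σ, h₁, h₂, hσ, h⟩ := h
  rintro v ⟨η, hη, hv1, hv2⟩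
  refine ⟨η ∘ σ, AnalyticAt.comp (by rw [hσ.2.1]; exact hη) hσ.1, ?_, ?_⟩
  · rw [ord_comp_of_eq h₁ h.1, hv1]
  · rw [ord_comp_of_eq h₂ h.2, hv2]

/-! ### Invariance of the values of differentials -/

/-- The partial derivative with respect to `x`. -/
def pdx (g : ℂ × ℂ → ℂ) (p : ℂ × ℂ) : ℂ := fderiv ℂ g p (1, 0)

/-- The partial derivative with respect to `y`. -/
def pdy (g : ℂ × ℂ → ℂ) (p : ℂ × ℂ) : ℂ := fderiv ℂ g p (0, 1)

theorem analyticAt_pdx {g : ℂ × ℂ → ℂ} {p : ℂ × ℂ} (hg : AnalyticAt ℂ g p) :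
    AnalyticAt ℂ (pdx g) p :=
  ((ContinuousLinearMap.apply ℂ ℂ ((1 : ℂ), (0 : ℂ))).analyticAt _).comp hg.fderiv

theorem analyticAt_pdy {g : ℂ × ℂ → ℂ} {p : ℂ × ℂ} (hg : AnalyticAt ℂ g p) :
    AnalyticAt ℂ (pdy g) p :=
  ((ContinuousLinearMap.apply ℂ ℂ ((0 : ℂ), (1 : ℂ))).analyticAt _).comp hg.fderiv

theorem fderiv_apply_eq (g : ℂ × ℂ → ℂ) (p v : ℂ × ℂ) :
    fderiv ℂ g p v = pdx g p * v.1 + pdy g p * v.2 := by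
  have : v = v.1 • ((1 : ℂ), (0 : ℂ)) + v.2 • ((0 : ℂ), (1 : ℂ)) := by
    ext <;> simp
  conv_lhs => rw [this]
  rw [map_add, map_smul, map_smul, pdx, pdy]
  simp only [smul_eq_mul]; ring

theorem deriv_comp_pair {g : ℂ × ℂ → ℂ} {f : ℂ → ℂ × ℂ} {t : ℂ} (hg : AnalyticAt ℂ g (f t))
    (hf : AnalyticAt ℂ f t) :
    deriv (fun s => g (f s)) t =
      pdx g (f t) * deriv (fun s => (f s).1) t + pdy g (f t) * deriv (fun s => (f s).2) t := by
  have h1 : HasDerivAt f (deriv f t) t := hf.differentiableAt.hasDerivAt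
  have h2 := hg.differentiableAt.hasFDerivAt.comp_hasDerivAt t h1
  have h3 : deriv (fun s => (f s).1) t = (deriv f t).1 :=
    (hasFDerivAt_fst (𝕜 := ℂ) (p := f t)).comp_hasDerivAt t h1 |>.deriv
  have h4 : deriv (fun s => (f s).2) t = (deriv f t).2 :=
    (hasFDerivAt_snd (𝕜 := ℂ) (p := f t)).comp_hasDerivAt t h1 |>.deriv
  rw [h3, h4, ← fderiv_apply_eq]
  exact h2.deriv

/-- The coefficient of `dx` in `σ* (A dx + B dy)`. -/
def pullX (σ : ℂ × ℂ → ℂ × ℂ) (A B : ℂ × ℂ → ℂ) (p : ℂ × ℂ) : ℂ :=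
  A (σ p) * pdx (fun q => (σ q).1) p + B (σ p) * pdx (fun q => (σ q).2) p

/-- The coefficient of `dy` in `σ* (A dx + B dy)`. -/
def pullY (σ : ℂ × ℂ → ℂ × ℂ) (A B : ℂ × ℂ → ℂ) (p : ℂ × ℂ) : ℂ :=
  A (σ p) * pdy (fun q => (σ q).1) p + B (σ p) * pdy (fun q => (σ q).2) p

theorem analyticAt_fst_comp {E : Type*} [NormedAddCommGroup E] [NormedSpace ℂ E] {f : E → ℂ × ℂ}
    {z : E} (hf : AnalyticAt ℂ f z) : AnalyticAt ℂ (fun s => (f s).1) z :=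
  analyticAt_fst.comp hf

theorem analyticAt_snd_comp {E : Type*} [NormedAddCommGroup E] [NormedSpace ℂ E] {f : E → ℂ × ℂ}
    {z : E} (hf : AnalyticAt ℂ f z) : AnalyticAt ℂ (fun s => (f s).2) z :=
  analyticAt_snd.comp hf

theorem pullback_pull {f g : ℂ → ℂ × ℂ} {ρ : ℂ → ℂ} {σ : ℂ × ℂ → ℂ × ℂ} (hf : IsBranch f)
    (hg : IsBranch g) (hρ : IsGermAut ρ) (hσ : IsGermAut σ) (h : σ ∘ f =ᶠ[𝓝 0] g ∘ ρ)
    (A B : ℂ × ℂ → ℂ) :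
    pullback (pullX σ A B) (pullY σ A B) f =ᶠ[𝓝 0] fun t => (pullback A B g ∘ ρ) t * deriv ρ t := by
  have e1 : (fun t => deriv (fun s => (σ (f s)).1) t) =ᶠ[𝓝 0]
      fun t => deriv (fun s => (g (ρ s)).1) t :=
    EventuallyEq.deriv (h.fun_comp Prod.fst)
  have e2 : (fun t => deriv (fun s => (σ (f s)).2) t) =ᶠ[𝓝 0]
      fun t => deriv (fun s => (g (ρ s)).2) t :=
    EventuallyEq.deriv (h.fun_comp Prod.snd)
  have eσ : ∀ᶠ t in 𝓝 0, AnalyticAt ℂ σ (f t) := hf.tendsto.eventually hσ.1.eventually_analyticAt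
  have eg : ∀ᶠ t in 𝓝 0, AnalyticAt ℂ g (ρ t) := hρ.tendsto.eventually hg.1.eventually_analyticAt
  filter_upwards [e1, e2, eσ, eg, hρ.1.eventually_analyticAt, hf.1.eventually_analyticAt, h]
    with t e1 e2 eσ eg eρ ef e
  rw [deriv_comp_pair (g := fun p => (σ p).1) (analyticAt_fst_comp eσ) ef] at e1
  rw [deriv_comp_pair (g := fun p => (σ p).2) (analyticAt_snd_comp eσ) ef] at e2
  have c1 : deriv (fun s => (g (ρ s)).1) t = deriv (fun s => (g s).1) (ρ t) * deriv ρ t :=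
    deriv_comp (h₂ := fun s => (g s).1) t (analyticAt_fst_comp eg).differentiableAt
      eρ.differentiableAt
  have c2 : deriv (fun s => (g (ρ s)).2) t = deriv (fun s => (g s).2) (ρ t) * deriv ρ t :=
    deriv_comp (h₂ := fun s => (g s).2) t (analyticAt_snd_comp eg).differentiableAt
      eρ.differentiableAt
  rw [c1] at e1
  rw [c2] at e2
  simp only [Function.comp_apply] at e
  simp only [pullback, pullX, pullY, Function.comp_apply, e]
  linear_combination A (g (ρ t)) * e1 + B (g (ρ t)) * e2

theorem analyticAt_pullback {A B : ℂ × ℂ → ℂ} (hA : AnalyticAt ℂ A 0) (hB : AnalyticAt ℂ B 0)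
    {f : ℂ → ℂ × ℂ} (hf : AnalyticAt ℂ f 0) (h0 : f 0 = 0) : AnalyticAt ℂ (pullback A B f) 0 := by
  have h1 : AnalyticAt ℂ (fun t => A (f t)) 0 := AnalyticAt.fun_comp (by rwa [h0]) hf
  have h2 : AnalyticAt ℂ (fun t => B (f t)) 0 := AnalyticAt.fun_comp (by rwa [h0]) hf
  exact (h1.mul (analyticAt_fst_comp hf).deriv).add (h2.mul (analyticAt_snd_comp hf).deriv)

theorem InMaxSq.const_mul {η : ℂ × ℂ → ℂ} (h : InMaxSq η) (c : ℂ) : InMaxSq fun p => c * η p := by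
  refine ⟨analyticAt_const.mul h.1, by simp [h.2.1], ?_⟩
  rw [fderiv_const_mul h.1.differentiableAt, h.2.2]
  ext <;> simp

theorem InMaxSq.add {η ξ : ℂ × ℂ → ℂ} (h : InMaxSq η) (h' : InMaxSq ξ) :
    InMaxSq fun p => η p + ξ p := by
  refine ⟨h.1.add h'.1, by simp [h.2.1, h'.2.1], ?_⟩
  rw [fderiv_fun_add h.1.differentiableAt h'.1.differentiableAt, h.2.2, h'.2.2, add_zero]

theorem inMaxSq_mul {η ξ : ℂ × ℂ → ℂ} (h : AnalyticAt ℂ η 0) (h' : AnalyticAt ℂ ξ 0)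
    (h0 : η 0 = 0) (h0' : ξ 0 = 0) : InMaxSq fun p => η p * ξ p := by
  refine ⟨h.mul h', by simp [h0], ?_⟩
  rw [fderiv_fun_mul h.differentiableAt h'.differentiableAt, h0, h0']
  ext <;> simp

theorem InMaxSq.mul {η ξ : ℂ × ℂ → ℂ} (h : InMaxSq η) (h' : AnalyticAt ℂ ξ 0) :
    InMaxSq fun p => η p * ξ p := by
  refine ⟨h.1.mul h', by simp [h.2.1], ?_⟩
  rw [fderiv_fun_mul h.1.differentiableAt h'.differentiableAt, h.2.1, h.2.2]
  ext <;> simp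

theorem InMaxSq.comp {η : ℂ × ℂ → ℂ} {σ : ℂ × ℂ → ℂ × ℂ} (h : InMaxSq η) (hσ : IsGermAut σ) :
    InMaxSq fun p => η (σ p) := by
  have h1 : AnalyticAt ℂ η (σ 0) := by rw [hσ.2.1]; exact h.1
  refine ⟨AnalyticAt.fun_comp h1 hσ.1, by simp [hσ.2.1, h.2.1], ?_⟩
  have := fderiv_comp (g := η) (f := σ) 0 h1.differentiableAt hσ.1.differentiableAt
  rw [hσ.2.1, h.2.2, ContinuousLinearMap.zero_comp] at this
  exact this

theorem InOmega.analyticAt {δ : Tangents} {A B : ℂ × ℂ → ℂ} (h : InOmega δ A B) :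
    AnalyticAt ℂ A 0 ∧ AnalyticAt ℂ B 0 := by
  obtain ⟨hA, β, η, hη, -, rfl⟩ := h
  exact ⟨hA.1, (analyticAt_const.mul analyticAt_snd).add hη.1⟩

/-- Only `β y dy` is delicate. Its pull-back is `β σ₂ dσ₂`, and when the linear part of `σ₂` is `b
y` this equals `β b² y dy` up to coefficients in `(x, y)²`. Without the hypothesis on the tangent a
linear term in `dx` could appear. -/
theorem InOmega.pull {δ : Tangents} {A B : ℂ × ℂ → ℂ} {σ : ℂ × ℂ → ℂ × ℂ} (h : InOmega δ A B)
    (hσ : IsGermAut σ) (hp : PreservesTangent δ σ) :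
    InOmega δ (pullX σ A B) (pullY σ A B) := by
  obtain ⟨hA, β, η, hη, hβ, rfl⟩ := h
  have s1 := analyticAt_fst_comp hσ.1
  have s2 := analyticAt_snd_comp hσ.1
  have s20 : (σ 0).2 = 0 := by rw [hσ.2.1]; rfl
  have hX : InMaxSq fun p =>
      A (σ p) * pdx (fun q => (σ q).1) p + η (σ p) * pdx (fun q => (σ q).2) p :=
    ((hA.comp hσ).mul (analyticAt_pdx s1)).add ((hη.comp hσ).mul (analyticAt_pdx s2))
  have hY : InMaxSq fun p =>
      A (σ p) * pdy (fun q => (σ q).1) p + η (σ p) * pdy (fun q => (σ q).2) p :=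
    ((hA.comp hσ).mul (analyticAt_pdy s1)).add ((hη.comp hσ).mul (analyticAt_pdy s2))
  cases δ with
  | distinct =>
    obtain rfl := hβ rfl
    refine ⟨?_, 0, _, hY, fun _ => rfl, ?_⟩
    · convert hX using 2; simp [pullX]
    · funext p; simp [pullY]
  | same =>
    obtain ⟨b, hb⟩ := hp rfl
    have hfd : ∀ v, fderiv ℂ (fun q => (σ q).2) 0 v = b * v.2 := by
      intro v
      rw [← hb v]
      have := fderiv_comp (g := Prod.snd) (f := σ) 0 (differentiableAt_snd) hσ.1.differentiableAt
      rw [fderiv_snd] at this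
      exact congrArg (fun L => L v) this
    have h1 : InMaxSq fun p => (σ p).2 * pdx (fun q => (σ q).2) p := by
      refine inMaxSq_mul s2 (analyticAt_pdx s2) s20 ?_
      simp [pdx, hfd]
    have h2 : InMaxSq fun p => (σ p).2 * pdy (fun q => (σ q).2) p - b ^ 2 * p.2 := by
      have ha : AnalyticAt ℂ (fun p => (σ p).2 * pdy (fun q => (σ q).2) p) 0 :=
        s2.mul (analyticAt_pdy s2)
      have hb' : AnalyticAt ℂ (fun p : ℂ × ℂ => b ^ 2 * p.2) 0 :=
        analyticAt_const.mul analyticAt_snd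
      refine ⟨ha.sub hb', by simp [s20], ?_⟩
      rw [fderiv_fun_sub ha.differentiableAt hb'.differentiableAt,
        fderiv_fun_mul s2.differentiableAt (analyticAt_pdy s2).differentiableAt, s20,
        fderiv_const_mul differentiableAt_snd, fderiv_snd]
      ext <;> simp [hfd, pdy, pow_two]
    refine ⟨?_, β * b ^ 2, _, hY.add (h2.const_mul β), (fun h => by cases h), ?_⟩
    · convert hX.add (h1.const_mul β) using 2
      simp only [pullX]; ring
    · funext p
      simp only [pullY]; ring

/-- Pulling a form back by `σ` multiplies its restriction to a branch by the unit `ρ'`, so orders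
are preserved. Multiplicities enter only because `Λ` is shifted by them. -/
theorem valuesOfDifferentials_subset {δ : Tangents} {φ ψ : Bigerm} (hφ : IsBigerm φ)
    (h : TEquiv δ φ ψ) (hm₁ : mult ψ.1 = mult φ.1) (hm₂ : mult ψ.2 = mult φ.2) :
    valuesOfDifferentials δ ψ ⊆ valuesOfDifferentials δ φ := by
  have hψ := h.isBigerm hφ
  obtain ⟨ρ₁, ρ₂, σ, h₁, h₂, hσ, hp, h⟩ := h
  rintro v ⟨A, B, hω, hv1, hv2⟩
  have key : ∀ {f g : ℂ → ℂ × ℂ} {ρ : ℂ → ℂ}, IsBranch f → IsBranch g → IsGermAut ρ →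
      σ ∘ f =ᶠ[𝓝 0] g ∘ ρ →
      ord (pullback (pullX σ A B) (pullY σ A B) f) = ord (pullback A B g) := by
    intro f g ρ hf hg hρ h
    rw [ord_congr (pullback_pull hf hg hρ hσ h A B), ← ord_comp_germAut (f := pullback A B g) hρ]
    have h3 := isGermAut_iff_deriv.mp hρ
    have hpa := analyticAt_pullback hω.analyticAt.1 hω.analyticAt.2 hg.1 hg.2.1
    have := analyticOrderAt_mul (f := pullback A B g ∘ ρ) (g := deriv ρ) (z₀ := 0)
      (AnalyticAt.comp (by rwa [hρ.2.1]) hρ.1) hρ.1.deriv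
    rw [hρ.1.deriv.analyticOrderAt_eq_zero.mpr h3.2.2, add_zero] at this
    exact this
  refine ⟨_, _, hω.pull hσ hp, ?_, ?_⟩
  · rw [key hφ.1 hψ.1 h₁ h.1, hv1, hm₁]
  · rw [key hφ.2.1 hψ.2.1 h₂ h.2, hv2, hm₂]

theorem TEquiv.mem_sigmaSet {δ : Tangents} {Γ Λ : Set (ℕ × ℕ)} {φ ψ : Bigerm}
    (hφ : φ ∈ SigmaSet δ Γ Λ) (h : TEquiv δ φ ψ) (hψ : InPuiseuxForm δ ψ)
    (hm₁ : mult ψ.1 = mult φ.1) (hm₂ : mult ψ.2 = mult φ.2) : ψ ∈ SigmaSet δ Γ Λ := by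
  obtain ⟨hb, -, rfl, rfl⟩ := hφ
  have hb' := h.isBigerm hb
  have hs := h.symm hb
  exact ⟨hb', hψ, (semigroupOfValues_subset h.aequiv).antisymm (semigroupOfValues_subset hs.aequiv),
    (valuesOfDifferentials_subset hb h hm₁ hm₂).antisymm
      (valuesOfDifferentials_subset hb' hs hm₁.symm hm₂.symm)⟩

/-! ### Roots of germs and Puiseux parametrizations -/

/-- After `t ^ m` is factored out, the quotient by `d ^ m` takes the value `1` at `0`, where the
principal logarithm is analytic; prescribing `d` selects the branch of the root. -/
theorem exists_root {u : ℂ → ℂ} (hu : AnalyticAt ℂ u 0) {m : ℕ} (hm : 0 < m)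
    (hd : PowerSeries.X ^ m ∣ taylor u) {d : ℂ} (hc : d ^ m = PowerSeries.coeff m (taylor u))
    (hd0 : d ≠ 0) :
    ∃ ρ : ℂ → ℂ, IsGermAut ρ ∧ deriv ρ 0 = d ∧ u =ᶠ[𝓝 0] fun t => ρ t ^ m := by
  obtain ⟨g, hg, hug, hτ⟩ := exists_eq_pow_mul hu hd
  have hg0 : g 0 = d ^ m := by
    rw [hc, hτ, PowerSeries.coeff_X_pow_mul', if_pos le_rfl, Nat.sub_self,
      PowerSeries.coeff_zero_eq_constantCoeff_apply, constantCoeff_taylor]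
  have hdm : d ^ m ≠ 0 := pow_ne_zero _ hd0
  set q : ℂ → ℂ := fun t => g t / d ^ m with hq
  have hqa : AnalyticAt ℂ q 0 := hg.div analyticAt_const hdm
  have hq0 : q 0 = 1 := by simp [hq, hg0, hdm]
  set h : ℂ → ℂ := fun t => d * Complex.exp (Complex.log (q t) / m) with hh
  have hha : AnalyticAt ℂ h 0 := by
    refine analyticAt_const.mul (AnalyticAt.cexp ?_)
    refine AnalyticAt.div (AnalyticAt.clog hqa ?_) analyticAt_const (by exact_mod_cast hm.ne')
    rw [hq0]; exact Complex.one_mem_slitPlane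
  have hh0 : h 0 = d := by simp [hh, hq0]
  have hpow : ∀ᶠ t in 𝓝 (0 : ℂ), h t ^ m = g t := by
    have : ∀ᶠ t in 𝓝 (0 : ℂ), q t ≠ 0 :=
      hqa.continuousAt.eventually_ne (by rw [hq0]; exact one_ne_zero)
    filter_upwards [this] with t ht
    have hm' : (m : ℂ) ≠ 0 := by exact_mod_cast hm.ne'
    simp only [hh]
    rw [mul_pow, ← Complex.exp_nat_mul, mul_div_cancel₀ _ hm', Complex.exp_log ht, hq]
    field_simp
  have hder : deriv (fun t => t * h t) 0 = d := by
    have h1 : DifferentiableAt ℂ (fun t : ℂ => t) 0 := differentiableAt_id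
    rw [deriv_fun_mul h1 hha.differentiableAt]
    simp [hh0]
  refine ⟨fun t => t * h t, isGermAut_iff_deriv.mpr ⟨analyticAt_id.mul hha, by simp, ?_⟩, hder, ?_⟩
  · rw [hder]; exact hd0
  · filter_upwards [hug, hpow] with t h1 h2
    rw [h1, mul_pow, h2]

theorem exists_reparam {u v : ℂ → ℂ} (hu : AnalyticAt ℂ u 0) (hv : AnalyticAt ℂ v 0) {m : ℕ}
    (hm : 0 < m) (hd : PowerSeries.X ^ m ∣ taylor u) {d : ℂ}
    (hc : d ^ m = PowerSeries.coeff m (taylor u)) (hd0 : d ≠ 0) :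
    ∃ ρ y : ℂ → ℂ, IsGermAut ρ ∧ deriv ρ 0 = d ∧ AnalyticAt ℂ y 0 ∧ (u =ᶠ[𝓝 0] fun t => ρ t ^ m) ∧
      (v =ᶠ[𝓝 0] fun t => y (ρ t)) ∧
      ∃ r : PowerSeries ℂ, PowerSeries.X ∣ r ∧ taylor y = (taylor v).subst r := by
  obtain ⟨ρ, hρ, hρd, hρu⟩ := exists_root hu hm hd hc hd0
  obtain ⟨ρ', hρ', hl, hr⟩ := hρ.exists_inverse
  refine ⟨ρ, fun t => v (ρ' t), hρ, hρd, AnalyticAt.fun_comp (by rwa [hρ'.2.1]) hρ'.1, hρu, ?_,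
    taylor ρ', X_dvd_taylor hρ'.2.1, taylor_comp hv hρ'.1 hρ'.2.1⟩
  filter_upwards [hl] with t ht
  rw [ht]

theorem X_dvd_of_tangent {a : PowerSeries ℂ} (ha : PowerSeries.X ^ 2 ∣ a - PowerSeries.X) :
    PowerSeries.X ∣ a := by
  have := dvd_add ((Dvd.intro_left _ (pow_succ _ 1).symm).trans ha) (dvd_refl PowerSeries.X)
  simpa using this

theorem hasSubst_of_dvd {a : PowerSeries ℂ} (ha : PowerSeries.X ∣ a) : PowerSeries.HasSubst a :=
  PowerSeries.HasSubst.of_constantCoeff_zero' (PowerSeries.X_dvd_iff.mp ha)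

/-- The cofactor of `r - a` in `r ^ m - a ^ m` is `X ^ (m - 1)` times a series with constant term
`m`, a unit. Hence exactly `m - 1` orders are lost. -/
theorem dvd_sub_of_pow_sub {r a : PowerSeries ℂ} (hr : PowerSeries.X ^ 2 ∣ r - PowerSeries.X)
    (ha : PowerSeries.X ^ 2 ∣ a - PowerSeries.X) {m p q : ℕ} (hm : 0 < m) (hpq : p + 1 = q + m)
    (h : PowerSeries.X ^ p ∣ r ^ m - a ^ m) : PowerSeries.X ^ q ∣ r - a := by
  obtain ⟨v, hv⟩ := hr
  obtain ⟨w, hw⟩ := ha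
  have hr' : r = PowerSeries.X * (1 + PowerSeries.X * v) := by
    rw [sub_eq_iff_eq_add] at hv; rw [hv]; ring
  have ha' : a = PowerSeries.X * (1 + PowerSeries.X * w) := by
    rw [sub_eq_iff_eq_add] at hw; rw [hw]; ring
  set r' := 1 + PowerSeries.X * v
  set a' := 1 + PowerSeries.X * w
  obtain ⟨m, rfl⟩ : ∃ n, m = n + 1 := ⟨m - 1, by omega⟩
  obtain rfl : p = q + m := by omega
  set U := ∑ i ∈ Finset.range (m + 1), r' ^ i * a' ^ (m - i) with hU
  have hUu : IsUnit U := by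
    rw [PowerSeries.isUnit_iff_constantCoeff, hU]
    simp only [map_sum, map_mul, map_pow, r', a', map_add, map_one, PowerSeries.constantCoeff_X,
      zero_mul, add_zero, one_pow, one_mul, Finset.sum_const, Finset.card_range]
    rw [isUnit_iff_ne_zero]
    simp only [nsmul_eq_mul, mul_one]
    exact_mod_cast m.succ_ne_zero
  have e : r ^ (m + 1) - a ^ (m + 1) = PowerSeries.X ^ m * ((r - a) * U) := by
    have h1 : r' ^ (m + 1) - a' ^ (m + 1) = (r' - a') * U := by
      rw [hU, mul_comm]
      have := (Commute.all r' a').geom_sum₂_mul (m + 1)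
      simp only [Nat.add_sub_cancel] at this
      exact this.symm
    rw [hr', ha', mul_pow, mul_pow, ← mul_sub, h1]
    ring
  rw [e, pow_add, mul_comm] at h
  have h2 := (mul_dvd_mul_iff_left (pow_ne_zero m PowerSeries.X_ne_zero)).mp h
  exact (hUu.dvd_mul_right).mp h2

theorem subst_sub_subst_dvd {r a : PowerSeries ℂ} (hr : PowerSeries.X ∣ r) (ha : PowerSeries.X ∣ a)
    {q : ℕ} (h : PowerSeries.X ^ q ∣ r - a) (f : PowerSeries ℂ) :
    PowerSeries.X ^ q ∣ f.subst r - f.subst a := by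
  have hs := hasSubst_of_dvd hr
  have hs' := hasSubst_of_dvd ha
  have := dvd_sub_of_monomials (F := (PowerSeries.substAlgHom hs).toLinearMap)
    (G := (PowerSeries.substAlgHom hs').toLinearMap) (M := q) ?_ ?_ ?_ f
  · simpa [PowerSeries.coe_substAlgHom] using this
  · intro n
    simp only [AlgHom.toLinearMap_apply, map_pow, PowerSeries.substAlgHom_X]
    exact h.trans (sub_dvd_pow_sub_pow r a n)
  · intro g
    simp only [AlgHom.toLinearMap_apply, PowerSeries.coe_substAlgHom]
    exact subst_X_pow_dvd hr (Dvd.intro _ rfl)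
  · intro g
    simp only [AlgHom.toLinearMap_apply, PowerSeries.coe_substAlgHom]
    exact subst_X_pow_dvd ha (Dvd.intro _ rfl)

theorem X_pow_dvd_pow_sub_pow {r a : PowerSeries ℂ} (hr : PowerSeries.X ∣ r)
    (ha : PowerSeries.X ∣ a) {q : ℕ} (h : PowerSeries.X ^ q ∣ r - a) (m : ℕ) :
    PowerSeries.X ^ (q + m) ∣ r ^ (m + 1) - a ^ (m + 1) := by
  rw [← (Commute.all r a).geom_sum₂_mul (m + 1), mul_comm, pow_add]
  refine mul_dvd_mul h (Finset.dvd_sum fun i hi => ?_)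
  have hi' := Finset.mem_range.mp hi
  have := mul_dvd_mul (pow_dvd_pow_of_dvd hr i) (pow_dvd_pow_of_dvd ha (m + 1 - 1 - i))
  rwa [← pow_add, show i + (m + 1 - 1 - i) = m by omega] at this

/-- The factor `X ^ (m + 1)` of `y` gains `m` orders: `r ^ (m + 1) - a ^ (m + 1)` is divisible by `X
^ (q + m)`, and the variation of the cofactor is multiplied by `a ^ (m + 1)`. -/
theorem subst_sub_subst_dvd_of_dvd {r a : PowerSeries ℂ} (hr : PowerSeries.X ∣ r)
    (ha : PowerSeries.X ∣ a) {q m : ℕ} (h : PowerSeries.X ^ q ∣ r - a) {y : PowerSeries ℂ}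
    (hy : PowerSeries.X ^ (m + 1) ∣ y) :
    PowerSeries.X ^ (q + m) ∣ y.subst r - y.subst a := by
  obtain ⟨z, rfl⟩ := hy
  have hs := hasSubst_of_dvd hr
  have hs' := hasSubst_of_dvd ha
  rw [PowerSeries.subst_mul hs, PowerSeries.subst_mul hs', PowerSeries.subst_pow hs,
    PowerSeries.subst_pow hs', PowerSeries.subst_X hs, PowerSeries.subst_X hs']
  have h1 := (X_pow_dvd_pow_sub_pow hr ha h m).mul_right (z.subst r)
  have h2 := mul_dvd_mul (pow_dvd_pow_of_dvd ha (m + 1)) (subst_sub_subst_dvd hr ha h z)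
  rw [← pow_add] at h2
  have h3 := dvd_add h1 ((pow_dvd_pow _ (by omega : q + m ≤ m + 1 + q)).trans h2)
  convert h3 using 1
  ring

theorem dvd_of_subst_dvd {ρ : ℂ → ℂ} (hρ : IsGermAut ρ) {n : ℕ} {f : PowerSeries ℂ}
    (h : PowerSeries.X ^ n ∣ f.subst (taylor ρ)) : PowerSeries.X ^ n ∣ f := by
  obtain ⟨ρ', hρ', -, hr⟩ := hρ.exists_inverse
  have h1 := subst_X_pow_dvd (X_dvd_taylor hρ'.2.1) h
  rw [PowerSeries.subst_comp_subst_apply (hasSubst_taylor hρ.2.1) (hasSubst_taylor hρ'.2.1),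
    ← taylor_comp hρ.1 hρ'.1 hρ'.2.1, taylor_congr (g := fun t => t) hr, taylor_id,
    PowerSeries.X_subst] at h1
  exact h1

/-- If `(u, v)` is, up to high order terms, a reparametrization of `(t ^ m, y + β)`, then its
Puiseux parametrization is `(t ^ m, y + β + ⋯)`. -/
theorem exists_reparam_of_congr {u v y : ℂ → ℂ} (hu : AnalyticAt ℂ u 0) (hv : AnalyticAt ℂ v 0)
    {m p : ℕ} (hm : 0 < m) (hp : m < p) (hy : PowerSeries.X ^ (m + 1) ∣ taylor y)
    {a β : PowerSeries ℂ} (ha : PowerSeries.X ^ 2 ∣ a - PowerSeries.X)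
    (hβ : PowerSeries.X ^ p ∣ β) (hua : PowerSeries.X ^ p ∣ taylor u - a ^ m)
    (hva : PowerSeries.X ^ (p + 1) ∣ taylor v - ((taylor y).subst a + β)) :
    ∃ ρ y' : ℂ → ℂ, IsGermAut ρ ∧ AnalyticAt ℂ y' 0 ∧ (u =ᶠ[𝓝 0] fun t => ρ t ^ m) ∧
      (v =ᶠ[𝓝 0] fun t => y' (ρ t)) ∧ PowerSeries.X ^ (p + 1) ∣ taylor y' - (taylor y + β) := by
  have haX := X_dvd_of_tangent ha
  have hum : PowerSeries.X ^ m ∣ taylor u := by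
    have := dvd_add ((pow_dvd_pow _ hp.le).trans hua) (pow_dvd_pow_of_dvd haX m)
    simpa using this
  have hcm : PowerSeries.coeff m (taylor u) = 1 := by
    have h1 := PowerSeries.X_pow_dvd_iff.mp hua m hp
    obtain ⟨v, hv⟩ := ha
    have hav : a = PowerSeries.X * (1 + PowerSeries.X * v) := by
      rw [sub_eq_iff_eq_add] at hv; rw [hv]; ring
    rw [map_sub, sub_eq_zero] at h1
    rw [h1, hav, mul_pow, PowerSeries.coeff_X_pow_mul', if_pos le_rfl, Nat.sub_self,
      PowerSeries.coeff_zero_eq_constantCoeff_apply]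
    simp
  -- The leading coefficient of `u` is `1`, so the root with derivative `1` may be chosen; like `a`,
  -- it is then tangent to the identity.
  obtain ⟨ρ, y', hρ, hρd, hy', hu', hv', -⟩ := exists_reparam (d := 1) hu hv hm hum
    (by rw [hcm, one_pow]) one_ne_zero
  refine ⟨ρ, y', hρ, hy', hu', hv', ?_⟩
  set r := taylor ρ with hr
  have hr2 : PowerSeries.X ^ 2 ∣ r - PowerSeries.X := by
    rw [PowerSeries.X_pow_dvd_iff]
    intro k hk
    rw [map_sub, PowerSeries.coeff_X]
    interval_cases k
    · simp [hr, constantCoeff_taylor, hρ.2.1]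
    · simp [hr, coeff_one_taylor, hρd]
  have hrX := X_dvd_of_tangent hr2
  have hs := hasSubst_of_dvd hrX
  rw [taylor_congr hu', taylor_pow hρ.1, ← hr] at hua
  -- Extracting `m`-th roots costs `m - 1` orders and leaves `p + 1 - m`; substituting into `y`,
  -- which starts in degree `m + 1`, gives `m` back and reaches `p + 1`.
  have hq := dvd_sub_of_pow_sub (q := p + 1 - m) hr2 ha hm (by omega) hua
  have h1 := subst_sub_subst_dvd_of_dvd hrX haX hq hy
  rw [show p + 1 - m + m = p + 1 by omega] at h1
  have h2 := subst_sub_self_raises hr2 hs p β hβ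
  simp only [LinearMap.sub_apply, AlgHom.toLinearMap_apply, Module.End.one_apply,
    PowerSeries.coe_substAlgHom] at h2
  rw [taylor_congr hv', taylor_comp hy' hρ.1 hρ.2.1, ← hr] at hva
  refine dvd_of_subst_dvd hρ ?_
  rw [← hr, PowerSeries.subst_sub hs, PowerSeries.subst_add hs]
  convert dvd_sub hva (dvd_add h1 h2) using 1
  ring

/-! ### Bigerms in Puiseux form -/

/-- The bigerm in Puiseux form with the given multiplicities and second coordinates. -/
def puiseux : Tangents → ℕ → ℕ → (ℂ → ℂ) → (ℂ → ℂ) → Bigerm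
  | .distinct, m₁, m₂, y₁, y₂ => (fun t => (t ^ m₁, y₁ t), fun t => (y₂ t, t ^ m₂))
  | .same, m₁, m₂, y₁, y₂ => (fun t => (t ^ m₁, y₁ t), fun t => (t ^ m₂, y₂ t))

theorem model_eq_puiseux (δ : Tangents) (m₁ m₂ : ℕ) (P₁ P₂ : ℂ[X]) :
    model δ m₁ m₂ P₁ P₂ = puiseux δ m₁ m₂ (fun t => P₁.eval t) (fun t => P₂.eval t) := by
  cases δ <;> rfl

/-- `y` is the non-trivial coordinate of a branch of multiplicity `m` in Puiseux form. -/
def PuiseuxCoord (m : ℕ) (y : ℂ → ℂ) : Prop :=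
  0 < m ∧ AnalyticAt ℂ y 0 ∧ PowerSeries.X ^ (m + 1) ∣ taylor y

theorem ord_id_pow (m : ℕ) : ord (fun t => t ^ m) = m := by
  rw [ord_eq_iff (by fun_prop), taylor_id_pow]
  simp [PowerSeries.coeff_X_pow]

theorem PuiseuxCoord.lt_ord {m : ℕ} {y : ℂ → ℂ} (h : PuiseuxCoord m y) : (m : ℕ∞) < ord y := by
  have := (le_ord_iff h.2.1).mpr h.2.2
  push_cast at this
  exact lt_of_lt_of_le (ENat.lt_add_one_iff (by simp) |>.mpr le_rfl) this

theorem puiseuxCoord_of_lt_ord {m : ℕ} {y : ℂ → ℂ} (hm : 0 < m) (hy : AnalyticAt ℂ y 0)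
    (h : (m : ℕ∞) < ord y) : PuiseuxCoord m y := by
  refine ⟨hm, hy, (le_ord_iff hy).mp ?_⟩
  push_cast
  exact Order.add_one_le_of_lt h

theorem PuiseuxCoord.mult_left {m : ℕ} {y : ℂ → ℂ} (h : PuiseuxCoord m y) :
    mult (fun t => (t ^ m, y t)) = m := by
  simp only [mult, ord_id_pow]
  exact min_eq_left h.lt_ord.le

theorem PuiseuxCoord.mult_right {m : ℕ} {y : ℂ → ℂ} (h : PuiseuxCoord m y) :
    mult (fun t => (y t, t ^ m)) = m := by
  simp only [mult, ord_id_pow]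
  exact min_eq_right h.lt_ord.le

theorem mult_puiseux₁ (δ : Tangents) {m₁ m₂ : ℕ} {y₁ y₂ : ℂ → ℂ} (h₁ : PuiseuxCoord m₁ y₁) :
    mult (puiseux δ m₁ m₂ y₁ y₂).1 = m₁ := by
  cases δ <;> exact h₁.mult_left

theorem mult_puiseux₂ (δ : Tangents) {m₁ m₂ : ℕ} {y₁ y₂ : ℂ → ℂ} (h₂ : PuiseuxCoord m₂ y₂) :
    mult (puiseux δ m₁ m₂ y₁ y₂).2 = m₂ := by
  cases δ
  · exact h₂.mult_right
  · exact h₂.mult_left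

theorem inPuiseuxForm_puiseux (δ : Tangents) {m₁ m₂ : ℕ} {y₁ y₂ : ℂ → ℂ}
    (h₁ : PuiseuxCoord m₁ y₁) (h₂ : PuiseuxCoord m₂ y₂) :
    InPuiseuxForm δ (puiseux δ m₁ m₂ y₁ y₂) := by
  have e₁ : PuiseuxX fun t => (t ^ m₁, y₁ t) := ⟨m₁, h₁.1, by simp, h₁.lt_ord⟩
  cases δ
  · exact ⟨e₁, m₂, h₂.1, by simp [puiseux], h₂.lt_ord⟩
  · exact ⟨e₁, m₂, h₂.1, by simp [puiseux], h₂.lt_ord⟩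

theorem ord_eq_natCast_of_eq_pow {g : ℂ → ℂ} {m : ℕ} (h : ∀ᶠ t in 𝓝 (0 : ℂ), g t = t ^ m) :
    ord g = m := by
  rw [← ord_id_pow m]; exact ord_congr h

theorem preservesTangent_id (δ : Tangents) : PreservesTangent δ fun x => x :=
  fun _ => ⟨1, fun v => by simp⟩

theorem tequiv_of_eventuallyEq {δ : Tangents} {φ ψ : Bigerm} (h₁ : φ.1 =ᶠ[𝓝 0] ψ.1)
    (h₂ : φ.2 =ᶠ[𝓝 0] ψ.2) : TEquiv δ φ ψ :=
  ⟨fun t => t, fun t => t, fun p => p, isGermAut_id, isGermAut_id, isGermAut_id,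
    preservesTangent_id δ, h₁, h₂⟩

theorem TEquiv.mem_sigmaSet_puiseux {δ : Tangents} {Γ Λ : Set (ℕ × ℕ)} {m₁ m₂ : ℕ}
    {y₁ y₂ y₁' y₂' : ℂ → ℂ} (hφ : puiseux δ m₁ m₂ y₁ y₂ ∈ SigmaSet δ Γ Λ)
    (h : TEquiv δ (puiseux δ m₁ m₂ y₁ y₂) (puiseux δ m₁ m₂ y₁' y₂'))
    (h₁ : PuiseuxCoord m₁ y₁) (h₂ : PuiseuxCoord m₂ y₂) (h₁' : PuiseuxCoord m₁ y₁')
    (h₂' : PuiseuxCoord m₂ y₂') : puiseux δ m₁ m₂ y₁' y₂' ∈ SigmaSet δ Γ Λ :=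
  h.mem_sigmaSet hφ (inPuiseuxForm_puiseux δ h₁' h₂')
    (by rw [mult_puiseux₁ δ h₁, mult_puiseux₁ δ h₁']) (by rw [mult_puiseux₂ δ h₂, mult_puiseux₂ δ h₂'])

theorem exists_puiseux_of_mem {δ : Tangents} {Γ Λ : Set (ℕ × ℕ)} {φ : Bigerm}
    (hφ : φ ∈ SigmaSet δ Γ Λ) :
    ∃ (m₁ m₂ : ℕ) (y₁ y₂ : ℂ → ℂ), PuiseuxCoord m₁ y₁ ∧ PuiseuxCoord m₂ y₂ ∧
      puiseux δ m₁ m₂ y₁ y₂ ∈ SigmaSet δ Γ Λ ∧ TEquiv δ φ (puiseux δ m₁ m₂ y₁ y₂) := by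
  have hb := hφ.1
  cases δ with
  | distinct =>
    obtain ⟨⟨m₁, hm₁, e₁, l₁⟩, m₂, hm₂, e₂, l₂⟩ := hφ.2.1
    have h₁ := puiseuxCoord_of_lt_ord hm₁ (analyticAt_snd_comp hb.1.1) l₁
    have h₂ := puiseuxCoord_of_lt_ord hm₂ (analyticAt_fst_comp hb.2.1.1) l₂
    have ht : TEquiv .distinct φ
        (puiseux .distinct m₁ m₂ (fun t => (φ.1 t).2) (fun t => (φ.2 t).1)) := by
      refine tequiv_of_eventuallyEq ?_ ?_
      · filter_upwards [e₁] with t ht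
        exact Prod.ext ht rfl
      · filter_upwards [e₂] with t ht
        exact Prod.ext rfl ht
    refine ⟨m₁, m₂, _, _, h₁, h₂, ht.mem_sigmaSet hφ (inPuiseuxForm_puiseux _ h₁ h₂) ?_ ?_, ht⟩
    · rw [mult_puiseux₁ _ h₁, mult, ord_eq_natCast_of_eq_pow e₁, min_eq_left l₁.le]
    · rw [mult_puiseux₂ _ h₂, mult, ord_eq_natCast_of_eq_pow e₂, min_eq_right l₂.le]
  | same =>
    obtain ⟨⟨m₁, hm₁, e₁, l₁⟩, m₂, hm₂, e₂, l₂⟩ := hφ.2.1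
    have h₁ := puiseuxCoord_of_lt_ord hm₁ (analyticAt_snd_comp hb.1.1) l₁
    have h₂ := puiseuxCoord_of_lt_ord hm₂ (analyticAt_snd_comp hb.2.1.1) l₂
    have ht : TEquiv .same φ (puiseux .same m₁ m₂ (fun t => (φ.1 t).2) (fun t => (φ.2 t).2)) := by
      refine tequiv_of_eventuallyEq ?_ ?_
      · filter_upwards [e₁] with t ht
        exact Prod.ext ht rfl
      · filter_upwards [e₂] with t ht
        exact Prod.ext ht rfl
    refine ⟨m₁, m₂, _, _, h₁, h₂, ht.mem_sigmaSet hφ (inPuiseuxForm_puiseux _ h₁ h₂) ?_ ?_, ht⟩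
    · rw [mult_puiseux₁ _ h₁, mult, ord_eq_natCast_of_eq_pow e₁, min_eq_left l₁.le]
    · rw [mult_puiseux₂ _ h₂, mult, ord_eq_natCast_of_eq_pow e₂, min_eq_left l₂.le]

/-! ### Every bigerm has a Puiseux form -/

theorem isGermAut_of_det {σ : ℂ × ℂ → ℂ × ℂ} (hσ : AnalyticAt ℂ σ 0) (h0 : σ 0 = 0)
    (hdet : pdx (fun p => (σ p).1) 0 * pdy (fun p => (σ p).2) 0 -
      pdy (fun p => (σ p).1) 0 * pdx (fun p => (σ p).2) 0 ≠ 0) : IsGermAut σ := by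
  refine ⟨hσ, h0, ?_⟩
  have e : ∀ v, fderiv ℂ σ 0 v = (fderiv ℂ (fun p => (σ p).1) 0 v, fderiv ℂ (fun p => (σ p).2) 0 v) := by
    intro v
    have h1 := DifferentiableAt.fderiv_prodMk (analyticAt_fst_comp hσ).differentiableAt
      (analyticAt_snd_comp hσ).differentiableAt
    exact congrArg (fun L => L v) h1
  have hinj : Function.Injective (fderiv ℂ σ 0 : ℂ × ℂ →ₗ[ℂ] ℂ × ℂ) := by
    rw [← LinearMap.ker_eq_bot, LinearMap.ker_eq_bot']
    intro v hv
    have hv' : fderiv ℂ σ 0 v = 0 := hv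
    rw [e, fderiv_apply_eq, fderiv_apply_eq, Prod.mk_eq_zero] at hv'
    obtain ⟨h1, h2⟩ := hv'
    set a := pdx (fun p => (σ p).1) 0
    set b := pdy (fun p => (σ p).1) 0
    set c := pdx (fun p => (σ p).2) 0
    set d := pdy (fun p => (σ p).2) 0
    have h3 : (a * d - b * c) * v.1 = 0 := by linear_combination d * h1 - b * h2
    have h4 : (a * d - b * c) * v.2 = 0 := by linear_combination a * h2 - c * h1
    exact Prod.ext ((mul_eq_zero.mp h3).resolve_left hdet) ((mul_eq_zero.mp h4).resolve_left hdet)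
  refine ⟨(LinearEquiv.ofInjectiveEndo _ hinj).toContinuousLinearEquiv, ?_⟩
  ext <;> rfl

theorem pdx_linear (a b : ℂ) (q : ℂ × ℂ) : pdx (fun p => a * p.1 + b * p.2) q = a := by
  rw [pdx, fderiv_fun_add (by fun_prop) (by fun_prop), fderiv_const_mul (by fun_prop),
    fderiv_const_mul (by fun_prop), fderiv_fst, fderiv_snd]
  simp

theorem pdy_linear (a b : ℂ) (q : ℂ × ℂ) : pdy (fun p => a * p.1 + b * p.2) q = b := by
  rw [pdy, fderiv_fun_add (by fun_prop) (by fun_prop), fderiv_const_mul (by fun_prop),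
    fderiv_const_mul (by fun_prop), fderiv_fst, fderiv_snd]
  simp

theorem isGermAut_linear {a b c d : ℂ} (h : a * d - b * c ≠ 0) :
    IsGermAut fun p : ℂ × ℂ => (a * p.1 + b * p.2, c * p.1 + d * p.2) := by
  refine isGermAut_of_det ?_ (by simp) ?_
  · exact ((analyticAt_const.mul analyticAt_fst).add (analyticAt_const.mul analyticAt_snd)).prod
      ((analyticAt_const.mul analyticAt_fst).add (analyticAt_const.mul analyticAt_snd))
  · rw [pdx_linear, pdy_linear, pdx_linear, pdy_linear]
    exact h

theorem IsBranch.exists_leading {f : ℂ → ℂ × ℂ} (hf : IsBranch f) :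
    ∃ m : ℕ, 0 < m ∧ PowerSeries.X ^ m ∣ taylor (fun t => (f t).1) ∧
      PowerSeries.X ^ m ∣ taylor (fun t => (f t).2) ∧
      (PowerSeries.coeff m (taylor fun t => (f t).1) ≠ 0 ∨
        PowerSeries.coeff m (taylor fun t => (f t).2) ≠ 0) := by
  classical
  obtain ⟨ha, h0, U, hU, hinj⟩ := hf
  have hex : ∃ m, PowerSeries.coeff m (taylor fun t => (f t).1) ≠ 0 ∨
      PowerSeries.coeff m (taylor fun t => (f t).2) ≠ 0 := by
    by_contra hne
    push Not at hne
    have h1 := eventuallyEq_zero_of_taylor (analyticAt_fst_comp ha)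
      (PowerSeries.ext fun n => by simpa using (hne n).1)
    have h2 := eventuallyEq_zero_of_taylor (analyticAt_snd_comp ha)
      (PowerSeries.ext fun n => by simpa using (hne n).2)
    have h3 : ∀ᶠ t in 𝓝[≠] (0 : ℂ), f t = 0 ∧ t ∈ U ∧ t ≠ 0 := by
      have : ∀ᶠ t in 𝓝 (0 : ℂ), f t = 0 ∧ t ∈ U := by
        filter_upwards [h1, h2, hU] with t e1 e2 e3
        exact ⟨Prod.ext e1 e2, e3⟩
      filter_upwards [this.filter_mono nhdsWithin_le_nhds, self_mem_nhdsWithin] with t e1 e2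
      exact ⟨e1.1, e1.2, e2⟩
    obtain ⟨t, e1, e2, e3⟩ := h3.exists
    exact e3 (hinj e2 (mem_of_mem_nhds hU) (by rw [e1, h0]))
  refine ⟨Nat.find hex, ?_, ?_, ?_, Nat.find_spec hex⟩
  · rw [Nat.pos_iff_ne_zero]
    intro h
    have := Nat.find_spec hex
    rw [h] at this
    simp [constantCoeff_taylor, h0] at this
  · rw [PowerSeries.X_pow_dvd_iff]
    intro k hk
    have := Nat.find_min hex hk
    push Not at this
    exact this.1
  · rw [PowerSeries.X_pow_dvd_iff]
    intro k hk
    have := Nat.find_min hex hk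
    push Not at this
    exact this.2

theorem taylor_linear {f : ℂ → ℂ × ℂ} (hf : AnalyticAt ℂ f 0) (a b : ℂ) :
    taylor (fun t => a * (f t).1 + b * (f t).2) =
      a • taylor (fun t => (f t).1) + b • taylor (fun t => (f t).2) := by
  rw [taylor_add (f := fun t => a * (f t).1) (g := fun t => b * (f t).2)
    (analyticAt_const.mul (analyticAt_fst_comp hf)) (analyticAt_const.mul (analyticAt_snd_comp hf)),
    taylor_const_mul, taylor_const_mul]

theorem exists_puiseuxCoord {u v : ℂ → ℂ} (hu : AnalyticAt ℂ u 0) (hv : AnalyticAt ℂ v 0) {m : ℕ}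
    (hm : 0 < m) (hd : PowerSeries.X ^ m ∣ taylor u) (hc : PowerSeries.coeff m (taylor u) ≠ 0)
    (hdv : PowerSeries.X ^ m ∣ taylor v) (hcv : PowerSeries.coeff m (taylor v) = 0) :
    ∃ ρ y : ℂ → ℂ, IsGermAut ρ ∧ PuiseuxCoord m y ∧ (u =ᶠ[𝓝 0] fun t => ρ t ^ m) ∧
      (v =ᶠ[𝓝 0] fun t => y (ρ t)) := by
  obtain ⟨d, hd'⟩ := IsAlgClosed.exists_pow_nat_eq (PowerSeries.coeff m (taylor u)) hm
  obtain ⟨ρ, y, hρ, -, hy, h1, h2, r, hr, hyr⟩ := exists_reparam hu hv hm hd hd' (by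
    rintro rfl
    rw [zero_pow hm.ne'] at hd'
    exact hc hd'.symm)
  refine ⟨ρ, y, hρ, ⟨hm, hy, ?_⟩, h1, h2⟩
  rw [hyr]
  refine subst_X_pow_dvd hr ?_
  rw [PowerSeries.X_pow_dvd_iff] at hdv ⊢
  intro k hk
  rcases Nat.lt_succ_iff_lt_or_eq.mp hk with h | rfl
  · exact hdv k h
  · exact hcv

/-- The vectors `(v₁, v₂)` and `(w₁, w₂)` are the tangent directions. If they are parallel, the new
`y` kills both and the new `x` is a linear form vanishing on neither; if they are independent, each
new coordinate kills one of them. Roots of the leading coordinates then give Puiseux form. -/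
theorem exists_aequiv_mem_sigmaSet {φ : Bigerm} (hφ : IsBigerm φ) :
    ∃ (δ : Tangents) (Γ Λ : Set (ℕ × ℕ)), ∃ φ' ∈ SigmaSet δ Γ Λ, AEquiv φ φ' := by
  suffices ∃ (δ : Tangents) (φ' : Bigerm), InPuiseuxForm δ φ' ∧ AEquiv φ φ' by
    obtain ⟨δ, φ', h1, h2⟩ := this
    exact ⟨δ, _, _, φ', ⟨h2.tequiv.isBigerm hφ, h1, rfl, rfl⟩, h2⟩
  obtain ⟨m₁, hm₁, hx₁, hy₁, hc₁⟩ := hφ.1.exists_leading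
  obtain ⟨m₂, hm₂, hx₂, hy₂, hc₂⟩ := hφ.2.1.exists_leading
  have a₁ := hφ.1.1
  have a₂ := hφ.2.1.1
  have lin : ∀ {f : ℂ → ℂ × ℂ}, AnalyticAt ℂ f 0 → ∀ a b : ℂ,
      AnalyticAt ℂ (fun t => a * (f t).1 + b * (f t).2) 0 := fun hf a b =>
    (analyticAt_const.mul (analyticAt_fst_comp hf)).add
      (analyticAt_const.mul (analyticAt_snd_comp hf))
  have dl₁ : ∀ a b : ℂ, PowerSeries.X ^ m₁ ∣ taylor fun t => a * (φ.1 t).1 + b * (φ.1 t).2 := by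
    intro a b
    rw [taylor_linear a₁]
    exact dvd_add (dvd_smul_of_dvd _ hx₁) (dvd_smul_of_dvd _ hy₁)
  have dl₂ : ∀ a b : ℂ, PowerSeries.X ^ m₂ ∣ taylor fun t => a * (φ.2 t).1 + b * (φ.2 t).2 := by
    intro a b
    rw [taylor_linear a₂]
    exact dvd_add (dvd_smul_of_dvd _ hx₂) (dvd_smul_of_dvd _ hy₂)
  set v₁ := PowerSeries.coeff m₁ (taylor fun t => (φ.1 t).1) with hv₁
  set v₂ := PowerSeries.coeff m₁ (taylor fun t => (φ.1 t).2) with hv₂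
  set w₁ := PowerSeries.coeff m₂ (taylor fun t => (φ.2 t).1) with hw₁
  set w₂ := PowerSeries.coeff m₂ (taylor fun t => (φ.2 t).2) with hw₂
  have cl₁ : ∀ a b : ℂ, PowerSeries.coeff m₁ (taylor fun t => a * (φ.1 t).1 + b * (φ.1 t).2) =
      a * v₁ + b * v₂ := by
    intro a b
    rw [taylor_linear a₁]
    simp [hv₁, hv₂]
  have cl₂ : ∀ a b : ℂ, PowerSeries.coeff m₂ (taylor fun t => a * (φ.2 t).1 + b * (φ.2 t).2) =
      a * w₁ + b * w₂ := by
    intro a b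
    rw [taylor_linear a₂]
    simp [hw₁, hw₂]
  by_cases hdet : v₁ * w₂ - v₂ * w₁ = 0
  · have hab : ∃ a b : ℂ, a * v₁ + b * v₂ ≠ 0 ∧ a * w₁ + b * w₂ ≠ 0 := by
      by_cases h : v₁ = 0
      · refine ⟨0, 1, ?_, ?_⟩
        · rcases hc₁ with h' | h'
          · exact absurd h h'
          · simpa using h'
        · have hv2 : v₂ ≠ 0 := by
            rcases hc₁ with h' | h'
            · exact absurd h h'
            · exact h'
          have hw1 : w₁ = 0 := by
            rw [h] at hdet
            have : v₂ * w₁ = 0 := by linear_combination -hdet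
            exact (mul_eq_zero.mp this).resolve_left hv2
          rcases hc₂ with h' | h'
          · exact absurd hw1 h'
          · simpa using h'
      · refine ⟨1, 0, by simpa using h, ?_⟩
        have : w₁ ≠ 0 := by
          intro hw1
          rw [hw1] at hdet
          have h4 : v₁ * w₂ = 0 := by linear_combination hdet
          have hw2 := (mul_eq_zero.mp h4).resolve_left h
          rcases hc₂ with h' | h'
          · exact h' hw1
          · exact h' hw2
        simpa using this
    obtain ⟨a, b, h1, h2⟩ := hab
    obtain ⟨ρ₁, y₁, hρ₁, hp₁, e₁, e₁'⟩ := exists_puiseuxCoord (lin a₁ a b) (lin a₁ (-v₂) v₁) hm₁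
      (dl₁ _ _) (by rw [cl₁]; exact h1) (dl₁ _ _) (by rw [cl₁]; ring)
    obtain ⟨ρ₂, y₂, hρ₂, hp₂, e₂, e₂'⟩ := exists_puiseuxCoord (lin a₂ a b) (lin a₂ (-v₂) v₁) hm₂
      (dl₂ _ _) (by rw [cl₂]; exact h2) (dl₂ _ _) (by rw [cl₂]; linear_combination hdet)
    refine ⟨.same, puiseux .same m₁ m₂ y₁ y₂, inPuiseuxForm_puiseux _ hp₁ hp₂, ρ₁, ρ₂, _, hρ₁, hρ₂,
      isGermAut_linear (a := a) (b := b) (c := -v₂) (d := v₁) ?_, ?_, ?_⟩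
    · intro h; apply h1; linear_combination h
    · filter_upwards [e₁, e₁'] with t h1 h2
      exact Prod.ext h1 h2
    · filter_upwards [e₂, e₂'] with t h1 h2
      exact Prod.ext h1 h2
  · obtain ⟨ρ₁, y₁, hρ₁, hp₁, e₁, e₁'⟩ := exists_puiseuxCoord (lin a₁ (-w₂) w₁) (lin a₁ (-v₂) v₁) hm₁
      (dl₁ _ _) (by rw [cl₁]; intro h; apply hdet; linear_combination -h) (dl₁ _ _)
      (by rw [cl₁]; ring)
    obtain ⟨ρ₂, y₂, hρ₂, hp₂, e₂, e₂'⟩ := exists_puiseuxCoord (lin a₂ (-v₂) v₁) (lin a₂ (-w₂) w₁) hm₂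
      (dl₂ _ _) (by rw [cl₂]; intro h; apply hdet; linear_combination h) (dl₂ _ _)
      (by rw [cl₂]; ring)
    refine ⟨.distinct, puiseux .distinct m₁ m₂ y₁ y₂, inPuiseuxForm_puiseux _ hp₁ hp₂, ρ₁, ρ₂, _,
      hρ₁, hρ₂, isGermAut_linear (a := -w₂) (b := w₁) (c := -v₂) (d := v₁) ?_, ?_, ?_⟩
    · intro h; apply hdet; linear_combination -h
    · filter_upwards [e₁, e₁'] with t h1 h2
      exact Prod.ext h1 h2
    · filter_upwards [e₂, e₂'] with t h1 h2
      exact Prod.ext h2 h1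

/-! ### The conductor -/

theorem exists_root_lt (m : ℕ) {ε : ℝ} (hε : 0 < ε) :
    ∀ᶠ x in 𝓝 (0 : ℂ), ∀ t : ℂ, t ^ m = x → ‖t‖ < ε := by
  have : ∀ᶠ x in 𝓝 (0 : ℂ), ‖x‖ < ε ^ m := by
    have := (continuous_norm (E := ℂ)).tendsto 0
    rw [norm_zero] at this
    exact this.eventually (gt_mem_nhds (pow_pos hε m))
  filter_upwards [this] with x hx t ht
  rw [← ht, norm_pow] at hx
  exact lt_of_pow_lt_pow_left₀ m hε.le hx

theorem eventually_forall_root (m : ℕ) {p : ℂ → Prop} (h : ∀ᶠ t in 𝓝 0, p t) :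
    ∀ᶠ x in 𝓝 (0 : ℂ), ∀ t : ℂ, t ^ m = x → p t := by
  obtain ⟨ε, hε, h⟩ := Metric.eventually_nhds_iff.mp h
  filter_upwards [exists_root_lt m hε] with x hx t ht
  exact h (by simpa using hx t ht)

/-- The power series of `g` is split by the residues of its exponents modulo `m`. Each piece
converges at `t ^ m` because, up to the factor `t ^ r`, it is a subseries of the series of `g` at
`t`. -/
theorem exists_residue_decomposition {g : ℂ → ℂ} (hg : AnalyticAt ℂ g 0) (m : ℕ) [NeZero m] :
    ∃ G : ZMod m → ℂ → ℂ, (∀ r, AnalyticAt ℂ (G r) 0) ∧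
      ∀ᶠ t in 𝓝 (0 : ℂ), g t = ∑ r : ZMod m, t ^ r.val * G r (t ^ m) := by
  have hm : 0 < m := Nat.pos_of_ne_zero (NeZero.ne m)
  obtain ⟨p, hp⟩ := hg
  rw [hasFPowerSeriesAt_iff] at hp
  simp only [zero_add, smul_eq_mul] at hp
  set a := p.coeff
  set G : ZMod m → ℂ → ℂ := fun r x => ∑' k : ℕ, x ^ k * a (r.val + m * k) with hG
  have hsum : ∀ᶠ x in 𝓝 (0 : ℂ), ∀ r : ZMod m, Summable fun k : ℕ => x ^ k * a (r.val + m * k) := by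
    filter_upwards [eventually_forall_root m hp] with x hx r
    obtain ⟨t, ht⟩ := IsAlgClosed.exists_pow_nat_eq x hm
    have hs := (hx t ht).summable
    by_cases ht0 : t = 0
    · subst ht0
      rw [zero_pow hm.ne'] at ht
      subst ht
      refine summable_of_ne_finset_zero (s := {0}) fun k hk => ?_
      rw [zero_pow (by simpa using hk), zero_mul]
    · have hi : Function.Injective fun k : ℕ => r.val + m * k := by
        intro k l h
        simpa [hm.ne'] using h
      have := (hs.comp_injective hi).mul_left ((t ^ r.val)⁻¹)
      refine this.congr fun k => ?_
      simp only [Function.comp_apply]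
      rw [← ht, pow_add, pow_mul]
      field_simp
  refine ⟨G, fun r => ?_, ?_⟩
  · set q : FormalMultilinearSeries ℂ ℂ ℂ :=
      FormalMultilinearSeries.ofScalars ℂ fun k => a (r.val + m * k) with hq
    refine HasFPowerSeriesAt.analyticAt (p := q) ?_
    rw [hasFPowerSeriesAt_iff]
    filter_upwards [hsum] with x hx
    have := (hx r).hasSum
    simpa [hG, hq, FormalMultilinearSeries.coeff_ofScalars] using this
  · filter_upwards [hp] with t ht
    rw [← ht.tsum_eq, Nat.sumByResidueClasses ht.summable m]
    refine Finset.sum_congr rfl fun r _ => ?_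
    rw [hG, ← tsum_mul_left]
    refine tsum_congr fun k => ?_
    rw [pow_add, pow_mul]; ring

theorem analyticAt_det {E ι : Type*} [NormedAddCommGroup E] [NormedSpace ℂ E] [Fintype ι]
    [DecidableEq ι] {M : E → Matrix ι ι ℂ} {z : E}
    (hM : ∀ i j, AnalyticAt ℂ (fun x => M x i j) z) : AnalyticAt ℂ (fun x => (M x).det) z := by
  simp only [Matrix.det_apply']
  exact Finset.analyticAt_fun_sum _ fun σ _ =>
    analyticAt_const.mul (Finset.analyticAt_fun_prod _ fun i _ => hM _ _)

theorem analyticAt_adjugate {E ι : Type*} [NormedAddCommGroup E] [NormedSpace ℂ E] [Fintype ι]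
    [DecidableEq ι] {M : E → Matrix ι ι ℂ} {z : E}
    (hM : ∀ i j, AnalyticAt ℂ (fun x => M x i j) z) (i j : ι) :
    AnalyticAt ℂ (fun x => (M x).adjugate i j) z := by
  simp only [Matrix.adjugate_apply]
  refine analyticAt_det fun k l => ?_
  by_cases h : k = j
  · subst h
    simpa using analyticAt_const
  · simpa [Matrix.updateRow_ne h] using hM k l

/-- `c` is a conductor exponent: pairs of germs of order at least `c` come from functions on the
plane. -/
def HasConductor (φ : Bigerm) (c : ℕ) : Prop :=
  ∀ g₁ g₂ : ℂ → ℂ, AnalyticAt ℂ g₁ 0 → AnalyticAt ℂ g₂ 0 → PowerSeries.X ^ c ∣ taylor g₁ →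
    PowerSeries.X ^ c ∣ taylor g₂ →
    ∃ η : ℂ × ℂ → ℂ, AnalyticAt ℂ η 0 ∧ η ∘ φ.1 =ᶠ[𝓝 0] g₁ ∧ η ∘ φ.2 =ᶠ[𝓝 0] g₂

theorem HasConductor.of_aequiv {φ ψ : Bigerm} {c : ℕ} (h : AEquiv φ ψ) (hc : HasConductor ψ c) :
    HasConductor φ c := by
  obtain ⟨ρ₁, ρ₂, σ, h₁, h₂, hσ, h⟩ := h
  obtain ⟨ρ₁', hρ₁', hl₁, -⟩ := h₁.exists_inverse
  obtain ⟨ρ₂', hρ₂', hl₂, -⟩ := h₂.exists_inverse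
  intro g₁ g₂ ha₁ ha₂ hd₁ hd₂
  obtain ⟨η, hη, e₁, e₂⟩ := hc (fun t => g₁ (ρ₁' t)) (fun t => g₂ (ρ₂' t))
    (AnalyticAt.fun_comp (by rwa [hρ₁'.2.1]) hρ₁'.1) (AnalyticAt.fun_comp (by rwa [hρ₂'.2.1]) hρ₂'.1)
    (by rw [taylor_comp ha₁ hρ₁'.1 hρ₁'.2.1]; exact subst_X_pow_dvd (X_dvd_taylor hρ₁'.2.1) hd₁)
    (by rw [taylor_comp ha₂ hρ₂'.1 hρ₂'.2.1]; exact subst_X_pow_dvd (X_dvd_taylor hρ₂'.2.1) hd₂)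
  refine ⟨η ∘ σ, AnalyticAt.comp (by rwa [hσ.2.1]) hσ.1, ?_, ?_⟩
  · filter_upwards [h.1, h₁.tendsto.eventually e₁, hl₁] with t e1 e2 e3
    simp only [Function.comp_apply] at e1 e2 ⊢
    rw [e1, e2, e3]
  · filter_upwards [h.2, h₂.tendsto.eventually e₂, hl₂] with t e1 e2 e3
    simp only [Function.comp_apply] at e1 e2 ⊢
    rw [e1, e2, e3]

theorem card_nthRoots_toFinset {m : ℕ} (hm : 0 < m) {x : ℂ} (hx : x ≠ 0) :
    (nthRoots m x).toFinset.card = m := by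
  have hζ := Complex.isPrimitiveRoot_exp m hm.ne'
  rw [Multiset.toFinset_card_of_nodup (hζ.nthRoots_nodup hx), hζ.card_nthRoots, if_pos]
  exact IsAlgClosed.exists_pow_nat_eq x hm

/-- A polynomial of degree less than `m₁ + m₂` that vanishes on all second coordinates above a
point `x ≠ 0` close to `0` is zero. -/
theorem eventually_eq_zero_of_vanishing {m₁ m₂ : ℕ} (hm₁ : 0 < m₁) (hm₂ : 0 < m₂) {s₁ s₂ : ℂ → ℂ}
    (hb : IsBigerm (fun t => (t ^ m₁, s₁ t), fun t => (t ^ m₂, s₂ t))) :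
    ∀ᶠ x in 𝓝 (0 : ℂ), x ≠ 0 → ∀ p : ℂ[X], p.natDegree < m₁ + m₂ →
      (∀ t, t ^ m₁ = x → p.eval (s₁ t) = 0) → (∀ t, t ^ m₂ = x → p.eval (s₂ t) = 0) → p = 0 := by
  classical
  obtain ⟨⟨-, -, U₁, hU₁, hi₁⟩, ⟨-, -, U₂, hU₂, hi₂⟩, U, hU, hd⟩ := hb
  filter_upwards [eventually_forall_root m₁ hU₁, eventually_forall_root m₂ hU₂,
    eventually_forall_root m₁ hU, eventually_forall_root m₂ hU] with x h₁ h₂ h₁' h₂' hx p hp e₁ e₂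
  set R₁ := (nthRoots m₁ x).toFinset with hR₁
  set R₂ := (nthRoots m₂ x).toFinset with hR₂
  have mem₁ : ∀ t ∈ R₁, t ^ m₁ = x := fun t ht => by
    rwa [hR₁, Multiset.mem_toFinset, mem_nthRoots hm₁] at ht
  have mem₂ : ∀ t ∈ R₂, t ^ m₂ = x := fun t ht => by
    rwa [hR₂, Multiset.mem_toFinset, mem_nthRoots hm₂] at ht
  -- Injectivity of each parametrization gives `m₁`, respectively `m₂`, distinct ordinates above
  -- `x`, and distinctness of the branches makes the two sets disjoint. A polynomial with that many
  -- roots exceeds the degree bound.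
  have c₁ : (R₁.image s₁).card = m₁ := by
    rw [Finset.card_image_of_injOn, card_nthRoots_toFinset hm₁ hx]
    intro t ht t' ht' hs
    have e := mem₁ t ht
    have e' := mem₁ t' ht'
    exact hi₁ (h₁ t e) (h₁ t' e') (Prod.ext (e.trans e'.symm) hs)
  have c₂ : (R₂.image s₂).card = m₂ := by
    rw [Finset.card_image_of_injOn, card_nthRoots_toFinset hm₂ hx]
    intro t ht t' ht' hs
    have e := mem₂ t ht
    have e' := mem₂ t' ht'
    exact hi₂ (h₂ t e) (h₂ t' e') (Prod.ext (e.trans e'.symm) hs)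
  have hdisj : Disjoint (R₁.image s₁) (R₂.image s₂) := by
    rw [Finset.disjoint_left]
    intro y hy hy'
    obtain ⟨t, ht, rfl⟩ := Finset.mem_image.mp hy
    obtain ⟨t', ht', hs⟩ := Finset.mem_image.mp hy'
    have e := mem₁ t ht
    have e' := mem₂ t' ht'
    have := hd t (h₁' t e) t' (h₂' t' e') (Prod.ext (e.trans e'.symm) hs.symm)
    rw [this.1, zero_pow hm₁.ne'] at e
    exact hx e.symm
  refine eq_zero_of_natDegree_lt_card_of_eval_eq_zero' p (R₁.image s₁ ∪ R₂.image s₂) ?_ ?_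
  · intro y hy
    rcases Finset.mem_union.mp hy with hy | hy
    · obtain ⟨t, ht, rfl⟩ := Finset.mem_image.mp hy
      exact e₁ t (mem₁ t ht)
    · obtain ⟨t, ht, rfl⟩ := Finset.mem_image.mp hy
      exact e₂ t (mem₂ t ht)
  · rwa [Finset.card_union_of_disjoint hdisj, c₁, c₂]

/-- Restricted to the two branches and expanded by residues of exponents over convergent series in
`x`, the functions `1, y, …, y ^ (m₁ + m₂ - 1)` form a square matrix. For small `x ≠ 0` its
determinant is nonzero: a kernel vector would be a polynomial in `y` with too many zeros above `x`.
The determinant is therefore `x ^ d` times a unit, and Cramer's rule lifts every pair of germs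
divisible by it. -/
theorem exists_hasConductor_of_graph {m₁ m₂ : ℕ} (hm₁ : 0 < m₁) (hm₂ : 0 < m₂) {s₁ s₂ : ℂ → ℂ}
    (hb : IsBigerm (fun t => (t ^ m₁, s₁ t), fun t => (t ^ m₂, s₂ t))) :
    ∃ c, HasConductor (fun t => (t ^ m₁, s₁ t), fun t => (t ^ m₂, s₂ t)) c := by
  classical
  have : NeZero m₁ := ⟨hm₁.ne'⟩
  have : NeZero m₂ := ⟨hm₂.ne'⟩
  have a₁ : AnalyticAt ℂ s₁ 0 := analyticAt_snd_comp hb.1.1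
  have a₂ : AnalyticAt ℂ s₂ 0 := analyticAt_snd_comp hb.2.1.1
  let ι := ZMod m₁ ⊕ ZMod m₂
  have hcard : Fintype.card ι = m₁ + m₂ := by simp [ι, ZMod.card]
  let e : ι ≃ Fin (m₁ + m₂) := Fintype.equivFinOfCardEq hcard
  choose S₁ hS₁ eS₁ using fun k : ℕ => exists_residue_decomposition (a₁.fun_pow k) m₁
  choose S₂ hS₂ eS₂ using fun k : ℕ => exists_residue_decomposition (a₂.fun_pow k) m₂
  let M : ℂ → Matrix ι ι ℂ := fun x => Matrix.of fun i j =>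
    Sum.elim (fun r => S₁ (e i) r x) (fun r => S₂ (e i) r x) j
  have hM : ∀ i j, AnalyticAt ℂ (fun x => M x i j) 0 := by
    rintro i (r | r)
    · exact hS₁ _ _
    · exact hS₂ _ _
  have eS₁' : ∀ᶠ t in 𝓝 (0 : ℂ), ∀ i : ι,
      s₁ t ^ (e i : ℕ) = ∑ r : ZMod m₁, t ^ r.val * M (t ^ m₁) i (Sum.inl r) :=
    eventually_all.mpr fun i => eS₁ (e i)
  have eS₂' : ∀ᶠ t in 𝓝 (0 : ℂ), ∀ i : ι,
      s₂ t ^ (e i : ℕ) = ∑ r : ZMod m₂, t ^ r.val * M (t ^ m₂) i (Sum.inr r) :=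
    eventually_all.mpr fun i => eS₂ (e i)
  let D : ℂ → ℂ := fun x => (M x).det
  have hD : AnalyticAt ℂ D 0 := analyticAt_det hM
  have hD0 : ∀ᶠ x in 𝓝 (0 : ℂ), x ≠ 0 → D x ≠ 0 := by
    filter_upwards [eventually_eq_zero_of_vanishing hm₁ hm₂ hb, eventually_forall_root m₁ eS₁',
      eventually_forall_root m₂ eS₂'] with x hx h₁ h₂ hx0 hdet
    obtain ⟨c, hc0, hc⟩ := Matrix.exists_vecMul_eq_zero_iff.mpr hdet
    have hcj : ∀ j, ∑ i, c i * M x i j = 0 := fun j => congrFun hc j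
    let p : ℂ[X] := ∑ i, C (c i) * X ^ (e i : ℕ)
    have hp : p = 0 := by
      refine hx hx0 p ?_ ?_ ?_
      · refine lt_of_le_of_lt (natDegree_sum_le_of_forall_le (n := m₁ + m₂ - 1) _ _ fun i _ => ?_)
          (by omega)
        refine (natDegree_C_mul_X_pow_le _ _).trans ?_
        have := (e i).isLt
        omega
      · intro t ht
        simp only [p, eval_finsetSum, eval_mul, eval_C, eval_pow, eval_X]
        simp_rw [h₁ t ht, Finset.mul_sum]
        rw [Finset.sum_comm]
        refine Finset.sum_eq_zero fun r _ => ?_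
        rw [ht]
        have := congrArg (fun z => t ^ r.val * z) (hcj (Sum.inl r))
        simp only [mul_zero, Finset.mul_sum] at this
        rw [← this]
        exact Finset.sum_congr rfl fun i _ => by ring
      · intro t ht
        simp only [p, eval_finsetSum, eval_mul, eval_C, eval_pow, eval_X]
        simp_rw [h₂ t ht, Finset.mul_sum]
        rw [Finset.sum_comm]
        refine Finset.sum_eq_zero fun r _ => ?_
        rw [ht]
        have := congrArg (fun z => t ^ r.val * z) (hcj (Sum.inr r))
        simp only [mul_zero, Finset.mul_sum] at this
        rw [← this]
        exact Finset.sum_congr rfl fun i _ => by ring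
    refine hc0 (funext fun i => ?_)
    have := congrArg (fun q => q.coeff (e i : ℕ)) hp
    simp only [p, finsetSum_coeff, coeff_C_mul, coeff_X_pow, coeff_zero] at this
    rw [Finset.sum_eq_single i] at this
    · simpa using this
    · intro j _ hj
      rw [if_neg, mul_zero]
      intro h
      exact hj (e.injective (Fin.ext h)).symm
    · simp
  have hDtop : ord D ≠ ⊤ := by
    intro h
    have h1 : ∀ᶠ x in 𝓝 (0 : ℂ), D x = 0 := analyticOrderAt_eq_top.mp h
    have h2 : ∀ᶠ x in 𝓝[≠] (0 : ℂ), False := by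
      filter_upwards [(h1.and hD0).filter_mono nhdsWithin_le_nhds, self_mem_nhdsWithin] with x hx hx0
      exact hx.2 hx0 hx.1
    exact h2.exists.elim fun _ h => h
  obtain ⟨d, hd⟩ := ENat.ne_top_iff_exists.mp hDtop
  obtain ⟨u, hu, hu0, hDu⟩ := (hD.analyticOrderAt_eq_natCast).mp hd.symm
  simp only [sub_zero, smul_eq_mul] at hDu
  -- On branch `i` the function `x ^ d` is `t ^ (d mᵢ)`, and `d (m₁ + m₂)` bounds both exponents.
  refine ⟨d * (m₁ + m₂), fun g₁ g₂ hg₁ hg₂ hd₁ hd₂ => ?_⟩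
  -- divide by the determinant
  have div : ∀ {m : ℕ}, 0 < m → m ≤ m₁ + m₂ → ∀ {g : ℂ → ℂ}, AnalyticAt ℂ g 0 →
      PowerSeries.X ^ (d * (m₁ + m₂)) ∣ taylor g →
      ∃ h : ℂ → ℂ, AnalyticAt ℂ h 0 ∧ ∀ᶠ t in 𝓝 (0 : ℂ), g t = D (t ^ m) * h t := by
    intro m hm hmm g hg hgd
    obtain ⟨k, hk, hgk, -⟩ := exists_eq_pow_mul hg ((pow_dvd_pow _ (Nat.mul_le_mul_left d hmm)).trans hgd)
    have ht : Tendsto (fun t : ℂ => t ^ m) (𝓝 0) (𝓝 0) := by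
      have := (continuous_pow m (M := ℂ)).tendsto 0
      rwa [zero_pow hm.ne'] at this
    have hum : AnalyticAt ℂ (fun t => u (t ^ m)) 0 :=
      AnalyticAt.fun_comp (by rwa [zero_pow hm.ne']) (by fun_prop)
    have hum0 : u ((0 : ℂ) ^ m) ≠ 0 := by rwa [zero_pow hm.ne']
    refine ⟨fun t => k t / u (t ^ m), hk.div hum hum0, ?_⟩
    filter_upwards [hgk, ht.eventually hDu, hum.continuousAt.eventually_ne hum0] with t e1 e2 e3
    rw [e1, e2, ← pow_mul, mul_comm m d]
    field_simp
  obtain ⟨h₁, hh₁, eh₁⟩ := div hm₁ (by omega) hg₁ hd₁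
  obtain ⟨h₂, hh₂, eh₂⟩ := div hm₂ (by omega) hg₂ hd₂
  obtain ⟨H₁, hH₁, eH₁⟩ := exists_residue_decomposition hh₁ m₁
  obtain ⟨H₂, hH₂, eH₂⟩ := exists_residue_decomposition hh₂ m₂
  let H : ℂ → ι → ℂ := fun x => Sum.elim (fun r => H₁ r x) (fun r => H₂ r x)
  have hH : ∀ j, AnalyticAt ℂ (fun x => H x j) 0 := by
    rintro (r | r)
    · exact hH₁ _
    · exact hH₂ _
  -- Cramer's rule: multiplication by the adjugate gives analytic coefficients with `c M = D H`.
  let c : ℂ → ι → ℂ := fun x => Matrix.vecMul (H x) (M x).adjugate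
  have hc : ∀ i, AnalyticAt ℂ (fun x => c x i) 0 := by
    intro i
    change AnalyticAt ℂ (fun x => ∑ j, H x j * (M x).adjugate j i) 0
    exact Finset.analyticAt_fun_sum _ fun j _ => (hH j).mul (analyticAt_adjugate hM j i)
  have hcM : ∀ x j, ∑ i, c x i * M x i j = D x * H x j := by
    intro x j
    have : Matrix.vecMul (c x) (M x) = D x • H x := by
      simp only [c, D]
      rw [Matrix.vecMul_vecMul, Matrix.adjugate_mul, Matrix.vecMul_smul, Matrix.vecMul_one]
    exact congrFun this j
  refine ⟨fun q => ∑ i, c q.1 i * q.2 ^ (e i : ℕ), ?_, ?_, ?_⟩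
  · refine Finset.analyticAt_fun_sum _ fun i _ => AnalyticAt.mul ?_ (analyticAt_snd.pow _)
    exact AnalyticAt.fun_comp (g := fun x => c x i) (f := Prod.fst) (hc i) analyticAt_fst
  · filter_upwards [eh₁, eH₁, eS₁'] with t e1 e2 e3
    simp only [Function.comp_apply]
    rw [e1, e2]
    simp_rw [e3, Finset.mul_sum]
    rw [Finset.sum_comm]
    refine Finset.sum_congr rfl fun r _ => ?_
    have := congrArg (fun z => t ^ r.val * z) (hcM (t ^ m₁) (Sum.inl r))
    simp only [Finset.mul_sum] at this
    rw [mul_left_comm]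
    refine Eq.trans (Finset.sum_congr rfl fun i _ => by ring) this
  · filter_upwards [eh₂, eH₂, eS₂'] with t e1 e2 e3
    simp only [Function.comp_apply]
    rw [e1, e2]
    simp_rw [e3, Finset.mul_sum]
    rw [Finset.sum_comm]
    refine Finset.sum_congr rfl fun r _ => ?_
    have := congrArg (fun z => t ^ r.val * z) (hcM (t ^ m₂) (Sum.inr r))
    simp only [Finset.mul_sum] at this
    rw [mul_left_comm]
    refine Eq.trans (Finset.sum_congr rfl fun i _ => by ring) this

/-- The graph case needs a coordinate of order `mᵢ` on both branches. For distinct tangents `x + y`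
is such a coordinate. -/
theorem exists_hasConductor {δ : Tangents} {m₁ m₂ : ℕ} {y₁ y₂ : ℂ → ℂ} (h₁ : PuiseuxCoord m₁ y₁)
    (h₂ : PuiseuxCoord m₂ y₂) (hb : IsBigerm (puiseux δ m₁ m₂ y₁ y₂)) :
    ∃ c, HasConductor (puiseux δ m₁ m₂ y₁ y₂) c := by
  cases δ with
  | same => exact exists_hasConductor_of_graph h₁.1 h₂.1 hb
  | distinct =>
    have key : ∀ {m : ℕ} {y v : ℂ → ℂ}, PuiseuxCoord m y → AnalyticAt ℂ v 0 →
        ∃ ρ s : ℂ → ℂ, IsGermAut ρ ∧ ((fun t => t ^ m + y t) =ᶠ[𝓝 0] fun t => ρ t ^ m) ∧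
          (v =ᶠ[𝓝 0] fun t => s (ρ t)) := by
      intro m y v h hv
      have hτ : taylor (fun t => t ^ m + y t) = PowerSeries.X ^ m + taylor y := by
        rw [taylor_add (f := fun t => t ^ m) (by fun_prop) h.2.1, taylor_id_pow]
      obtain ⟨ρ, s, hρ, -, -, e1, e2, -⟩ := exists_reparam (u := fun t => t ^ m + y t) (v := v)
        (d := 1) ((by fun_prop : AnalyticAt ℂ (fun t : ℂ => t ^ m) 0).add h.2.1) hv h.1
        (by rw [hτ]; exact dvd_add dvd_rfl ((pow_dvd_pow _ (Nat.le_succ m)).trans h.2.2))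
        (by rw [hτ, map_add, PowerSeries.X_pow_dvd_iff.mp h.2.2 m (Nat.lt_succ_self m)]
            simp [PowerSeries.coeff_X_pow]) one_ne_zero
      exact ⟨ρ, s, hρ, e1, e2⟩
    obtain ⟨ρ₁, s₁, hρ₁, e₁, e₁'⟩ := key h₁ h₁.2.1
    obtain ⟨ρ₂, s₂, hρ₂, e₂, e₂'⟩ := key h₂ (v := fun t => t ^ m₂) (by fun_prop)
    have hA : AEquiv (puiseux .distinct m₁ m₂ y₁ y₂)
        (fun t => (t ^ m₁, s₁ t), fun t => (t ^ m₂, s₂ t)) := by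
      refine ⟨ρ₁, ρ₂, _, hρ₁, hρ₂, isGermAut_linear (a := 1) (b := 1) (c := 0) (d := 1) (by simp),
        ?_, ?_⟩
      · filter_upwards [e₁, e₁'] with t h1 h2
        simp only [puiseux, Function.comp_apply, one_mul, zero_mul, zero_add]
        rw [← h1, ← h2]
      · filter_upwards [e₂, e₂'] with t h1 h2
        simp only [puiseux, Function.comp_apply, one_mul, zero_mul, zero_add]
        rw [← h1, ← h2, add_comm]
    obtain ⟨c, hc⟩ := exists_hasConductor_of_graph h₁.1 h₂.1 (hA.tequiv.isBigerm hb)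
    exact ⟨c, hc.of_aequiv hA⟩

/-! ### Finite determinacy -/

theorem pdx_of_inMaxSq {η : ℂ × ℂ → ℂ} (hη : InMaxSq η) (a b : ℂ) :
    pdx (fun p => a * p.1 + b * p.2 + η p) 0 = a := by
  have := pdx_linear a b 0
  rw [pdx] at this ⊢
  rw [fderiv_fun_add (by fun_prop) hη.1.differentiableAt, hη.2.2, add_zero, this]

theorem pdy_of_inMaxSq {η : ℂ × ℂ → ℂ} (hη : InMaxSq η) (a b : ℂ) :
    pdy (fun p => a * p.1 + b * p.2 + η p) 0 = b := by
  have := pdy_linear a b 0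
  rw [pdy] at this ⊢
  rw [fderiv_fun_add (by fun_prop) hη.1.differentiableAt, hη.2.2, add_zero, this]

/-- The transformations `(x + β y + ⋯, y + ⋯)`. -/
theorem isGermAut_unipotent {β : ℂ} {η₁ η₂ : ℂ × ℂ → ℂ} (h₁ : InMaxSq η₁) (h₂ : InMaxSq η₂)
    (δ : Tangents) :
    IsGermAut (fun p : ℂ × ℂ => (1 * p.1 + β * p.2 + η₁ p, 0 * p.1 + 1 * p.2 + η₂ p)) ∧
      PreservesTangent δ (fun p : ℂ × ℂ => (1 * p.1 + β * p.2 + η₁ p, 0 * p.1 + 1 * p.2 + η₂ p)) := by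
  have ha : AnalyticAt ℂ (fun p : ℂ × ℂ => (1 * p.1 + β * p.2 + η₁ p, 0 * p.1 + 1 * p.2 + η₂ p)) 0 :=
    AnalyticAt.prod
      (((analyticAt_const.mul analyticAt_fst).add (analyticAt_const.mul analyticAt_snd)).add h₁.1)
      (((analyticAt_const.mul analyticAt_fst).add (analyticAt_const.mul analyticAt_snd)).add h₂.1)
  constructor
  · refine isGermAut_of_det ha (by simp [h₁.2.1, h₂.2.1]) ?_
    rw [pdx_of_inMaxSq h₁, pdy_of_inMaxSq h₁, pdx_of_inMaxSq h₂, pdy_of_inMaxSq h₂]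
    simp
  · intro _
    refine ⟨1, fun v => ?_⟩
    have h3 := DifferentiableAt.fderiv_prodMk (analyticAt_fst_comp ha).differentiableAt
      (analyticAt_snd_comp ha).differentiableAt
    have h4 := congrArg (fun L => (L v).2) h3
    refine h4.trans ?_
    change fderiv ℂ (fun p : ℂ × ℂ => 0 * p.1 + 1 * p.2 + η₂ p) 0 v = _
    rw [fderiv_apply_eq, pdx_of_inMaxSq h₂, pdy_of_inMaxSq h₂]
    simp

theorem analyticAt_puiseux (δ : Tangents) {m₁ m₂ : ℕ} {y₁ y₂ : ℂ → ℂ} (h₁ : PuiseuxCoord m₁ y₁)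
    (h₂ : PuiseuxCoord m₂ y₂) :
    AnalyticAt ℂ (puiseux δ m₁ m₂ y₁ y₂).1 0 ∧ AnalyticAt ℂ (puiseux δ m₁ m₂ y₁ y₂).2 0 := by
  have p₁ : AnalyticAt ℂ (fun t : ℂ => t ^ m₁) 0 := by fun_prop
  have p₂ : AnalyticAt ℂ (fun t : ℂ => t ^ m₂) 0 := by fun_prop
  cases δ
  · exact ⟨p₁.prod h₁.2.1, h₂.2.1.prod p₂⟩
  · exact ⟨p₁.prod h₁.2.1, p₂.prod h₂.2.1⟩

/-- Terms of high order do not matter. -/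
theorem tequiv_of_high_order {δ : Tangents} {m₁ m₂ : ℕ} {y₁ y₂ y₁' y₂' : ℂ → ℂ}
    (h₁ : PuiseuxCoord m₁ y₁) (h₂ : PuiseuxCoord m₂ y₂) (h₁' : AnalyticAt ℂ y₁' 0)
    (h₂' : AnalyticAt ℂ y₂' 0) {c : ℕ} (hc : HasConductor (puiseux δ m₁ m₂ y₁ y₂) c)
    (hd₁ : PowerSeries.X ^ (c + 2 * (m₁ + m₂)) ∣ taylor y₁' - taylor y₁)
    (hd₂ : PowerSeries.X ^ (c + 2 * (m₁ + m₂)) ∣ taylor y₂' - taylor y₂) :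
    TEquiv δ (puiseux δ m₁ m₂ y₁ y₂) (puiseux δ m₁ m₂ y₁' y₂') := by
  -- The correction is written as `(x + y) ^ 2` along the branch times a germ of order at least `c`.
  -- The square accounts for `2 m` orders and places the correction in `(x, y)²`; the remaining `c`
  -- orders allow the other factor to be lifted to the plane.
  have key : ∀ {m : ℕ} {y y' : ℂ → ℂ}, m ≤ m₁ + m₂ → PuiseuxCoord m y → AnalyticAt ℂ y' 0 →
      PowerSeries.X ^ (c + 2 * (m₁ + m₂)) ∣ taylor y' - taylor y →
      ∃ h : ℂ → ℂ, AnalyticAt ℂ h 0 ∧ PowerSeries.X ^ c ∣ taylor h ∧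
        ∀ᶠ t in 𝓝 (0 : ℂ), y' t = y t + (t ^ m + y t) ^ 2 * h t := by
    intro m y y' hm h h' hd
    rw [← taylor_sub h' h.2.1] at hd
    obtain ⟨k, hk, e, -⟩ := exists_eq_pow_mul (h'.fun_sub h.2.1)
      ((pow_dvd_pow _ (by omega : c + 2 * m ≤ c + 2 * (m₁ + m₂))).trans hd)
    obtain ⟨z, hz, ez, -⟩ := exists_eq_pow_mul h.2.1 h.2.2
    have hw : AnalyticAt ℂ (fun t => (1 + t * z t) ^ 2) 0 :=
      (analyticAt_const.add (analyticAt_id.mul hz)).pow 2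
    have hw0 : (1 + (0 : ℂ) * z 0) ^ 2 ≠ 0 := by simp
    have hq : AnalyticAt ℂ (fun t => k t / (1 + t * z t) ^ 2) 0 := hk.div hw hw0
    refine ⟨fun t => t ^ c * (k t / (1 + t * z t) ^ 2),
      (by fun_prop : AnalyticAt ℂ (fun t : ℂ => t ^ c) 0).mul hq, ?_, ?_⟩
    · rw [taylor_mul (f := fun t => t ^ c) (by fun_prop) hq, taylor_id_pow]
      exact Dvd.intro _ rfl
    · filter_upwards [e, ez, hw.continuousAt.eventually_ne hw0] with t e1 e2 e3
      have e4 : k t / (1 + t * z t) ^ 2 * (1 + t * z t) ^ 2 = k t := div_mul_cancel₀ _ e3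
      rw [e2] at e1 ⊢
      linear_combination e1 - t ^ (c + 2 * m) * e4
  obtain ⟨k₁, hk₁, hkd₁, ek₁⟩ := key (by omega) h₁ h₁' hd₁
  obtain ⟨k₂, hk₂, hkd₂, ek₂⟩ := key (by omega) h₂ h₂' hd₂
  have hz : AnalyticAt ℂ (fun _ : ℂ => (0 : ℂ)) 0 := analyticAt_const
  have hzd : PowerSeries.X ^ c ∣ taylor fun _ : ℂ => (0 : ℂ) := by
    rw [taylor_const, map_zero]; exact dvd_zero _
  have hsq : ∀ {η : ℂ × ℂ → ℂ}, AnalyticAt ℂ η 0 → InMaxSq fun p => (p.1 + p.2) ^ 2 * η p := by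
    intro η hη
    have hs : AnalyticAt ℂ (fun p : ℂ × ℂ => p.1 + p.2) 0 := analyticAt_fst.add analyticAt_snd
    have := (inMaxSq_mul hs hs (by simp) (by simp)).mul hη
    simpa only [pow_two] using this
  cases δ with
  | same =>
    obtain ⟨η, hη, e₁, e₂⟩ := hc k₁ k₂ hk₁ hk₂ hkd₁ hkd₂
    have h0 : InMaxSq fun _ : ℂ × ℂ => (0 : ℂ) := ⟨analyticAt_const, rfl, by simp⟩
    obtain ⟨hσ, hσ'⟩ := isGermAut_unipotent (β := 0) h0 (hsq hη) .same
    refine ⟨fun t => t, fun t => t, _, isGermAut_id, isGermAut_id, hσ, hσ', ?_, ?_⟩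
    · filter_upwards [e₁, ek₁] with t e1 e2
      simp only [puiseux, Function.comp_apply] at e1 ⊢
      rw [e1, e2]; ring_nf
    · filter_upwards [e₂, ek₂] with t e1 e2
      simp only [puiseux, Function.comp_apply] at e1 ⊢
      rw [e1, e2]; ring_nf
  | distinct =>
    -- For distinct tangents the branches are corrected in different target coordinates, so each
    -- correction is lifted together with `0` on the other branch.
    obtain ⟨η, hη, e₁, e₂⟩ := hc k₁ _ hk₁ hz hkd₁ hzd
    obtain ⟨ξ, hξ, f₁, f₂⟩ := hc _ k₂ hz hk₂ hzd hkd₂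
    obtain ⟨hσ, hσ'⟩ := isGermAut_unipotent (β := 0) (hsq hξ) (hsq hη) .distinct
    refine ⟨fun t => t, fun t => t, _, isGermAut_id, isGermAut_id, hσ, hσ', ?_, ?_⟩
    · filter_upwards [e₁, f₁, ek₁] with t e1 f1 e2
      simp only [puiseux, Function.comp_apply] at e1 f1 ⊢
      rw [e1, f1, e2]; ring_nf
    · filter_upwards [e₂, f₂, ek₂] with t e1 f1 e2
      simp only [puiseux, Function.comp_apply] at e1 f1 ⊢
      rw [e1, f1, e2]; ring_nf

/-! ### Orders along a branch -/

theorem X_pow_dvd_taylor_of_isLittleO {F : ℂ → ℂ} (hF : AnalyticAt ℂ F 0) {m : ℕ}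
    (h : F =o[𝓝 0] fun t : ℂ => t ^ m) : PowerSeries.X ^ (m + 1) ∣ taylor F := by
  by_contra hn
  have h1 : ord F < (m + 1 : ℕ) := by
    rw [← not_le, le_ord_iff hF]; exact hn
  obtain ⟨k, hk⟩ := ENat.ne_top_iff_exists.mp (ne_top_of_lt h1)
  rw [← hk] at h1
  have hkm : k ≤ m := Nat.lt_succ_iff.mp (by exact_mod_cast h1)
  obtain ⟨G, hG, hG0, hFG⟩ := (hF.analyticOrderAt_eq_natCast).mp hk.symm
  have h2 : F =o[𝓝 0] fun t : ℂ => t ^ k := by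
    refine h.trans_isBigO ?_
    have h4 : ContinuousAt (fun t : ℂ => t ^ (m - k)) 0 := by fun_prop
    have := (Asymptotics.isBigO_refl (fun t : ℂ => t ^ k) (𝓝 0)).mul (h4.isBigO_one ℂ)
    refine (this.congr_left fun t => ?_).congr_right fun t => mul_one _
    rw [← pow_add, Nat.add_sub_cancel' hkm]
  have h3 := (h2.tendsto_div_nhds_zero).mono_left (nhdsWithin_le_nhds (s := {0}ᶜ))
  have h4 : Tendsto G (𝓝[≠] 0) (𝓝 (G 0)) := hG.continuousAt.tendsto.mono_left nhdsWithin_le_nhds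
  refine hG0 (tendsto_nhds_unique (h4.congr' ?_) h3)
  filter_upwards [hFG.filter_mono nhdsWithin_le_nhds, self_mem_nhdsWithin] with t e1 e2
  have : t ≠ 0 := e2
  rw [e1, sub_zero, smul_eq_mul, mul_div_cancel_left₀ _ (pow_ne_zero _ this)]

theorem isBigO_of_X_pow_dvd {F : ℂ → ℂ} (hF : AnalyticAt ℂ F 0) {m : ℕ}
    (h : PowerSeries.X ^ m ∣ taylor F) : F =O[𝓝 0] fun t : ℂ => t ^ m := by
  obtain ⟨g, hg, e, -⟩ := exists_eq_pow_mul hF h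
  have := (Asymptotics.isBigO_refl (fun t : ℂ => t ^ m) (𝓝 0)).mul (hg.continuousAt.isBigO_one ℂ)
  refine (this.congr' ?_ ?_)
  · exact e.symm
  · exact Eventually.of_forall fun t => mul_one _

/-- The vanishing differential gives `η = o(‖p‖)`, hence `o(t ^ m)` along the branch. One order
beyond `m` is all that preserving Puiseux form requires. -/
theorem InMaxSq.X_pow_dvd {η : ℂ × ℂ → ℂ} (hη : InMaxSq η) {f : ℂ → ℂ × ℂ} (hf : AnalyticAt ℂ f 0)
    (h0 : f 0 = 0) {m : ℕ} (h₁ : PowerSeries.X ^ m ∣ taylor fun t => (f t).1)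
    (h₂ : PowerSeries.X ^ m ∣ taylor fun t => (f t).2) :
    PowerSeries.X ^ (m + 1) ∣ taylor fun t => η (f t) := by
  refine X_pow_dvd_taylor_of_isLittleO (AnalyticAt.fun_comp (by rw [h0]; exact hη.1) hf) ?_
  have hd := hη.1.differentiableAt.hasFDerivAt
  rw [hη.2.2, hasFDerivAt_iff_isLittleO_nhds_zero] at hd
  simp only [zero_add, hη.2.1, sub_zero, zero_apply] at hd
  have ht : Tendsto f (𝓝 0) (𝓝 0) := by simpa [h0] using hf.continuousAt.tendsto
  refine (hd.comp_tendsto ht).trans_isBigO ?_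
  exact (isBigO_of_X_pow_dvd (analyticAt_fst_comp hf) h₁).prod_left
    (isBigO_of_X_pow_dvd (analyticAt_snd_comp hf) h₂)

theorem taylor_pullback {A B : ℂ × ℂ → ℂ} (hA : AnalyticAt ℂ A 0) (hB : AnalyticAt ℂ B 0)
    {f : ℂ → ℂ × ℂ} (hf : AnalyticAt ℂ f 0) (h0 : f 0 = 0) :
    taylor (pullback A B f) =
      taylor (fun t => A (f t)) * PowerSeries.derivative ℂ (taylor fun t => (f t).1) +
      taylor (fun t => B (f t)) * PowerSeries.derivative ℂ (taylor fun t => (f t).2) := by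
  have h1 : AnalyticAt ℂ (fun t => A (f t)) 0 := AnalyticAt.fun_comp (by rwa [h0]) hf
  have h2 : AnalyticAt ℂ (fun t => B (f t)) 0 := AnalyticAt.fun_comp (by rwa [h0]) hf
  have h3 := (analyticAt_fst_comp hf).deriv
  have h4 := (analyticAt_snd_comp hf).deriv
  rw [← taylor_deriv, ← taylor_deriv, ← taylor_mul h1 h3, ← taylor_mul h2 h4,
    ← taylor_add (h1.fun_mul h3) (h2.fun_mul h4)]
  rfl

theorem derivative_taylor_comp {g : ℂ × ℂ → ℂ} (hg : AnalyticAt ℂ g 0) {f : ℂ → ℂ × ℂ}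
    (hf : AnalyticAt ℂ f 0) (h0 : f 0 = 0) :
    PowerSeries.derivative ℂ (taylor fun t => g (f t)) =
      taylor (fun t => pdx g (f t)) * PowerSeries.derivative ℂ (taylor fun t => (f t).1) +
      taylor (fun t => pdy g (f t)) * PowerSeries.derivative ℂ (taylor fun t => (f t).2) := by
  rw [← taylor_pullback (analyticAt_pdx hg) (analyticAt_pdy hg) hf h0, ← taylor_deriv]
  have ht : Tendsto f (𝓝 0) (𝓝 0) := by simpa [h0] using hf.continuousAt.tendsto
  refine taylor_congr ?_
  filter_upwards [ht.eventually hg.eventually_analyticAt, hf.eventually_analyticAt] with t e1 e2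
  exact deriv_comp_pair e1 e2

theorem X_dvd_taylor_comp {g : ℂ × ℂ → ℂ} {f : ℂ → ℂ × ℂ} (hg : g 0 = 0) (h0 : f 0 = 0) :
    PowerSeries.X ∣ taylor fun t => g (f t) := by
  rw [PowerSeries.X_dvd_iff, constantCoeff_taylor, h0, hg]

/-! ### Truncated flows of vector fields in the plane -/

/-- The vector field `η₁ ∂/∂x + η₂ ∂/∂y` as an operator. -/
def planeField (η₁ η₂ : ℂ × ℂ → ℂ) (g : ℂ × ℂ → ℂ) (p : ℂ × ℂ) : ℂ :=
  η₁ p * pdx g p + η₂ p * pdy g p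

theorem analyticAt_planeField {η₁ η₂ g : ℂ × ℂ → ℂ} (h₁ : AnalyticAt ℂ η₁ 0)
    (h₂ : AnalyticAt ℂ η₂ 0) (hg : AnalyticAt ℂ g 0) : AnalyticAt ℂ (planeField η₁ η₂ g) 0 :=
  (h₁.mul (analyticAt_pdx hg)).add (h₂.mul (analyticAt_pdy hg))

theorem analyticAt_planeField_iterate {η₁ η₂ g : ℂ × ℂ → ℂ} (h₁ : AnalyticAt ℂ η₁ 0)
    (h₂ : AnalyticAt ℂ η₂ 0) (hg : AnalyticAt ℂ g 0) (n : ℕ) :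
    AnalyticAt ℂ ((planeField η₁ η₂)^[n] g) 0 := by
  induction n with
  | zero => exact hg
  | succ n ih => rw [Function.iterate_succ_apply']; exact analyticAt_planeField h₁ h₂ ih

theorem InMaxSq.pdx_zero {η : ℂ × ℂ → ℂ} (h : InMaxSq η) : pdx η 0 = 0 := by
  rw [pdx, h.2.2]; rfl

theorem InMaxSq.pdy_zero {η : ℂ × ℂ → ℂ} (h : InMaxSq η) : pdy η 0 = 0 := by
  rw [pdy, h.2.2]; rfl

theorem inMaxSq_planeField {η₁ η₂ g : ℂ × ℂ → ℂ} (h₁ : AnalyticAt ℂ η₁ 0) (h₁0 : η₁ 0 = 0)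
    (h₂ : AnalyticAt ℂ η₂ 0) (h₂0 : η₂ 0 = 0) (hg : InMaxSq g) : InMaxSq (planeField η₁ η₂ g) :=
  (inMaxSq_mul h₁ (analyticAt_pdx hg.1) h₁0 hg.pdx_zero).add
    (inMaxSq_mul h₂ (analyticAt_pdy hg.1) h₂0 hg.pdy_zero)

theorem inMaxSq_planeField_iterate {η₁ η₂ g : ℂ × ℂ → ℂ} (h₁ : AnalyticAt ℂ η₁ 0) (h₁0 : η₁ 0 = 0)
    (h₂ : AnalyticAt ℂ η₂ 0) (h₂0 : η₂ 0 = 0) (hg : InMaxSq (planeField η₁ η₂ g)) (n : ℕ) :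
    InMaxSq ((planeField η₁ η₂)^[n + 1] g) := by
  induction n with
  | zero => exact hg
  | succ n ih =>
    rw [Function.iterate_succ_apply']
    exact inMaxSq_planeField h₁ h₁0 h₂ h₂0 ih

theorem pdx_fst (p : ℂ × ℂ) : pdx (fun q => q.1) p = 1 := by simp [pdx, fderiv_fst]
theorem pdy_fst (p : ℂ × ℂ) : pdy (fun q => q.1) p = 0 := by simp [pdy, fderiv_fst]
theorem pdx_snd (p : ℂ × ℂ) : pdx (fun q => q.2) p = 0 := by simp [pdx, fderiv_snd]
theorem pdy_snd (p : ℂ × ℂ) : pdy (fun q => q.2) p = 1 := by simp [pdy, fderiv_snd]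

theorem planeField_fst (η₁ η₂ : ℂ × ℂ → ℂ) : planeField η₁ η₂ (fun q => q.1) = η₁ := by
  funext p; simp [planeField, pdx_fst, pdy_fst]

theorem planeField_snd (η₁ η₂ : ℂ × ℂ → ℂ) : planeField η₁ η₂ (fun q => q.2) = η₂ := by
  funext p; simp [planeField, pdx_snd, pdy_snd]

/-- The truncated exponential of the vector field, applied to `g`. -/
def planeFlow (η₁ η₂ : ℂ × ℂ → ℂ) (K : ℕ) (g : ℂ × ℂ → ℂ) (p : ℂ × ℂ) : ℂ :=
  ∑ n ∈ Finset.range (K + 1), expCoeff n * ((planeField η₁ η₂)^[n] g) p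

theorem analyticAt_planeFlow {η₁ η₂ g : ℂ × ℂ → ℂ} (h₁ : AnalyticAt ℂ η₁ 0)
    (h₂ : AnalyticAt ℂ η₂ 0) (hg : AnalyticAt ℂ g 0) (K : ℕ) :
    AnalyticAt ℂ (planeFlow η₁ η₂ K g) 0 :=
  Finset.analyticAt_fun_sum _ fun n _ =>
    analyticAt_const.mul (analyticAt_planeField_iterate h₁ h₂ hg n)

section Flow

variable {η₁ η₂ : ℂ × ℂ → ℂ} (h₁ : AnalyticAt ℂ η₁ 0) (h₂ : AnalyticAt ℂ η₂ 0)
  {f : ℂ → ℂ × ℂ} (hf : AnalyticAt ℂ f 0) (h0 : f 0 = 0) {e bx bY : PowerSeries ℂ}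
  (hbx : bx = taylor (fun t => η₁ (f t)) + e * PowerSeries.derivative ℂ (taylor fun t => (f t).1))
  (hby : bY = taylor (fun t => η₂ (f t)) + e * PowerSeries.derivative ℂ (taylor fun t => (f t).2))

include h₁ h₂ hf h0 hbx hby

/-- Along `f` the field is the tangential field `-e f'` plus the displacement `(bx, bY)`; by the
chain rule the tangential part acts on `g ∘ f` as `-e d/dt`. -/
theorem taylor_planeField {g : ℂ × ℂ → ℂ} (hg : AnalyticAt ℂ g 0) :
    taylor (fun t => planeField η₁ η₂ g (f t)) = vecField (-e) (taylor fun t => g (f t)) +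
      (taylor (fun t => pdx g (f t)) * bx + taylor (fun t => pdy g (f t)) * bY) := by
  have an : ∀ {k : ℂ × ℂ → ℂ}, AnalyticAt ℂ k 0 → AnalyticAt ℂ (fun t => k (f t)) 0 := fun hk =>
    AnalyticAt.fun_comp (by rwa [h0]) hf
  have e1 : taylor (fun t => planeField η₁ η₂ g (f t)) =
      taylor (fun t => η₁ (f t)) * taylor (fun t => pdx g (f t)) +
      taylor (fun t => η₂ (f t)) * taylor (fun t => pdy g (f t)) := by
    rw [← taylor_mul (an h₁) (an (analyticAt_pdx hg)), ← taylor_mul (an h₂) (an (analyticAt_pdy hg)),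
      ← taylor_add ((an h₁).fun_mul (an (analyticAt_pdx hg)))
        ((an h₂).fun_mul (an (analyticAt_pdy hg)))]
    rfl
  rw [e1, vecField_apply, derivative_taylor_comp hg hf h0, hbx, hby]
  ring

/-- The restrictions of the iterates satisfy the perturbed recursion for `vecField (-e)`, whose
truncated exponential is the substitution of `a`. For the finer estimate, the iterates from the
first on lie in `(x, y)²`, so their partial derivatives vanish at `0` and the later perturbations
gain an order. -/
theorem taylor_planeFlow {g : ℂ × ℂ → ℂ} (hg : AnalyticAt ℂ g 0) (he : PowerSeries.X ^ 2 ∣ e)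
    {p K : ℕ} (hpx : PowerSeries.X ^ p ∣ bx) (hpy : PowerSeries.X ^ p ∣ bY) (hK : p < K)
    {a : PowerSeries ℂ} (ha : ∀ f : PowerSeries ℂ, PowerSeries.X ^ (K + 1) ∣
      opSum expCoeff K (vecField (-e)) f - f.subst a) :
    PowerSeries.X ^ p ∣
      taylor (fun t => planeFlow η₁ η₂ K g (f t)) - (taylor fun t => g (f t)).subst a ∧
    (InMaxSq (planeField η₁ η₂ g) → η₁ 0 = 0 → η₂ 0 = 0 → PowerSeries.X ^ (p + 1) ∣
      taylor (fun t => planeFlow η₁ η₂ K g (f t)) - ((taylor fun t => g (f t)).subst a +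
        (taylor (fun t => pdx g (f t)) * bx + taylor (fun t => pdy g (f t)) * bY))) := by
  set G : ℕ → ℂ × ℂ → ℂ := fun n => (planeField η₁ η₂)^[n] g with hG
  have hGa : ∀ n, AnalyticAt ℂ (G n) 0 := analyticAt_planeField_iterate h₁ h₂ hg
  set u : ℕ → PowerSeries ℂ := fun n => taylor fun t => G n (f t) with hu
  set r : ℕ → PowerSeries ℂ := fun n =>
    taylor (fun t => pdx (G n) (f t)) * bx + taylor (fun t => pdy (G n) (f t)) * bY with hr
  have hR : Raises (vecField (-e)) := raises_vecField (by rwa [dvd_neg])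
  have hrec : ∀ n, u (n + 1) = vecField (-e) (u n) + r n := by
    intro n
    simp only [hu, hr, hG]
    rw [Function.iterate_succ_apply']
    exact taylor_planeField h₁ h₂ hf h0 hbx hby (hGa n)
  have hrp : ∀ n, PowerSeries.X ^ p ∣ r n := fun n =>
    dvd_add (hpx.mul_left _) (hpy.mul_left _)
  have hsum : taylor (fun t => planeFlow η₁ η₂ K g (f t)) =
      ∑ n ∈ Finset.range (K + 1), expCoeff n • u n := by
    simp only [planeFlow]
    rw [taylor_sum (f := fun n t => expCoeff n * G n (f t))]
    · exact Finset.sum_congr rfl fun n _ => taylor_const_mul _ _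
    · intro n _
      exact analyticAt_const.mul (AnalyticAt.fun_comp (by rw [h0]; exact hGa n) hf)
  have hsub := ha (u 0)
  rw [hsum]
  refine ⟨?_, fun hm h10 h20 => ?_⟩
  · have h3 := perturbed_sum hR hrec hrp expCoeff K
    have h4 := dvd_add h3 ((pow_dvd_pow _ (by omega)).trans hsub)
    convert h4 using 1
    simp only [hu, hG, Function.iterate_zero, id_eq]
    ring
  · have h3 := perturbed_sum_succ hR hrec (hrp 0) (fun n => ?_) (c := expCoeff) (by simp [expCoeff])
      (K := K) (by omega)
    · have h4 := dvd_add h3 ((pow_dvd_pow _ (by omega)).trans hsub)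
      convert h4 using 1
      simp only [hu, hr, hG, Function.iterate_zero, id_eq]
      ring
    · have hin := inMaxSq_planeField_iterate h₁ h10 h₂ h20 hm n
      refine dvd_add ?_ ?_
      · rw [pow_succ']
        exact mul_dvd_mul (X_dvd_taylor_comp hin.pdx_zero h0) hpx
      · rw [pow_succ']
        exact mul_dvd_mul (X_dvd_taylor_comp hin.pdy_zero h0) hpy

end Flow

/-! ### Flows dual to differential forms and their effect on a branch -/

theorem derivative_X_pow (m : ℕ) :
    PowerSeries.derivative ℂ (PowerSeries.X ^ (m + 1)) =
      (PowerSeries.C ((m : ℂ) + 1)) * PowerSeries.X ^ m := by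
  rw [PowerSeries.derivative_pow, PowerSeries.derivative_X]
  simp

theorem derivative_X_pow_ne_zero {m : ℕ} (hm : 0 < m) :
    PowerSeries.derivative ℂ (PowerSeries.X ^ m) ≠ 0 := by
  obtain ⟨k, rfl⟩ : ∃ k, m = k + 1 := ⟨m - 1, by omega⟩
  rw [derivative_X_pow]
  refine mul_ne_zero ?_ (pow_ne_zero _ PowerSeries.X_ne_zero)
  rw [Ne, map_eq_zero_iff _ (PowerSeries.C_injective)]
  exact_mod_cast k.succ_ne_zero

/-- Solving `w + e d(X ^ m) = 0`. -/
theorem exists_solution {m : ℕ} (hm : 0 < m) {w : PowerSeries ℂ}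
    (hw : PowerSeries.X ^ (m + 1) ∣ w) :
    ∃ e : PowerSeries ℂ, PowerSeries.X ^ 2 ∣ e ∧
      w + e * PowerSeries.derivative ℂ (PowerSeries.X ^ m) = 0 := by
  obtain ⟨k, rfl⟩ : ∃ k, m = k + 1 := ⟨m - 1, by omega⟩
  obtain ⟨v, rfl⟩ := hw
  have hk : (k : ℂ) + 1 ≠ 0 := by exact_mod_cast k.succ_ne_zero
  refine ⟨PowerSeries.X ^ 2 * (-(PowerSeries.C ((k : ℂ) + 1)⁻¹) * v), Dvd.intro _ rfl, ?_⟩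
  have hC : PowerSeries.C ((k : ℂ) + 1)⁻¹ * PowerSeries.C ((k : ℂ) + 1) = 1 := by
    rw [← map_mul, inv_mul_cancel₀ hk, map_one]
  rw [derivative_X_pow]
  linear_combination (-(PowerSeries.X ^ (k + 2) * v)) * hC

theorem InOmega.apply_zero {δ : Tangents} {A B : ℂ × ℂ → ℂ} (h : InOmega δ A B) :
    A 0 = 0 ∧ B 0 = 0 := by
  obtain ⟨hA, β, η, hη, -, rfl⟩ := h
  exact ⟨hA.2.1, by simp [hη.2.1]⟩

theorem InOmega.inMaxSq_right {A B : ℂ × ℂ → ℂ} (h : InOmega .distinct A B) : InMaxSq B := by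
  obtain ⟨-, β, η, hη, hβ, rfl⟩ := h
  obtain rfl := hβ rfl
  simpa using hη

theorem InMaxSq.neg {η : ℂ × ℂ → ℂ} (h : InMaxSq η) : InMaxSq fun p => - η p := by
  simpa using h.const_mul (-1)

/-- The time-one flow attached to a differential form `A dx + B dy`. -/
def formFlow (A B : ℂ × ℂ → ℂ) (K : ℕ) (p : ℂ × ℂ) : ℂ × ℂ :=
  (planeFlow (fun q => -B q) A K (fun q => q.1) p, planeFlow (fun q => -B q) A K (fun q => q.2) p)

theorem inMaxSq_sum {ι : Type*} (s : Finset ι) {η : ι → ℂ × ℂ → ℂ} (h : ∀ i ∈ s, InMaxSq (η i)) :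
    InMaxSq fun p => ∑ i ∈ s, η i p := by
  classical
  induction s using Finset.induction_on with
  | empty => exact ⟨by simpa using analyticAt_const, by simp, by simp⟩
  | insert i s hi ih =>
    simp only [Finset.sum_insert hi]
    exact (h i (by simp)).add (ih fun j hj => h j (by simp [hj]))

/-- The linear part is that of the field: `(x, y) ↦ (x - β y, y)`, which is unipotent and fixes the
`x`-axis. Truncation at `K + 1` ensures that the first order term is present. -/
theorem isGermAut_formFlow {δ : Tangents} {A B : ℂ × ℂ → ℂ} (h : InOmega δ A B) (K : ℕ) :
    IsGermAut (formFlow A B (K + 1)) ∧ PreservesTangent δ (formFlow A B (K + 1)) := by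
  have hA0 := h.apply_zero
  have hAB := h.analyticAt
  have hnB : AnalyticAt ℂ (fun q => -B q) 0 := hAB.2.neg
  have hnB0 : (fun q => -B q) 0 = 0 := by simp [hA0.2]
  obtain ⟨hA, β, η, hη, -, rfl⟩ := h
  set η₁ : ℂ × ℂ → ℂ := fun q => -(β * q.2 + η q) with hη₁
  -- the second coordinate
  have hy : ∀ n, InMaxSq ((planeField η₁ A)^[n + 1] fun q => q.2) :=
    inMaxSq_planeField_iterate hnB hnB0 hAB.1 hA0.1 (by rwa [planeField_snd])
  -- The first iterate of `x` is `-B`, which may contain the linear term `-β y`. That term depends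
  -- on `y` only and is differentiated along `A ∈ (x, y)²`, so from the second iterate on everything
  -- lies in `(x, y)²`.
  have hx : ∀ n, InMaxSq ((planeField η₁ A)^[n + 1 + 1] fun q => q.1) := by
    intro n
    rw [Function.iterate_succ_apply, planeField_fst]
    refine inMaxSq_planeField_iterate hnB hnB0 hAB.1 hA0.1 ?_ n
    refine (inMaxSq_mul hnB (analyticAt_pdx hnB) hnB0 ?_).add (hA.mul (analyticAt_pdy hnB))
    have e : η₁ = fun q => 0 * q.1 + -β * q.2 + -η q := by
      funext q; simp only [hη₁]; ring
    rw [e]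
    exact pdx_of_inMaxSq hη.neg 0 (-β)
  have hy' : InMaxSq fun p => ∑ n ∈ Finset.range (K + 1),
      expCoeff (n + 1) * ((planeField η₁ A)^[n + 1] fun q => q.2) p :=
    inMaxSq_sum _ fun n _ => (hy n).const_mul _
  have hx' : InMaxSq fun p => ∑ n ∈ Finset.range K,
      expCoeff (n + 1 + 1) * ((planeField η₁ A)^[n + 1 + 1] fun q => q.1) p :=
    inMaxSq_sum _ fun n _ => (hx n).const_mul _
  have := isGermAut_unipotent (β := -β) (hη.neg.add hx') hy' δ
  convert this using 3
  all_goals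
    rename_i p
    refine Prod.ext ?_ ?_
    · simp only [formFlow, planeFlow]
      rw [Finset.sum_range_succ', Finset.sum_range_succ']
      simp only [Function.iterate_zero, id_eq, zero_add, Function.iterate_one, planeField_fst]
      simp only [expCoeff, hη₁]
      simp
      ring
    · simp only [formFlow, planeFlow]
      rw [Finset.sum_range_succ']
      simp [expCoeff, hη₁]
      ring

/-- The effect of the flow on a branch `(t ^ m, y)`. -/
theorem formFlow_branchX {δ : Tangents} {A B : ℂ × ℂ → ℂ} (h : InOmega δ A B) {m : ℕ} {y : ℂ → ℂ}
    (hy : PuiseuxCoord m y) {b : PowerSeries ℂ}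
    (hb : taylor (pullback A B fun t => (t ^ m, y t)) =
      PowerSeries.derivative ℂ (PowerSeries.X ^ m) * b)
    {p K : ℕ} (hp : m < p) (hpb : PowerSeries.X ^ p ∣ b) (hK : p < K) :
    ∃ ρ y' : ℂ → ℂ, IsGermAut ρ ∧ AnalyticAt ℂ y' 0 ∧
      (formFlow A B K ∘ (fun t => (t ^ m, y t)) =ᶠ[𝓝 0] (fun t => (t ^ m, y' t)) ∘ ρ) ∧
      PowerSeries.X ^ (p + 1) ∣ taylor y' - (taylor y + b) := by
  have hAB := h.analyticAt
  have hA0 := h.apply_zero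
  have hnB : AnalyticAt ℂ (fun q => -B q) 0 := hAB.2.neg
  set f : ℂ → ℂ × ℂ := fun t => (t ^ m, y t) with hfdef
  have hpow : AnalyticAt ℂ (fun t : ℂ => t ^ m) 0 := by fun_prop
  have hf : AnalyticAt ℂ f 0 := hpow.prod hy.2.1
  have hy0 : y 0 = 0 := by
    rw [← constantCoeff_taylor y, ← PowerSeries.X_dvd_iff]
    exact (Dvd.intro_left _ (pow_succ _ m).symm).trans hy.2.2
  have h0 : f 0 = 0 := by simp [hfdef, hy0, hy.1.ne']
  have hd₁ : PowerSeries.X ^ m ∣ taylor fun t => (f t).1 := by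
    simp only [hfdef, taylor_id_pow]; exact dvd_rfl
  have hd₂ : PowerSeries.X ^ m ∣ taylor fun t => (f t).2 :=
    (pow_dvd_pow _ (Nat.le_succ m)).trans hy.2.2
  have hw : PowerSeries.X ^ (m + 1) ∣ taylor fun t => -B (f t) := by
    obtain ⟨-, β, η, hη, -, rfl⟩ := id h
    have e1 : AnalyticAt ℂ (fun t => η (f t)) 0 := AnalyticAt.fun_comp (by rw [h0]; exact hη.1) hf
    have e2 : AnalyticAt ℂ (fun t => β * (f t).2) 0 :=
      analyticAt_const.mul (analyticAt_snd_comp hf)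
    rw [taylor_neg, dvd_neg, taylor_add e2 e1, taylor_const_mul]
    exact dvd_add (dvd_smul_of_dvd _ hy.2.2) (hη.X_pow_dvd hf h0 hd₁ hd₂)
  -- The tangential part `e` is chosen to cancel the displacement of `t ^ m`; all transversal motion
  -- then appears in `y` and equals `b`.
  obtain ⟨e, he, hsol⟩ := exists_solution hy.1 hw
  have hbx : (0 : PowerSeries ℂ) = taylor (fun t => -B (f t)) +
      e * PowerSeries.derivative ℂ (taylor fun t => (f t).1) := by
    simp only [hfdef, taylor_id_pow]; exact hsol.symm
  have hby : b = taylor (fun t => A (f t)) +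
      e * PowerSeries.derivative ℂ (taylor fun t => (f t).2) := by
    refine mul_left_cancel₀ (derivative_X_pow_ne_zero hy.1) ?_
    rw [← hb, taylor_pullback hAB.1 hAB.2 hf h0]
    rw [taylor_neg] at hsol
    have e3 : (taylor fun t => (f t).1) = PowerSeries.X ^ m := taylor_id_pow m
    rw [e3]
    linear_combination (-(PowerSeries.derivative ℂ (taylor fun t => (f t).2))) * hsol
  obtain ⟨a, ha2, ha⟩ := opSum_exp_eq_subst (e := -e) (by rwa [dvd_neg]) K
  have haX := X_dvd_of_tangent ha2
  have hs := hasSubst_of_dvd haX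
  have ex := (taylor_planeFlow hnB hAB.1 hf h0 hbx hby (g := fun q => q.1) analyticAt_fst he
    (dvd_zero _) hpb hK ha).1
  have ey := (taylor_planeFlow hnB hAB.1 hf h0 hbx hby (g := fun q => q.2) analyticAt_snd he
    (dvd_zero _) hpb hK ha).2 (by rw [planeField_snd]; exact h.1) (by simp [hA0.2]) hA0.1
  have e3 : (taylor fun t => (f t).1) = PowerSeries.X ^ m := taylor_id_pow m
  rw [e3, PowerSeries.subst_pow hs, PowerSeries.subst_X hs] at ex
  simp only [pdx_snd, pdy_snd, mul_zero, zero_add, taylor_const, map_one, one_mul] at ey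
  have hflow : ∀ {g : ℂ × ℂ → ℂ}, AnalyticAt ℂ g 0 →
      AnalyticAt ℂ (fun t => planeFlow (fun q => -B q) A K g (f t)) 0 := fun hg =>
    AnalyticAt.fun_comp (by rw [h0]; exact analyticAt_planeFlow hnB hAB.1 hg K) hf
  obtain ⟨ρ, y', hρ, hy', h1, h2, h3⟩ := exists_reparam_of_congr (hflow analyticAt_fst)
    (hflow analyticAt_snd) hy.1 hp hy.2.2 ha2 hpb ex ey
  refine ⟨ρ, y', hρ, hy', ?_, h3⟩
  filter_upwards [h1, h2] with t e1 e2
  exact Prod.ext e1 e2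

/-- The effect of the flow on a branch `(y, t ^ m)`. -/
theorem formFlow_branchY {A B : ℂ × ℂ → ℂ} (h : InOmega .distinct A B) {m : ℕ} {y : ℂ → ℂ}
    (hy : PuiseuxCoord m y) {b : PowerSeries ℂ}
    (hb : taylor (pullback A B fun t => (y t, t ^ m)) =
      -(PowerSeries.derivative ℂ (PowerSeries.X ^ m) * b))
    {p K : ℕ} (hp : m < p) (hpb : PowerSeries.X ^ p ∣ b) (hK : p < K) :
    ∃ ρ y' : ℂ → ℂ, IsGermAut ρ ∧ AnalyticAt ℂ y' 0 ∧
      (formFlow A B K ∘ (fun t => (y t, t ^ m)) =ᶠ[𝓝 0] (fun t => (y' t, t ^ m)) ∘ ρ) ∧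
      PowerSeries.X ^ (p + 1) ∣ taylor y' - (taylor y + b) := by
  have hAB := h.analyticAt
  have hA0 := h.apply_zero
  have hnB : AnalyticAt ℂ (fun q => -B q) 0 := hAB.2.neg
  set f : ℂ → ℂ × ℂ := fun t => (y t, t ^ m) with hfdef
  have hpow : AnalyticAt ℂ (fun t : ℂ => t ^ m) 0 := by fun_prop
  have hf : AnalyticAt ℂ f 0 := hy.2.1.prod hpow
  have hy0 : y 0 = 0 := by
    rw [← constantCoeff_taylor y, ← PowerSeries.X_dvd_iff]
    exact (Dvd.intro_left _ (pow_succ _ m).symm).trans hy.2.2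
  have h0 : f 0 = 0 := by simp [hfdef, hy0, hy.1.ne']
  have hd₁ : PowerSeries.X ^ m ∣ taylor fun t => (f t).1 :=
    (pow_dvd_pow _ (Nat.le_succ m)).trans hy.2.2
  have e3 : (taylor fun t => (f t).2) = PowerSeries.X ^ m := taylor_id_pow m
  have hd₂ : PowerSeries.X ^ m ∣ taylor fun t => (f t).2 := by rw [e3]
  have hw : PowerSeries.X ^ (m + 1) ∣ taylor fun t => A (f t) := h.1.X_pow_dvd hf h0 hd₁ hd₂
  -- The monomial coordinate is now the second one, so `e` cancels the component `A` and the
  -- displacement falls on the first coordinate.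
  obtain ⟨e, he, hsol⟩ := exists_solution hy.1 hw
  have hby : (0 : PowerSeries ℂ) = taylor (fun t => A (f t)) +
      e * PowerSeries.derivative ℂ (taylor fun t => (f t).2) := by
    rw [e3]; exact hsol.symm
  have hbx : b = taylor (fun t => -B (f t)) +
      e * PowerSeries.derivative ℂ (taylor fun t => (f t).1) := by
    refine mul_left_cancel₀ (derivative_X_pow_ne_zero hy.1) ?_
    rw [← neg_inj, ← hb, taylor_pullback hAB.1 hAB.2 hf h0, taylor_neg, e3]
    linear_combination (PowerSeries.derivative ℂ (taylor fun t => (f t).1)) * hsol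
  obtain ⟨a, ha2, ha⟩ := opSum_exp_eq_subst (e := -e) (by rwa [dvd_neg]) K
  have haX := X_dvd_of_tangent ha2
  have hs := hasSubst_of_dvd haX
  have ey := (taylor_planeFlow hnB hAB.1 hf h0 hbx hby (g := fun q => q.2) analyticAt_snd he
    hpb (dvd_zero _) hK ha).1
  have ex := (taylor_planeFlow hnB hAB.1 hf h0 hbx hby (g := fun q => q.1) analyticAt_fst he
    hpb (dvd_zero _) hK ha).2 (by rw [planeField_fst]; exact h.inMaxSq_right.neg)
    (by simp [hA0.2]) hA0.1
  rw [e3, PowerSeries.subst_pow hs, PowerSeries.subst_X hs] at ey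
  simp only [pdx_fst, pdy_fst, mul_zero, add_zero, taylor_const, map_one, one_mul] at ex
  have hflow : ∀ {g : ℂ × ℂ → ℂ}, AnalyticAt ℂ g 0 →
      AnalyticAt ℂ (fun t => planeFlow (fun q => -B q) A K g (f t)) 0 := fun hg =>
    AnalyticAt.fun_comp (by rw [h0]; exact analyticAt_planeFlow hnB hAB.1 hg K) hf
  obtain ⟨ρ, y', hρ, hy', h1, h2, h3⟩ := exists_reparam_of_congr (hflow analyticAt_snd)
    (hflow analyticAt_fst) hy.1 hp hy.2.2 ha2 hpb ey ex
  refine ⟨ρ, y', hρ, hy', ?_, h3⟩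
  filter_upwards [h1, h2] with t e1 e2
  exact Prod.ext e2 e1

/-! ### Displacement of the coefficients along a differential form -/

theorem PuiseuxCoord.apply_zero {m : ℕ} {y : ℂ → ℂ} (h : PuiseuxCoord m y) : y 0 = 0 := by
  rw [← constantCoeff_taylor y, ← PowerSeries.X_dvd_iff]
  exact (Dvd.intro_left _ (pow_succ _ m).symm).trans h.2.2

/-- The pull-back is a determinant of the tangent vector and the field `(-B, A)`, so the tangential
part drops out. What remains is `d(t ^ m)/dt` times the displacement `A + e y'`. Its order exceeds
`m`, so the move stays in Puiseux form. -/
theorem exists_displacementX {δ : Tangents} {A B : ℂ × ℂ → ℂ} (h : InOmega δ A B) {m : ℕ} {y : ℂ → ℂ}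
    (hy : PuiseuxCoord m y) :
    ∃ b : PowerSeries ℂ, PowerSeries.X ^ (m + 1) ∣ b ∧
      taylor (pullback A B fun t => (t ^ m, y t)) =
        PowerSeries.derivative ℂ (PowerSeries.X ^ m) * b := by
  have hAB := h.analyticAt
  set f : ℂ → ℂ × ℂ := fun t => (t ^ m, y t) with hfdef
  have hpow : AnalyticAt ℂ (fun t : ℂ => t ^ m) 0 := by fun_prop
  have hf : AnalyticAt ℂ f 0 := hpow.prod hy.2.1
  have h0 : f 0 = 0 := by simp [hfdef, hy.apply_zero, hy.1.ne']
  have e3 : (taylor fun t => (f t).1) = PowerSeries.X ^ m := taylor_id_pow m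
  have hd₁ : PowerSeries.X ^ m ∣ taylor fun t => (f t).1 := by rw [e3]
  have hd₂ : PowerSeries.X ^ m ∣ taylor fun t => (f t).2 :=
    (pow_dvd_pow _ (Nat.le_succ m)).trans hy.2.2
  have hw : PowerSeries.X ^ (m + 1) ∣ taylor fun t => -B (f t) := by
    obtain ⟨-, β, η, hη, -, rfl⟩ := id h
    have e1 : AnalyticAt ℂ (fun t => η (f t)) 0 := AnalyticAt.fun_comp (by rw [h0]; exact hη.1) hf
    have e2 : AnalyticAt ℂ (fun t => β * (f t).2) 0 :=
      analyticAt_const.mul (analyticAt_snd_comp hf)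
    rw [taylor_neg, dvd_neg, taylor_add e2 e1, taylor_const_mul]
    exact dvd_add (dvd_smul_of_dvd _ hy.2.2) (hη.X_pow_dvd hf h0 hd₁ hd₂)
  obtain ⟨e, he, hsol⟩ := exists_solution hy.1 hw
  refine ⟨taylor (fun t => A (f t)) + e * PowerSeries.derivative ℂ (taylor fun t => (f t).2),
    dvd_add (h.1.X_pow_dvd hf h0 hd₁ hd₂) ?_, ?_⟩
  · have := mul_dvd_mul he (X_pow_dvd_derivative hy.2.2)
    rw [← pow_add] at this
    exact (pow_dvd_pow _ (by omega)).trans this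
  · rw [taylor_pullback hAB.1 hAB.2 hf h0, e3]
    rw [taylor_neg] at hsol
    linear_combination (-(PowerSeries.derivative ℂ (taylor fun t => (f t).2))) * hsol

/-- Here the displaced coordinate is `x`, along which the field has component `-B`; this is the
origin of the sign. -/
theorem exists_displacementY {A B : ℂ × ℂ → ℂ} (h : InOmega .distinct A B) {m : ℕ} {y : ℂ → ℂ}
    (hy : PuiseuxCoord m y) :
    ∃ b : PowerSeries ℂ, PowerSeries.X ^ (m + 1) ∣ b ∧
      taylor (pullback A B fun t => (y t, t ^ m)) =
        -(PowerSeries.derivative ℂ (PowerSeries.X ^ m) * b) := by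
  have hAB := h.analyticAt
  set f : ℂ → ℂ × ℂ := fun t => (y t, t ^ m) with hfdef
  have hpow : AnalyticAt ℂ (fun t : ℂ => t ^ m) 0 := by fun_prop
  have hf : AnalyticAt ℂ f 0 := hy.2.1.prod hpow
  have h0 : f 0 = 0 := by simp [hfdef, hy.apply_zero, hy.1.ne']
  have e3 : (taylor fun t => (f t).2) = PowerSeries.X ^ m := taylor_id_pow m
  have hd₁ : PowerSeries.X ^ m ∣ taylor fun t => (f t).1 :=
    (pow_dvd_pow _ (Nat.le_succ m)).trans hy.2.2
  have hd₂ : PowerSeries.X ^ m ∣ taylor fun t => (f t).2 := by rw [e3]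
  obtain ⟨e, he, hsol⟩ := exists_solution hy.1 (h.1.X_pow_dvd hf h0 hd₁ hd₂)
  refine ⟨taylor (fun t => -B (f t)) + e * PowerSeries.derivative ℂ (taylor fun t => (f t).1),
    dvd_add (h.inMaxSq_right.neg.X_pow_dvd hf h0 hd₁ hd₂) ?_, ?_⟩
  · have := mul_dvd_mul he (X_pow_dvd_derivative hy.2.2)
    rw [← pow_add] at this
    exact (pow_dvd_pow _ (by omega)).trans this
  · rw [taylor_pullback hAB.1 hAB.2 hf h0, taylor_neg, e3]
    linear_combination (PowerSeries.derivative ℂ (taylor fun t => (f t).1)) * hsol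

/-- The sign relating pull-backs to displacements on the second branch. -/
def branchSign : Tangents → ℂ
  | .distinct => -1
  | .same => 1

theorem branchSign_ne_zero (δ : Tangents) : branchSign δ ≠ 0 := by
  cases δ <;> simp [branchSign]

theorem exists_displacement {δ : Tangents} {A B : ℂ × ℂ → ℂ} (h : InOmega δ A B) {m₁ m₂ : ℕ}
    {y₁ y₂ : ℂ → ℂ} (h₁ : PuiseuxCoord m₁ y₁) (h₂ : PuiseuxCoord m₂ y₂) :
    ∃ b₁ b₂ : PowerSeries ℂ, PowerSeries.X ^ (m₁ + 1) ∣ b₁ ∧ PowerSeries.X ^ (m₂ + 1) ∣ b₂ ∧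
      taylor (pullback A B (puiseux δ m₁ m₂ y₁ y₂).1) =
        PowerSeries.derivative ℂ (PowerSeries.X ^ m₁) * b₁ ∧
      taylor (pullback A B (puiseux δ m₁ m₂ y₁ y₂).2) =
        branchSign δ • (PowerSeries.derivative ℂ (PowerSeries.X ^ m₂) * b₂) := by
  cases δ with
  | distinct =>
    obtain ⟨b₁, hb₁, e₁⟩ := exists_displacementX h h₁
    obtain ⟨b₂, hb₂, e₂⟩ := exists_displacementY h h₂
    exact ⟨b₁, b₂, hb₁, hb₂, e₁, by rw [branchSign, neg_one_smul]; exact e₂⟩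
  | same =>
    obtain ⟨b₁, hb₁, e₁⟩ := exists_displacementX h h₁
    obtain ⟨b₂, hb₂, e₂⟩ := exists_displacementX h h₂
    exact ⟨b₁, b₂, hb₁, hb₂, e₁, by rw [branchSign, one_smul]; exact e₂⟩

theorem exists_formFlow_puiseux {δ : Tangents} {A B : ℂ × ℂ → ℂ} (h : InOmega δ A B) {m₁ m₂ : ℕ}
    {y₁ y₂ : ℂ → ℂ} (h₁ : PuiseuxCoord m₁ y₁) (h₂ : PuiseuxCoord m₂ y₂) {b₁ b₂ : PowerSeries ℂ}
    (hb₁ : PowerSeries.X ^ (m₁ + 1) ∣ b₁) (hb₂ : PowerSeries.X ^ (m₂ + 1) ∣ b₂)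
    (e₁ : taylor (pullback A B (puiseux δ m₁ m₂ y₁ y₂).1) =
        PowerSeries.derivative ℂ (PowerSeries.X ^ m₁) * b₁)
    (e₂ : taylor (pullback A B (puiseux δ m₁ m₂ y₁ y₂).2) =
        branchSign δ • (PowerSeries.derivative ℂ (PowerSeries.X ^ m₂) * b₂))
    {j : ℕ} (hj₁ : PowerSeries.X ^ j ∣ b₁) (hj₂ : PowerSeries.X ^ j ∣ b₂) :
    ∃ y₁' y₂' : ℂ → ℂ, PuiseuxCoord m₁ y₁' ∧ PuiseuxCoord m₂ y₂' ∧
      TEquiv δ (puiseux δ m₁ m₂ y₁ y₂) (puiseux δ m₁ m₂ y₁' y₂') ∧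
      PowerSeries.X ^ (j + 1) ∣ taylor y₁' - (taylor y₁ + b₁) ∧
      PowerSeries.X ^ (j + 1) ∣ taylor y₂' - (taylor y₂ + b₂) := by
  -- The branch lemmas require a displacement order larger than `m`. Replacing `j` by `max j (m +
  -- 1)` covers small `j` as well.
  have hmax : ∀ {m : ℕ} {b : PowerSeries ℂ}, PowerSeries.X ^ (m + 1) ∣ b → PowerSeries.X ^ j ∣ b →
      PowerSeries.X ^ max j (m + 1) ∣ b := fun hm hj => by
    rcases max_choice j (_ + 1) with e | e <;> rw [e] <;> assumption
  have hcoord : ∀ {m : ℕ} {y y' : ℂ → ℂ} {b : PowerSeries ℂ}, PuiseuxCoord m y → AnalyticAt ℂ y' 0 →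
      PowerSeries.X ^ (m + 1) ∣ b →
      PowerSeries.X ^ (max j (m + 1) + 1) ∣ taylor y' - (taylor y + b) → PuiseuxCoord m y' := by
    intro m y y' b hy hy' hb hd
    refine ⟨hy.1, hy', ?_⟩
    have := dvd_add ((pow_dvd_pow _ (by omega : m + 1 ≤ _)).trans hd) (dvd_add hy.2.2 hb)
    simpa using this
  set K := max j (m₁ + 1) + max j (m₂ + 1) with hK
  have hσ := isGermAut_formFlow h K
  obtain ⟨ρ₁, y₁', hρ₁, hy₁', c₁, d₁⟩ : ∃ ρ y' : ℂ → ℂ, IsGermAut ρ ∧ AnalyticAt ℂ y' 0 ∧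
      (formFlow A B (K + 1) ∘ (fun t => (t ^ m₁, y₁ t)) =ᶠ[𝓝 0] (fun t => (t ^ m₁, y' t)) ∘ ρ) ∧
      PowerSeries.X ^ (max j (m₁ + 1) + 1) ∣ taylor y' - (taylor y₁ + b₁) :=
    formFlow_branchX h h₁ (by cases δ <;> exact e₁) (by omega) (hmax hb₁ hj₁) (by omega)
  have hp₁ := hcoord h₁ hy₁' hb₁ d₁
  have d₁' := (pow_dvd_pow PowerSeries.X (by omega : j + 1 ≤ _)).trans d₁
  cases δ with
  | distinct =>
    rw [branchSign, neg_one_smul] at e₂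
    obtain ⟨ρ₂, y₂', hρ₂, hy₂', c₂, d₂⟩ := formFlow_branchY h h₂ e₂ (by omega) (hmax hb₂ hj₂)
      (by omega : _ < K + 1)
    exact ⟨y₁', y₂', hp₁, hcoord h₂ hy₂' hb₂ d₂, ⟨ρ₁, ρ₂, _, hρ₁, hρ₂, hσ.1, hσ.2, c₁, c₂⟩, d₁',
      (pow_dvd_pow PowerSeries.X (by omega)).trans d₂⟩
  | same =>
    rw [branchSign, one_smul] at e₂
    obtain ⟨ρ₂, y₂', hρ₂, hy₂', c₂, d₂⟩ := formFlow_branchX h h₂ e₂ (by omega) (hmax hb₂ hj₂)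
      (by omega : _ < K + 1)
    exact ⟨y₁', y₂', hp₁, hcoord h₂ hy₂' hb₂ d₂, ⟨ρ₁, ρ₂, _, hρ₁, hρ₂, hσ.1, hσ.2, c₁, c₂⟩, d₁',
      (pow_dvd_pow PowerSeries.X (by omega)).trans d₂⟩

theorem InOmega.const_mul {δ : Tangents} {A B : ℂ × ℂ → ℂ} (h : InOmega δ A B) (s : ℂ) :
    InOmega δ (fun p => s * A p) fun p => s * B p := by
  obtain ⟨hA, β, η, hη, hβ, rfl⟩ := h
  exact ⟨hA.const_mul s, s * β, fun p => s * η p, hη.const_mul s, fun hd => by rw [hβ hd, mul_zero],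
    by funext p; ring⟩

theorem taylor_pullback_const_mul (A B : ℂ × ℂ → ℂ) (f : ℂ → ℂ × ℂ) (s : ℂ) :
    taylor (pullback (fun p => s * A p) (fun p => s * B p) f) = s • taylor (pullback A B f) := by
  rw [← taylor_const_mul]
  congr 1
  funext t
  simp only [pullback]
  ring

/-- The order of a pull-back in terms of the displacement. -/
theorem ord_pullback_iff {g : ℂ → ℂ} (hg : AnalyticAt ℂ g 0) {m : ℕ} (hm : 0 < m)
    {b : PowerSeries ℂ} {s : ℂ} (hs : s ≠ 0)
    (e : taylor g = s • (PowerSeries.derivative ℂ (PowerSeries.X ^ m) * b)) {v : ℕ} :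
    ord g + 1 = (v : ℕ∞) + (m : ℕ∞) ↔ PowerSeries.X ^ v ∣ b ∧ PowerSeries.coeff v b ≠ 0 := by
  obtain ⟨k, rfl⟩ : ∃ k, m = k + 1 := ⟨m - 1, by omega⟩
  have hc : s * ((k : ℂ) + 1) ≠ 0 := mul_ne_zero hs (by exact_mod_cast k.succ_ne_zero)
  have e' : taylor g = PowerSeries.X ^ k * ((s * ((k : ℂ) + 1)) • b) := by
    rw [e, derivative_X_pow, mul_smul, PowerSeries.smul_eq_C_mul, PowerSeries.smul_eq_C_mul,
      PowerSeries.smul_eq_C_mul]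
    ring
  have hord : ord g + 1 = (v : ℕ∞) + ((k + 1 : ℕ) : ℕ∞) ↔ ord g = ((v + k : ℕ) : ℕ∞) := by
    rw [Nat.cast_succ, ← add_assoc, ← Nat.cast_add]
    exact ⟨fun h => ENat.add_left_injective_of_ne_top (by simp : (1 : ℕ∞) ≠ ⊤) h, fun h => by rw [h]⟩
  rw [hord, ord_eq_iff hg, e', add_comm v k, pow_add,
    mul_dvd_mul_iff_left (pow_ne_zero _ PowerSeries.X_ne_zero), add_comm k v,
    PowerSeries.coeff_X_pow_mul, PowerSeries.coeff_smul, smul_eq_mul, mul_ne_zero_iff]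
  refine and_congr ⟨fun h => ?_, fun h => dvd_smul_of_dvd _ h⟩ (and_iff_right hc)
  have := dvd_smul_of_dvd (s * ((k : ℂ) + 1))⁻¹ h
  rwa [inv_smul_smul₀ hc] at this

/-- The displacement attached to a point of `Λ`. -/
theorem exists_move {δ : Tangents} {m₁ m₂ : ℕ} {y₁ y₂ : ℂ → ℂ} (h₁ : PuiseuxCoord m₁ y₁)
    (h₂ : PuiseuxCoord m₂ y₂) {v : ℕ × ℕ}
    (hv : v ∈ valuesOfDifferentials δ (puiseux δ m₁ m₂ y₁ y₂)) :
    ∃ b₁ b₂ : PowerSeries ℂ, PowerSeries.X ^ v.1 ∣ b₁ ∧ PowerSeries.coeff v.1 b₁ ≠ 0 ∧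
      PowerSeries.X ^ v.2 ∣ b₂ ∧ PowerSeries.coeff v.2 b₂ ≠ 0 ∧
      ∀ (s : ℂ) (j : ℕ), j ≤ v.1 → j ≤ v.2 → ∃ y₁' y₂' : ℂ → ℂ,
        PuiseuxCoord m₁ y₁' ∧ PuiseuxCoord m₂ y₂' ∧
        TEquiv δ (puiseux δ m₁ m₂ y₁ y₂) (puiseux δ m₁ m₂ y₁' y₂') ∧
        PowerSeries.X ^ (j + 1) ∣ taylor y₁' - (taylor y₁ + s • b₁) ∧
        PowerSeries.X ^ (j + 1) ∣ taylor y₂' - (taylor y₂ + s • b₂) := by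
  obtain ⟨A, B, hAB, o₁, o₂⟩ := hv
  obtain ⟨b₁, b₂, hb₁, hb₂, e₁, e₂⟩ := exists_displacement hAB h₁ h₂
  rw [mult_puiseux₁ δ h₁] at o₁
  rw [mult_puiseux₂ δ h₂] at o₂
  have hA := hAB.analyticAt
  have hf := analyticAt_puiseux δ h₁ h₂
  have z₁ : (puiseux δ m₁ m₂ y₁ y₂).1 0 = 0 := by
    cases δ <;> simp [puiseux, h₁.apply_zero, h₁.1.ne']
  have z₂ : (puiseux δ m₁ m₂ y₁ y₂).2 0 = 0 := by
    cases δ <;> simp [puiseux, h₂.apply_zero, h₂.1.ne']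
  obtain ⟨q₁, q₁'⟩ := (ord_pullback_iff (analyticAt_pullback hA.1 hA.2 hf.1 z₁) h₁.1 one_ne_zero
    (by rwa [one_smul])).mp o₁
  obtain ⟨q₂, q₂'⟩ := (ord_pullback_iff (analyticAt_pullback hA.1 hA.2 hf.2 z₂) h₂.1
    (branchSign_ne_zero δ) e₂).mp o₂
  refine ⟨b₁, b₂, q₁, q₁', q₂, q₂', fun s j hj₁ hj₂ => ?_⟩
  refine exists_formFlow_puiseux (hAB.const_mul s) h₁ h₂ (dvd_smul_of_dvd _ hb₁)
    (dvd_smul_of_dvd _ hb₂) ?_ ?_ (dvd_smul_of_dvd _ ((pow_dvd_pow _ hj₁).trans q₁))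
    (dvd_smul_of_dvd _ ((pow_dvd_pow _ hj₂).trans q₂))
  · rw [taylor_pullback_const_mul, e₁, mul_smul_comm]
  · rw [taylor_pullback_const_mul, e₂, mul_smul_comm, smul_comm]

/-! ### Elimination of coefficients -/

theorem coeff_eq_of_X_pow_dvd_sub {f g : PowerSeries ℂ} {n j : ℕ} (h : PowerSeries.X ^ n ∣ f - g)
    (hj : j < n) : PowerSeries.coeff j f = PowerSeries.coeff j g := by
  have := PowerSeries.X_pow_dvd_iff.mp h j hj
  rwa [map_sub, sub_eq_zero] at this

theorem X_pow_dvd_sub_trans {f g h : PowerSeries ℂ} {n : ℕ} (h₁ : PowerSeries.X ^ n ∣ g - f)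
    (h₂ : PowerSeries.X ^ n ∣ h - g) : PowerSeries.X ^ n ∣ h - f := by
  simpa using dvd_add h₂ h₁

section Elimination

variable {δ : Tangents} {Γ Λ : Set (ℕ × ℕ)} {m₁ m₂ : ℕ} {y₁ y₂ : ℂ → ℂ}

/-- `z₁, z₂` give an equivalent bigerm of the same `Σ` agreeing with `y₁, y₂` below order `n`. -/
def Deforms (δ : Tangents) (m₁ m₂ : ℕ) (y₁ y₂ : ℂ → ℂ) (n : ℕ) (z₁ z₂ : ℂ → ℂ) : Prop :=
  PuiseuxCoord m₁ z₁ ∧ PuiseuxCoord m₂ z₂ ∧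
    TEquiv δ (puiseux δ m₁ m₂ y₁ y₂) (puiseux δ m₁ m₂ z₁ z₂) ∧
    PowerSeries.X ^ n ∣ taylor z₁ - taylor y₁ ∧ PowerSeries.X ^ n ∣ taylor z₂ - taylor y₂

theorem Deforms.refl (h₁ : PuiseuxCoord m₁ y₁) (h₂ : PuiseuxCoord m₂ y₂) (n : ℕ) :
    Deforms δ m₁ m₂ y₁ y₂ n y₁ y₂ :=
  ⟨h₁, h₂, tequiv_of_eventuallyEq .rfl .rfl, by simp, by simp⟩

theorem Deforms.trans {n n' : ℕ} {z₁ z₂ w₁ w₂ : ℂ → ℂ} (h : Deforms δ m₁ m₂ y₁ y₂ n z₁ z₂)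
    (h' : Deforms δ m₁ m₂ z₁ z₂ n' w₁ w₂) (hn : n ≤ n') : Deforms δ m₁ m₂ y₁ y₂ n w₁ w₂ :=
  ⟨h'.1, h'.2.1, h.2.2.1.trans h'.2.2.1,
    X_pow_dvd_sub_trans h.2.2.2.1 ((pow_dvd_pow _ hn).trans h'.2.2.2.1),
    X_pow_dvd_sub_trans h.2.2.2.2 ((pow_dvd_pow _ hn).trans h'.2.2.2.2)⟩

theorem Deforms.mem {n : ℕ} {z₁ z₂ : ℂ → ℂ} (h : Deforms δ m₁ m₂ y₁ y₂ n z₁ z₂)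
    (h₁ : PuiseuxCoord m₁ y₁) (h₂ : PuiseuxCoord m₂ y₂)
    (hm : puiseux δ m₁ m₂ y₁ y₂ ∈ SigmaSet δ Γ Λ) : puiseux δ m₁ m₂ z₁ z₂ ∈ SigmaSet δ Γ Λ :=
  h.2.2.1.mem_sigmaSet_puiseux hm h₁ h₂ h.1 h.2.1

/-- The parameter of the move enters the coefficient of degree `j` affinely, with nonzero slope on a
branch whose coordinate of `v` is `j`, so one value kills that coefficient. If the other coordinate
exceeds `j`, the slope on the other branch is zero. -/
theorem exists_deforms_of_mem (h₁ : PuiseuxCoord m₁ y₁) (h₂ : PuiseuxCoord m₂ y₂)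
    (hm : puiseux δ m₁ m₂ y₁ y₂ ∈ SigmaSet δ Γ Λ) {v : ℕ × ℕ} (hv : v ∈ Λ) {j : ℕ} (hj₁ : j ≤ v.1)
    (hj₂ : j ≤ v.2) :
    (v.1 = j → ∃ z₁ z₂, Deforms δ m₁ m₂ y₁ y₂ j z₁ z₂ ∧ PowerSeries.coeff j (taylor z₁) = 0 ∧
      (j < v.2 → PowerSeries.coeff j (taylor z₂) = PowerSeries.coeff j (taylor y₂))) ∧
    (v.2 = j → ∃ z₁ z₂, Deforms δ m₁ m₂ y₁ y₂ j z₁ z₂ ∧ PowerSeries.coeff j (taylor z₂) = 0 ∧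
      (j < v.1 → PowerSeries.coeff j (taylor z₁) = PowerSeries.coeff j (taylor y₁))) := by
  rw [← hm.2.2.2] at hv
  obtain ⟨b₁, b₂, p₁, q₁, p₂, q₂, H⟩ := exists_move h₁ h₂ hv
  have key : ∀ s : ℂ, ∃ z₁ z₂, Deforms δ m₁ m₂ y₁ y₂ j z₁ z₂ ∧
      PowerSeries.coeff j (taylor z₁) =
        PowerSeries.coeff j (taylor y₁) + s * PowerSeries.coeff j b₁ ∧
      PowerSeries.coeff j (taylor z₂) =
        PowerSeries.coeff j (taylor y₂) + s * PowerSeries.coeff j b₂ := by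
    intro s
    obtain ⟨z₁, z₂, c₁, c₂, ht, d₁, d₂⟩ := H s j hj₁ hj₂
    have low : ∀ {y z : ℂ → ℂ} {b : PowerSeries ℂ} {k : ℕ}, j ≤ k → PowerSeries.X ^ k ∣ b →
        PowerSeries.X ^ (j + 1) ∣ taylor z - (taylor y + s • b) →
        PowerSeries.X ^ j ∣ taylor z - taylor y := by
      intro y z b k hk hb hd
      have := dvd_add ((pow_dvd_pow _ (Nat.le_succ j)).trans hd)
        (dvd_smul_of_dvd s ((pow_dvd_pow _ hk).trans hb))
      convert this using 1
      ring
    refine ⟨z₁, z₂, ⟨c₁, c₂, ht, low hj₁ p₁ d₁, low hj₂ p₂ d₂⟩, ?_, ?_⟩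
    · rw [coeff_eq_of_X_pow_dvd_sub d₁ (Nat.lt_succ_self j)]; simp
    · rw [coeff_eq_of_X_pow_dvd_sub d₂ (Nat.lt_succ_self j)]; simp
  refine ⟨fun e => ?_, fun e => ?_⟩
  · rw [e] at q₁
    obtain ⟨z₁, z₂, hd, e₁, e₂⟩ :=
      key (-PowerSeries.coeff j (taylor y₁) / PowerSeries.coeff j b₁)
    refine ⟨z₁, z₂, hd, ?_, fun hlt => ?_⟩
    · rw [e₁, div_mul_cancel₀ _ q₁, add_neg_cancel]
    · rw [e₂, PowerSeries.X_pow_dvd_iff.mp p₂ j hlt, mul_zero, add_zero]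
  · rw [e] at q₂
    obtain ⟨z₁, z₂, hd, e₁, e₂⟩ :=
      key (-PowerSeries.coeff j (taylor y₂) / PowerSeries.coeff j b₂)
    refine ⟨z₁, z₂, hd, ?_, fun hlt => ?_⟩
    · rw [e₂, div_mul_cancel₀ _ q₂, add_neg_cancel]
    · rw [e₁, PowerSeries.X_pow_dvd_iff.mp p₁ j hlt, mul_zero, add_zero]

/-- The conditions on the coefficients of exponent `j` in a normal form. -/
def ReducedAt (Λ : Set (ℕ × ℕ)) (j : ℕ) (f₁ f₂ : PowerSeries ℂ) : Prop :=
  (PowerSeries.coeff j f₁ ≠ 0 → (j, j) ∉ maximalPoints Λ ∧ fibre₁ Λ (j, j) = ∅) ∧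
    (PowerSeries.coeff j f₂ ≠ 0 → fibre₂ Λ (j, j) = ∅)

/-- The second branch is treated first. A point of `F₁(j, j)` then clears the first branch without
disturbing it. A point of `M` does disturb it, harmlessly: at such a point `F₂(j, j)` is empty and
no condition is imposed on the second branch. -/
theorem exists_reducedAt (h₁ : PuiseuxCoord m₁ y₁) (h₂ : PuiseuxCoord m₂ y₂)
    (hm : puiseux δ m₁ m₂ y₁ y₂ ∈ SigmaSet δ Γ Λ) (j : ℕ) :
    ∃ z₁ z₂, Deforms δ m₁ m₂ y₁ y₂ j z₁ z₂ ∧ ReducedAt Λ j (taylor z₁) (taylor z₂) := by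
  obtain ⟨z₁, z₂, hd, hz⟩ : ∃ z₁ z₂, Deforms δ m₁ m₂ y₁ y₂ j z₁ z₂ ∧
      (PowerSeries.coeff j (taylor z₂) ≠ 0 → fibre₂ Λ (j, j) = ∅) := by
    rcases (fibre₂ Λ (j, j)).eq_empty_or_nonempty with he | ⟨v, hv, ev, hlt⟩
    · exact ⟨y₁, y₂, .refl h₁ h₂ j, fun _ => he⟩
    · obtain ⟨z₁, z₂, hd, e, -⟩ := (exists_deforms_of_mem h₁ h₂ hm hv hlt.le ev.ge).2 ev
      exact ⟨z₁, z₂, hd, fun hn => absurd e hn⟩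
  have hm' := hd.mem h₁ h₂ hm
  rcases (fibre₁ Λ (j, j)).eq_empty_or_nonempty with he | ⟨v, hv, ev, hlt⟩
  · by_cases hM : (j, j) ∈ maximalPoints Λ
    · obtain ⟨w₁, w₂, hd', e, -⟩ :=
        (exists_deforms_of_mem hd.1 hd.2.1 hm' hM.1 le_rfl le_rfl).1 rfl
      exact ⟨w₁, w₂, hd.trans hd' le_rfl, fun hn => absurd e hn, fun _ => hM.2.2⟩
    · exact ⟨z₁, z₂, hd, fun _ => ⟨hM, he⟩, hz⟩
  · obtain ⟨w₁, w₂, hd', e, e'⟩ := (exists_deforms_of_mem hd.1 hd.2.1 hm' hv ev.ge hlt.le).1 ev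
    exact ⟨w₁, w₂, hd.trans hd' le_rfl, fun hn => absurd e hn, fun hn => hz (e' hlt ▸ hn)⟩

theorem ReducedAt.congr {f₁ f₂ g₁ g₂ : PowerSeries ℂ} {j n : ℕ} (h : ReducedAt Λ j f₁ f₂)
    (hj : j < n) (d₁ : PowerSeries.X ^ n ∣ g₁ - f₁) (d₂ : PowerSeries.X ^ n ∣ g₂ - f₂) :
    ReducedAt Λ j g₁ g₂ := by
  rw [ReducedAt, coeff_eq_of_X_pow_dvd_sub d₁ hj, coeff_eq_of_X_pow_dvd_sub d₂ hj]
  exact h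

theorem exists_reduced (h₁ : PuiseuxCoord m₁ y₁) (h₂ : PuiseuxCoord m₂ y₂)
    (hm : puiseux δ m₁ m₂ y₁ y₂ ∈ SigmaSet δ Γ Λ) (k n : ℕ) :
    ∃ z₁ z₂, Deforms δ m₁ m₂ y₁ y₂ k z₁ z₂ ∧
      ∀ j, k ≤ j → j < k + n → ReducedAt Λ j (taylor z₁) (taylor z₂) := by
  induction n with
  | zero => exact ⟨y₁, y₂, .refl h₁ h₂ k, fun j h h' => by omega⟩
  | succ n ih =>
    obtain ⟨z₁, z₂, hd, hz⟩ := ih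
    obtain ⟨w₁, w₂, hd', hw⟩ := exists_reducedAt hd.1 hd.2.1 (hd.mem h₁ h₂ hm) (k + n)
    refine ⟨w₁, w₂, hd.trans hd' (by omega), fun j hj hj' => ?_⟩
    rcases Nat.lt_or_ge j (k + n) with hlt | hge
    · exact (hz j hj hlt).congr hlt hd'.2.2.2.1 hd'.2.2.2.2
    · obtain rfl : j = k + n := by omega
      exact hw

/-- Reduction to polynomial normal form, keeping the coefficients of exponents below `k`. -/
theorem exists_reduced_polynomial (h₁ : PuiseuxCoord m₁ y₁) (h₂ : PuiseuxCoord m₂ y₂)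
    (hm : puiseux δ m₁ m₂ y₁ y₂ ∈ SigmaSet δ Γ Λ) (k : ℕ) :
    ∃ P₁ P₂ : ℂ[X], model δ m₁ m₂ P₁ P₂ ∈ SigmaSet δ Γ Λ ∧ Above m₁ P₁ ∧ Above m₂ P₂ ∧
      TEquiv δ (puiseux δ m₁ m₂ y₁ y₂) (model δ m₁ m₂ P₁ P₂) ∧
      (∀ j < k, P₁.coeff j = PowerSeries.coeff j (taylor y₁) ∧
        P₂.coeff j = PowerSeries.coeff j (taylor y₂)) ∧
      ∀ j, k ≤ j → ReducedAt Λ j P₁ P₂ := by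
  obtain ⟨c, hc⟩ := exists_hasConductor h₁ h₂ hm.1
  -- Reduction is carried past the degree `c + 2 (m₁ + m₂)` beyond which terms may be discarded.
  obtain ⟨z₁, z₂, hd, hz⟩ := exists_reduced h₁ h₂ hm k (c + 2 * (m₁ + m₂))
  set N := k + (c + 2 * (m₁ + m₂)) with hN
  -- The exponent `c` was chosen for the original bigerm; it serves the deformed one because
  -- conductor exponents are `𝒜`-invariant.
  have hc' := HasConductor.of_aequiv (hd.2.2.1.symm hm.1).aequiv hc
  have tr : ∀ z : ℂ → ℂ, taylor (fun t => (PowerSeries.trunc N (taylor z)).eval t) =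
      ((PowerSeries.trunc N (taylor z) : ℂ[X]) : PowerSeries ℂ) := fun z => taylor_polynomial _
  have trd : ∀ z : ℂ → ℂ, PowerSeries.X ^ N ∣
      taylor (fun t => (PowerSeries.trunc N (taylor z)).eval t) - taylor z := by
    intro z
    rw [tr, PowerSeries.X_pow_dvd_iff]
    intro j hj
    rw [map_sub, Polynomial.coeff_coe, PowerSeries.coeff_trunc, if_pos hj, sub_self]
  have trm : ∀ {m : ℕ} {z : ℂ → ℂ}, m < N → PuiseuxCoord m z →
      PuiseuxCoord m fun t => (PowerSeries.trunc N (taylor z)).eval t := by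
    intro m z hmN hz
    refine ⟨hz.1, analyticAt_polynomial_eval _ _, ?_⟩
    simpa using dvd_add ((pow_dvd_pow _ hmN).trans (trd z)) hz.2.2
  have p₁ := trm (by have := h₁.1; omega) hd.1
  have p₂ := trm (by have := h₂.1; omega) hd.2.1
  have ht := tequiv_of_high_order hd.1 hd.2.1 p₁.2.1 p₂.2.1 hc'
    ((pow_dvd_pow _ (by omega)).trans (trd z₁)) ((pow_dvd_pow _ (by omega)).trans (trd z₂))
  have hd' : Deforms δ m₁ m₂ y₁ y₂ k _ _ :=
    hd.trans ⟨p₁, p₂, ht, trd z₁, trd z₂⟩ (by omega)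
  have hab : ∀ {m : ℕ} {P : ℂ[X]}, PuiseuxCoord m (fun t => P.eval t) → Above m P := by
    intro m P hP j hj
    by_contra hlt
    have := PowerSeries.X_pow_dvd_iff.mp hP.2.2 j (by omega)
    rw [taylor_polynomial, Polynomial.coeff_coe] at this
    exact Polynomial.mem_support_iff.mp hj this
  refine ⟨PowerSeries.trunc N (taylor z₁), PowerSeries.trunc N (taylor z₂), ?_, hab p₁, hab p₂,
    ?_, fun j hj => ⟨?_, ?_⟩, fun j hj => ?_⟩
  · rw [model_eq_puiseux]
    exact hd'.mem h₁ h₂ hm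
  · rw [model_eq_puiseux]
    exact hd'.2.2.1
  · have := coeff_eq_of_X_pow_dvd_sub hd'.2.2.2.1 hj
    rwa [tr, Polynomial.coeff_coe] at this
  · have := coeff_eq_of_X_pow_dvd_sub hd'.2.2.2.2 hj
    rwa [tr, Polynomial.coeff_coe] at this
  · rcases Nat.lt_or_ge j N with hlt | hge
    · exact (hz j hj hlt).congr hlt (by rw [← tr]; exact trd z₁) (by rw [← tr]; exact trd z₂)
    · have : ∀ z : ℂ → ℂ, PowerSeries.coeff j
          ((PowerSeries.trunc N (taylor z) : ℂ[X]) : PowerSeries ℂ) = 0 := fun z => by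
        rw [Polynomial.coeff_coe, PowerSeries.coeff_trunc, if_neg (by omega)]
      exact ⟨fun h => absurd (this z₁) h, fun h => absurd (this z₂) h⟩

end Elimination

/-! ### Homotheties -/

theorem polynomial_eventuallyEq_iff {P Q : ℂ[X]} :
    ((fun t => P.eval t) =ᶠ[𝓝 0] fun t => Q.eval t) ↔ P = Q := by
  refine ⟨fun h => ?_, fun h => by rw [h]⟩
  have := taylor_congr h
  rw [taylor_polynomial, taylor_polynomial] at this
  exact Polynomial.coe_injective _ this

theorem eval_rescale_iff {a α : ℂ} {P Q : ℂ[X]} :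
    ((fun t => a * P.eval t) =ᶠ[𝓝 0] fun t => Q.eval (α * t)) ↔
      ∀ j, a * P.coeff j = Q.coeff j * α ^ j := by
  have h := polynomial_eventuallyEq_iff (P := C a * P) (Q := Q.comp (C α * X))
  simp only [eval_mul, eval_C, eval_comp, eval_X] at h
  rw [h, Polynomial.ext_iff]
  simp only [coeff_C_mul, comp_C_mul_X_coeff]

theorem pow_rescale_iff {a α : ℂ} {m : ℕ} :
    ((fun t : ℂ => a * t ^ m) =ᶠ[𝓝 0] fun t => (α * t) ^ m) ↔ a = α ^ m := by
  have h := eval_rescale_iff (a := a) (α := α) (P := X ^ m) (Q := X ^ m)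
  simp only [eval_pow, eval_X] at h
  rw [h]
  refine ⟨fun h => by simpa using h m, fun h j => ?_⟩
  rw [coeff_X_pow]
  split_ifs with e
  · rw [e, h]; ring
  · simp

/-- The multiplier of the monomial coordinate of the second branch under `(a x, b y)`. -/
def pureWeight : Tangents → ℂ → ℂ → ℂ
  | .distinct, _, b => b
  | .same, a, _ => a

/-- The multiplier of the polynomial coordinate of the second branch under `(a x, b y)`. -/
def coordWeight : Tangents → ℂ → ℂ → ℂ
  | .distinct, a, _ => a
  | .same, _, b => b

theorem eventuallyEq_prodMk_iff {f₁ f₂ g₁ g₂ : ℂ → ℂ} :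
    ((fun t => (f₁ t, f₂ t)) =ᶠ[𝓝 0] fun t => (g₁ t, g₂ t)) ↔
      f₁ =ᶠ[𝓝 0] g₁ ∧ f₂ =ᶠ[𝓝 0] g₂ := by
  simp only [EventuallyEq, Prod.mk.injEq, eventually_and]

theorem carries_homothety_iff {δ : Tangents} {m₁ m₂ : ℕ} {P₁ P₂ Q₁ Q₂ : ℂ[X]} {α β a b : ℂ} :
    Carries (fun t => α * t) (fun t => β * t) (fun p => (a * p.1, b * p.2))
        (model δ m₁ m₂ P₁ P₂) (model δ m₁ m₂ Q₁ Q₂) ↔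
      (a = α ^ m₁ ∧ ∀ j, b * P₁.coeff j = Q₁.coeff j * α ^ j) ∧
      (pureWeight δ a b = β ^ m₂ ∧ ∀ j, coordWeight δ a b * P₂.coeff j = Q₂.coeff j * β ^ j) := by
  cases δ with
  | distinct =>
    simp only [Carries, model, Function.comp_def, eventuallyEq_prodMk_iff, pow_rescale_iff,
      eval_rescale_iff, pureWeight, coordWeight]
    tauto
  | same =>
    simp only [Carries, model, Function.comp_def, eventuallyEq_prodMk_iff, pow_rescale_iff,
      eval_rescale_iff, pureWeight, coordWeight]

theorem fderiv_homothety (a b : ℂ) (v : ℂ × ℂ) :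
    fderiv ℂ (fun p : ℂ × ℂ => (a * p.1, b * p.2)) 0 v = (a * v.1, b * v.2) := by
  have h : HasFDerivAt (fun p : ℂ × ℂ => (a * p.1, b * p.2))
      ((a • ContinuousLinearMap.fst ℂ ℂ ℂ).prod (b • ContinuousLinearMap.snd ℂ ℂ ℂ)) 0 :=
    (hasFDerivAt_fst.const_mul a).prodMk (hasFDerivAt_snd.const_mul b)
  rw [h.fderiv]
  rfl

theorem isGermAut_homothety {a b : ℂ} (ha : a ≠ 0) (hb : b ≠ 0) :
    IsGermAut fun p : ℂ × ℂ => (a * p.1, b * p.2) := by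
  simpa using isGermAut_linear (a := a) (b := 0) (c := 0) (d := b) (by simp [ha, hb])

theorem isGermAut_mul {α : ℂ} (hα : α ≠ 0) : IsGermAut fun t : ℂ => α * t := by
  rw [isGermAut_iff_deriv]
  refine ⟨by fun_prop, by simp, ?_⟩
  have : HasDerivAt (fun t : ℂ => α * t) (α * 1) 0 := (hasDerivAt_id (0 : ℂ)).const_mul α
  rwa [this.deriv, mul_one]

theorem preservesTangent_homothety (δ : Tangents) (a b : ℂ) :
    PreservesTangent δ fun p : ℂ × ℂ => (a * p.1, b * p.2) := by
  intro h
  exact ⟨b, fun v => by rw [fderiv_homothety]⟩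

/-- `c * P(t / α)`. -/
def rescale (c α : ℂ) (P : ℂ[X]) : ℂ[X] := C c * P.comp (C α⁻¹ * X)

theorem coeff_rescale (c α : ℂ) (P : ℂ[X]) (j : ℕ) :
    (rescale c α P).coeff j = c * P.coeff j / α ^ j := by
  rw [rescale, coeff_C_mul, comp_C_mul_X_coeff, inv_pow, div_eq_mul_inv, mul_assoc]

theorem support_rescale {c α : ℂ} (hc : c ≠ 0) (hα : α ≠ 0) (P : ℂ[X]) :
    (rescale c α P).support = P.support := by
  ext j
  simp [mem_support_iff, coeff_rescale, hc, hα]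

theorem coordWeight_ne_zero {δ : Tangents} {a b : ℂ} (ha : a ≠ 0) (hb : b ≠ 0) :
    coordWeight δ a b ≠ 0 := by cases δ <;> assumption

theorem pureWeight_ne_zero {δ : Tangents} {a b : ℂ} (ha : a ≠ 0) (hb : b ≠ 0) :
    pureWeight δ a b ≠ 0 := by cases δ <;> assumption

theorem tequiv_rescale (δ : Tangents) {m₁ m₂ : ℕ} (P₁ P₂ : ℂ[X]) {α β a b : ℂ} (hα : α ≠ 0)
    (hβ : β ≠ 0) (hb : b ≠ 0) (ha : a = α ^ m₁) (hw : pureWeight δ a b = β ^ m₂) :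
    TEquiv δ (model δ m₁ m₂ P₁ P₂)
      (model δ m₁ m₂ (rescale b α P₁) (rescale (coordWeight δ a b) β P₂)) := by
  have ha0 : a ≠ 0 := by rw [ha]; exact pow_ne_zero _ hα
  refine ⟨_, _, _, isGermAut_mul hα, isGermAut_mul hβ, isGermAut_homothety ha0 hb,
    preservesTangent_homothety δ a b, carries_homothety_iff.mpr ⟨⟨ha, fun j => ?_⟩, hw, fun j => ?_⟩⟩
  · rw [coeff_rescale, div_mul_cancel₀ _ (pow_ne_zero _ hα)]
  · rw [coeff_rescale, div_mul_cancel₀ _ (pow_ne_zero _ hβ)]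

theorem Above.puiseuxCoord {m : ℕ} {P : ℂ[X]} (hm : 0 < m) (h : Above m P) :
    PuiseuxCoord m fun t => P.eval t := by
  refine ⟨hm, analyticAt_polynomial_eval _ _, ?_⟩
  rw [taylor_polynomial, PowerSeries.X_pow_dvd_iff]
  intro j hj
  rw [coeff_coe]
  by_contra hn
  have := h j (mem_support_iff.mpr hn)
  omega

theorem multiplicities_pos {δ : Tangents} {m₁ m₂ : ℕ} {P₁ P₂ : ℂ[X]}
    (h : InPuiseuxForm δ (model δ m₁ m₂ P₁ P₂)) : 0 < m₁ ∧ 0 < m₂ := by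
  have key : ∀ {m n : ℕ}, 0 < m → (∀ᶠ t in 𝓝 (0 : ℂ), t ^ n = t ^ m) → 0 < n := by
    intro m n hm he
    have : ord (fun t => t ^ n) = m := ord_eq_natCast_of_eq_pow he
    rw [ord_id_pow] at this
    have : n = m := by exact_mod_cast this
    omega
  cases δ with
  | distinct =>
    obtain ⟨⟨n₁, p₁, e₁, -⟩, ⟨n₂, p₂, e₂, -⟩⟩ := h
    exact ⟨key p₁ e₁, key p₂ e₂⟩
  | same =>
    obtain ⟨⟨n₁, p₁, e₁, -⟩, ⟨n₂, p₂, e₂, -⟩⟩ := h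
    exact ⟨key p₁ e₁, key p₂ e₂⟩

theorem TEquiv.mem_sigmaSet_model {δ : Tangents} {Γ Λ : Set (ℕ × ℕ)} {m₁ m₂ : ℕ}
    {P₁ P₂ Q₁ Q₂ : ℂ[X]} (hφ : model δ m₁ m₂ P₁ P₂ ∈ SigmaSet δ Γ Λ)
    (h : TEquiv δ (model δ m₁ m₂ P₁ P₂) (model δ m₁ m₂ Q₁ Q₂)) (h₁ : Above m₁ P₁) (h₂ : Above m₂ P₂)
    (h₁' : Above m₁ Q₁) (h₂' : Above m₂ Q₂) : model δ m₁ m₂ Q₁ Q₂ ∈ SigmaSet δ Γ Λ := by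
  obtain ⟨p₁, p₂⟩ := multiplicities_pos hφ.2.1
  rw [model_eq_puiseux] at hφ h ⊢
  rw [model_eq_puiseux] at h
  exact h.mem_sigmaSet_puiseux hφ (h₁.puiseuxCoord p₁) (h₂.puiseuxCoord p₂) (h₁'.puiseuxCoord p₁)
    (h₂'.puiseuxCoord p₂)

/-- Rescaling inside `Σ`. -/
theorem exists_rescale {δ : Tangents} {Γ Λ : Set (ℕ × ℕ)} {m₁ m₂ : ℕ} {P₁ P₂ : ℂ[X]}
    (hφ : model δ m₁ m₂ P₁ P₂ ∈ SigmaSet δ Γ Λ) (h₁ : Above m₁ P₁) (h₂ : Above m₂ P₂)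
    {α β a b : ℂ} (hα : α ≠ 0) (hβ : β ≠ 0) (hb : b ≠ 0) (ha : a = α ^ m₁)
    (hw : pureWeight δ a b = β ^ m₂) :
    ∃ Q₁ Q₂ : ℂ[X], TEquiv δ (model δ m₁ m₂ P₁ P₂) (model δ m₁ m₂ Q₁ Q₂) ∧
      model δ m₁ m₂ Q₁ Q₂ ∈ SigmaSet δ Γ Λ ∧ Q₁.support = P₁.support ∧ Q₂.support = P₂.support ∧
      (∀ j, Q₁.coeff j = b * P₁.coeff j / α ^ j) ∧
      ∀ j, Q₂.coeff j = coordWeight δ a b * P₂.coeff j / β ^ j := by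
  have ha0 : a ≠ 0 := by rw [ha]; exact pow_ne_zero _ hα
  have s₁ := support_rescale hb hα P₁
  have s₂ := support_rescale (coordWeight_ne_zero (δ := δ) ha0 hb) hβ P₂
  have ht := tequiv_rescale δ P₁ P₂ hα hβ hb ha hw
  exact ⟨_, _, ht, ht.mem_sigmaSet_model hφ h₁ h₂ (by rwa [Above, s₁]) (by rwa [Above, s₂]), s₁, s₂,
    coeff_rescale _ _ _, coeff_rescale _ _ _⟩

/-! ### Lowest terms of a polynomial -/

/-- `t ^ j` is the lowest term of `P`. -/
def LowestTerm (P : ℂ[X]) (j : ℕ) : Prop := P.coeff j ≠ 0 ∧ ∀ i < j, P.coeff i = 0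

/-- `t ^ j` and `t ^ k` are the two lowest terms of `P`. -/
def LowestTerms (P : ℂ[X]) (j k : ℕ) : Prop :=
  j < k ∧ P.coeff j ≠ 0 ∧ P.coeff k ≠ 0 ∧ ∀ i < k, i ≠ j → P.coeff i = 0

theorem exists_lowestTerm {P : ℂ[X]} (hP : P ≠ 0) :
    ∃ j, LowestTerm P j ∧ ((∃ k, LowestTerms P j k) ∨ ∀ i ≠ j, P.coeff i = 0) := by
  classical
  have h : ∃ j, P.coeff j ≠ 0 := by
    by_contra! h
    exact hP (by ext j; simpa using h j)
  have hj : LowestTerm P (Nat.find h) :=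
    ⟨Nat.find_spec h, fun i hi => not_not.mp (Nat.find_min h hi)⟩
  refine ⟨_, hj, ?_⟩
  by_cases h' : ∃ k, k ≠ Nat.find h ∧ P.coeff k ≠ 0
  · left
    refine ⟨Nat.find h', ?_, hj.1, (Nat.find_spec h').2, fun i hi hne => ?_⟩
    · by_contra hle
      have h1 := Nat.find_spec h'
      exact h1.2 (hj.2 _ (by have := h1.1; omega))
    · by_contra hc
      exact Nat.find_min h' hi ⟨hne, hc⟩
  · right
    push Not at h'
    exact h'

theorem eq_C_mul_X_pow {P : ℂ[X]} {j : ℕ} (h : ∀ i ≠ j, P.coeff i = 0) :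
    P = C (P.coeff j) * X ^ j := by
  ext i
  rw [coeff_C_mul_X_pow]
  split_ifs with e
  · rw [e]
  · exact h i e

theorem eq_X_pow {P : ℂ[X]} {j : ℕ} (h : ∀ i ≠ j, P.coeff i = 0) (h1 : P.coeff j = 1) :
    P = X ^ j := by
  have := eq_C_mul_X_pow h
  rwa [h1, C_1, one_mul] at this

theorem LowestTerm.exists_eq {P : ℂ[X]} {j : ℕ} (h : ∀ i < j, P.coeff i = 0) :
    ∃ R, Above j R ∧ P = C (P.coeff j) * X ^ j + R := by
  refine ⟨P - C (P.coeff j) * X ^ j, fun i hi => ?_, by ring⟩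
  rw [mem_support_iff, coeff_sub, coeff_C_mul_X_pow] at hi
  by_contra hle
  rcases eq_or_ne i j with rfl | hne
  · simp at hi
  · rw [if_neg hne, h i (by omega), sub_zero] at hi
    exact hi rfl

theorem LowestTerms.exists_eq {P : ℂ[X]} {j k : ℕ} (h : LowestTerms P j k) :
    ∃ R, Above k R ∧ P = C (P.coeff j) * X ^ j + C (P.coeff k) * X ^ k + R := by
  refine ⟨P - C (P.coeff j) * X ^ j - C (P.coeff k) * X ^ k, fun i hi => ?_, by ring⟩
  rw [mem_support_iff, coeff_sub, coeff_sub, coeff_C_mul_X_pow, coeff_C_mul_X_pow] at hi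
  have hjk := h.1
  by_contra hle
  rcases eq_or_ne i j with rfl | hne
  · simp [hjk.ne] at hi
  · rcases eq_or_ne i k with rfl | hne'
    · simp [hjk.ne'] at hi
    · rw [if_neg hne, if_neg hne', h.2.2.2 i (by omega) hne] at hi
      simp at hi

theorem LowestTerms.congr_support {P Q : ℂ[X]} {j k : ℕ} (h : LowestTerms P j k)
    (hs : Q.support = P.support) : LowestTerms Q j k := by
  have e : ∀ i, Q.coeff i = 0 ↔ P.coeff i = 0 := fun i => by
    rw [← notMem_support_iff, ← notMem_support_iff, hs]
  simpa only [LowestTerms, Ne, e] using h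

theorem coeff_eq_zero_of_support {P Q : ℂ[X]} (hs : Q.support = P.support) {i : ℕ}
    (h : P.coeff i = 0) : Q.coeff i = 0 := by
  rwa [← notMem_support_iff, hs, notMem_support_iff]

theorem exists_pow_eq {n : ℕ} (hn : 0 < n) {z : ℂ} (hz : z ≠ 0) : ∃ γ : ℂ, γ ≠ 0 ∧ γ ^ n = z := by
  obtain ⟨γ, hγ⟩ := IsAlgClosed.exists_pow_nat_eq z hn
  refine ⟨γ, fun h => hz ?_, hγ⟩
  rw [← hγ, h, zero_pow hn.ne']

theorem exists_mul_pow_eq {p q : ℕ} (hpq : p ≠ q) {z : ℂ} (hz : z ≠ 0) :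
    ∃ γ : ℂ, γ ≠ 0 ∧ z * γ ^ p = γ ^ q := by
  rcases lt_or_gt_of_ne hpq with h | h
  · obtain ⟨γ, h0, e⟩ := exists_pow_eq (n := q - p) (by omega) hz
    refine ⟨γ, h0, ?_⟩
    rw [← e, ← pow_add, Nat.sub_add_cancel h.le]
  · obtain ⟨γ, h0, e⟩ := exists_pow_eq (n := p - q) (by omega) (inv_ne_zero hz)
    refine ⟨γ, h0, ?_⟩
    have : γ ^ p = γ ^ (p - q) * γ ^ q := by rw [← pow_add, Nat.sub_add_cancel h.le]
    rw [this, e, mul_inv_cancel_left₀ hz]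

/-! ### Consequences of primitivity -/

/-- A primitive root of unity `ζ` of order `gcd(m, j)` satisfies `f (ζ t) = f t`, and injectivity
forces `ζ = 1`. -/
theorem IsBranch.exponents_coprime {m j : ℕ} {c : ℂ} (h : IsBranch fun t => (t ^ m, c * t ^ j)) :
    m.gcd j = 1 := by
  obtain ⟨-, h0, U, hU, hinj⟩ := h
  set d := m.gcd j with hd
  have hd0 : d ≠ 0 := by
    intro h
    have hm0 : m = 0 := Nat.eq_zero_of_gcd_eq_zero_left h
    rw [hm0] at h0
    simp at h0
  have hprim := Complex.isPrimitiveRoot_exp d hd0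
  set ζ := Complex.exp (2 * Real.pi * Complex.I / d) with hζ
  have hcont : Tendsto (fun t : ℂ => ζ * t) (𝓝 0) (𝓝 0) := by
    have : ContinuousAt (fun t : ℂ => ζ * t) 0 := by fun_prop
    simpa [ContinuousAt] using this
  have hev : ∀ᶠ t in 𝓝[≠] (0 : ℂ), t ∈ U ∧ ζ * t ∈ U ∧ t ≠ 0 := by
    filter_upwards [nhdsWithin_le_nhds hU, nhdsWithin_le_nhds (hcont hU), self_mem_nhdsWithin]
      with t a b c using ⟨a, b, c⟩
  obtain ⟨t, ht, hζt, ht0⟩ := hev.exists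
  have hpow : ∀ n, d ∣ n → (ζ * t) ^ n = t ^ n := by
    rintro n ⟨r, rfl⟩
    rw [mul_pow, pow_mul ζ, hprim.pow_eq_one, one_pow, one_mul]
  have := hinj hζt ht (by
    simp only [hpow m (Nat.gcd_dvd_left m j), hpow j (Nat.gcd_dvd_right m j)])
  have h1 : ζ = 1 := by
    rw [← mul_eq_right₀ ht0]; exact this
  exact Nat.dvd_one.mp ((hprim.pow_eq_one_iff_dvd 1).mp (by rw [pow_one, h1]))

theorem IsBranch.eq_one_of_coord_zero {m : ℕ} (h : IsBranch fun t => (t ^ m, (0 : ℂ))) : m = 1 := by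
  have h' : IsBranch fun t => (t ^ m, (0 : ℂ) * t ^ m) := by simpa using h
  simpa using h'.exponents_coprime

theorem IsBranch.swap {f : ℂ → ℂ × ℂ} (h : IsBranch f) : IsBranch fun t => (f t).swap := by
  obtain ⟨h1, h2, U, hU, hi⟩ := h
  refine ⟨(analyticAt_snd_comp h1).prod (analyticAt_fst_comp h1), by simp [h2], U, hU, ?_⟩
  intro s hs t ht e
  exact hi hs ht (Prod.swap_injective e)

section Coprime

variable {δ : Tangents} {m₁ m₂ : ℕ} {P₁ P₂ : ℂ[X]}

theorem IsBigerm.eq_one_left (h : IsBigerm (model δ m₁ m₂ 0 P₂)) : m₁ = 1 := by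
  refine IsBranch.eq_one_of_coord_zero ?_
  cases δ <;> simpa [model] using h.1

theorem IsBigerm.eq_one_right (h : IsBigerm (model δ m₁ m₂ P₁ 0)) : m₂ = 1 := by
  refine IsBranch.eq_one_of_coord_zero ?_
  cases δ with
  | distinct => simpa [model] using h.2.1.swap
  | same => simpa [model] using h.2.1

theorem IsBigerm.left_ne_right {f : ℂ → ℂ × ℂ} : ¬ IsBigerm (f, f) := by
  rintro ⟨-, -, U, hU, h⟩
  have : ∀ᶠ t in 𝓝[≠] (0 : ℂ), t ∈ U ∧ t ≠ 0 := by
    filter_upwards [nhdsWithin_le_nhds hU, self_mem_nhdsWithin] with t a b using ⟨a, b⟩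
  obtain ⟨t, ht, ht0⟩ := this.exists
  exact ht0 (h t ht t ht rfl).1

/-- By primitivity each fraction `jᵢ / mᵢ` is in lowest terms, and a fraction determines its reduced
form. -/
theorem IsBigerm.eq_of_proportional {j₁ j₂ : ℕ} {a b : ℂ}
    (h : IsBigerm (model .same m₁ m₂ (C a * X ^ j₁) (C b * X ^ j₂))) (e : j₁ * m₂ = j₂ * m₁) :
    m₂ = m₁ ∧ j₂ = j₁ := by
  have c₁ : m₁.Coprime j₁ := IsBranch.exponents_coprime (c := a) (by simpa [model] using h.1)
  have c₂ : m₂.Coprime j₂ := IsBranch.exponents_coprime (c := b) (by simpa [model] using h.2.1)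
  have hm : m₂ = m₁ := Nat.dvd_antisymm (c₂.dvd_of_dvd_mul_left (Dvd.intro_left _ e))
    (c₁.dvd_of_dvd_mul_left (Dvd.intro_left _ e.symm))
  have hj : j₂ = j₁ := Nat.dvd_antisymm (c₂.symm.dvd_of_dvd_mul_right (Dvd.intro _ e.symm))
    (c₁.symm.dvd_of_dvd_mul_right (Dvd.intro _ e))
  exact ⟨hm, hj⟩

end Coprime

/-! ### Normalization of coefficients -/

section Normalization

variable {δ : Tangents} {Γ Λ : Set (ℕ × ℕ)} {m₁ m₂ : ℕ} {P₁ P₂ : ℂ[X]}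

/-- `Q₁, Q₂` arise from `P₁, P₂` by a homothety inside `Σ`. -/
def HomotheticIn (δ : Tangents) (Γ Λ : Set (ℕ × ℕ)) (m₁ m₂ : ℕ) (P₁ P₂ Q₁ Q₂ : ℂ[X]) : Prop :=
  TEquiv δ (model δ m₁ m₂ P₁ P₂) (model δ m₁ m₂ Q₁ Q₂) ∧
    model δ m₁ m₂ Q₁ Q₂ ∈ SigmaSet δ Γ Λ ∧ Q₁.support = P₁.support ∧ Q₂.support = P₂.support

/-- Two conditions, two parameters: `α ^ (k - j)` is the ratio of the two lowest coefficients and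
`b` makes the lower one `1`. Then `β` is any root keeping the monomial coordinate of the second
branch monic. -/
theorem exists_twoOnes_left (hφ : model δ m₁ m₂ P₁ P₂ ∈ SigmaSet δ Γ Λ) (h₁ : Above m₁ P₁)
    (h₂ : Above m₂ P₂) {j k : ℕ} (hP : LowestTerms P₁ j k) :
    ∃ Q₁ Q₂ R, HomotheticIn δ Γ Λ m₁ m₂ P₁ P₂ Q₁ Q₂ ∧ Above k R ∧ Q₁ = X ^ j + X ^ k + R := by
  have hm := multiplicities_pos hφ.2.1
  obtain ⟨hjk, hj, hk, -⟩ := id hP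
  obtain ⟨α, hα, eα⟩ := exists_pow_eq (n := k - j) (by omega) (div_ne_zero hk hj)
  have hb : α ^ j / P₁.coeff j ≠ 0 := div_ne_zero (pow_ne_zero _ hα) hj
  obtain ⟨β, hβ, eβ⟩ := exists_pow_eq hm.2 (pureWeight_ne_zero (δ := δ) (pow_ne_zero m₁ hα) hb)
  obtain ⟨Q₁, Q₂, ht, hmem, s₁, s₂, c₁, -⟩ := exists_rescale hφ h₁ h₂ hα hβ hb rfl eβ.symm
  obtain ⟨R, hR, e⟩ := (hP.congr_support s₁).exists_eq
  refine ⟨Q₁, Q₂, R, ⟨ht, hmem, s₁, s₂⟩, hR, ?_⟩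
  have hkα : α ^ k = α ^ j * (P₁.coeff k / P₁.coeff j) := by
    rw [← eα, ← pow_add]; congr 1; omega
  have e1 : Q₁.coeff j = 1 := by rw [c₁]; field_simp
  have e2 : Q₁.coeff k = 1 := by rw [c₁, hkα]; field_simp
  rwa [e1, e2, C_1, one_mul, one_mul] at e

/-- Putting `α = γ ^ m₂` and `β = κ γ ^ j` with `κ ^ m₂` the inverse of the coefficient of `P₁`
normalizes the first branch for every `γ`. The lowest coefficient of the second is then scaled by a
power of `γ` of exponent `m₁ m₂ - j j₂`, nonzero because `m₁ < j` and `m₂ < j₂`. -/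
theorem exists_normalized_of_monomial_distinct (hφ : model .distinct m₁ m₂ P₁ P₂ ∈ SigmaSet .distinct Γ Λ)
    (h₁ : Above m₁ P₁) (h₂ : Above m₂ P₂) {j : ℕ} (hj : P₁.coeff j ≠ 0)
    (hs : ∀ i ≠ j, P₁.coeff i = 0) {j₂ : ℕ} (hP₂ : LowestTerm P₂ j₂) :
    ∃ Q₁ Q₂, HomotheticIn .distinct Γ Λ m₁ m₂ P₁ P₂ Q₁ Q₂ ∧ Q₁ = X ^ j ∧
      ∃ R, Above j₂ R ∧ Q₂ = X ^ j₂ + R := by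
  have hm := multiplicities_pos hφ.2.1
  have hmj := h₁ j (mem_support_iff.mpr hj)
  have hmj₂ := h₂ j₂ (mem_support_iff.mpr hP₂.1)
  obtain ⟨κ, hκ, eκ⟩ := exists_pow_eq hm.2 (inv_ne_zero hj)
  obtain ⟨γ, hγ, eγ⟩ := exists_mul_pow_eq (p := m₂ * m₁) (q := j * j₂)
    (by rw [mul_comm m₂]; exact (Nat.mul_lt_mul'' hmj hmj₂).ne)
    (div_ne_zero hP₂.1 (pow_ne_zero j₂ hκ))
  have hβ : κ * γ ^ j ≠ 0 := mul_ne_zero hκ (pow_ne_zero _ hγ)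
  obtain ⟨Q₁, Q₂, ht, hmem, s₁, s₂, c₁, c₂⟩ := exists_rescale hφ h₁ h₂ (pow_ne_zero m₂ hγ) hβ
    (pow_ne_zero m₂ hβ) rfl rfl
  refine ⟨Q₁, Q₂, ⟨ht, hmem, s₁, s₂⟩,
    eq_X_pow (fun i hi => coeff_eq_zero_of_support s₁ (hs i hi)) ?_, ?_⟩
  · rw [c₁, mul_pow, eκ, ← pow_mul, ← pow_mul, mul_comm m₂ j]
    field_simp
  · obtain ⟨R, hR, e⟩ := LowestTerm.exists_eq (P := Q₂) (j := j₂)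
      fun i hi => coeff_eq_zero_of_support s₂ (hP₂.2 i hi)
    refine ⟨R, hR, ?_⟩
    have : Q₂.coeff j₂ = 1 := by
      rw [c₂, coordWeight, mul_pow, ← pow_mul, ← pow_mul, ← eγ]
      have := hP₂.1
      field_simp
    rwa [this, C_1, one_mul] at e

/-- Homotheties of the family `α = γ ^ m₂`, `β = γ ^ m₁` making the first branch monic. -/
theorem exists_rescale_same (hφ : model .same m₁ m₂ P₁ P₂ ∈ SigmaSet .same Γ Λ)
    (h₁ : Above m₁ P₁) (h₂ : Above m₂ P₂) {j : ℕ} (hj : P₁.coeff j ≠ 0)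
    (hs : ∀ i ≠ j, P₁.coeff i = 0) {γ : ℂ} (hγ : γ ≠ 0) :
    ∃ Q₁ Q₂, HomotheticIn .same Γ Λ m₁ m₂ P₁ P₂ Q₁ Q₂ ∧ Q₁ = X ^ j ∧
      ∀ i, Q₂.coeff i = P₂.coeff i / P₁.coeff j * γ ^ (j * m₂) / γ ^ (i * m₁) := by
  have hα := pow_ne_zero m₂ hγ
  have hb : (γ ^ m₂) ^ j / P₁.coeff j ≠ 0 := div_ne_zero (pow_ne_zero _ hα) hj
  obtain ⟨Q₁, Q₂, ht, hmem, s₁, s₂, c₁, c₂⟩ := exists_rescale hφ h₁ h₂ (β := γ ^ m₁) hα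
    (pow_ne_zero m₁ hγ) hb rfl (by rw [pureWeight, ← pow_mul, ← pow_mul, mul_comm])
  refine ⟨Q₁, Q₂, ⟨ht, hmem, s₁, s₂⟩,
    eq_X_pow (fun i hi => coeff_eq_zero_of_support s₁ (hs i hi)) ?_, fun i => ?_⟩
  · rw [c₁]
    field_simp
  · rw [c₂, coordWeight, ← pow_mul, ← pow_mul, mul_comm m₂, mul_comm m₁]
    field_simp

/-- The residual parameter scales the coefficient of `t ^ i` on the second branch by a power of `γ`
of exponent `j m₂ - i m₁`. The lowest term can be made monic unless this exponent vanishes; in that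
case the next term is used. If there is none, both branches are monomial with equal exponents, and
the modulus `a` differs from `1` because the branches are distinct. -/
theorem exists_normalized_of_monomial_same (hφ : model .same m₁ m₂ P₁ P₂ ∈ SigmaSet .same Γ Λ)
    (h₁ : Above m₁ P₁) (h₂ : Above m₂ P₂) {j : ℕ} (hj : P₁.coeff j ≠ 0)
    (hs : ∀ i ≠ j, P₁.coeff i = 0) (hP₂ : P₂ ≠ 0) :
    ∃ Q₁ Q₂, HomotheticIn .same Γ Λ m₁ m₂ P₁ P₂ Q₁ Q₂ ∧ Normalized .same m₁ m₂ Q₁ Q₂ := by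
  have hm := multiplicities_pos hφ.2.1
  obtain ⟨j₂, hl, hcase⟩ := exists_lowestTerm hP₂
  by_cases hp : j * m₂ = j₂ * m₁
  · rcases hcase with ⟨k, hk⟩ | hmono
    · have hpk : j * m₂ ≠ k * m₁ := by
        rw [hp]; exact (Nat.mul_lt_mul_of_pos_right hk.1 hm.1).ne
      obtain ⟨γ, hγ, eγ⟩ := exists_mul_pow_eq hpk (div_ne_zero hk.2.2.1 hj)
      obtain ⟨Q₁, Q₂, hQ, e, c⟩ := exists_rescale_same hφ h₁ h₂ hj hs hγ
      obtain ⟨R, hR, e'⟩ := (hk.congr_support hQ.2.2.2).exists_eq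
      have ck : Q₂.coeff k = 1 := by
        rw [c, eγ, div_self (pow_ne_zero _ hγ)]
      rw [ck, C_1, one_mul] at e'
      exact ⟨Q₁, Q₂, hQ, .inr (.inl ⟨j, e, .inr (.inl ⟨j₂, k, Q₂.coeff j₂, R, hp,
        (hk.congr_support hQ.2.2.2).2.1, hk.1, hR, e'⟩)⟩)⟩
    · obtain ⟨Q₁, Q₂, hQ, e, c⟩ := exists_rescale_same hφ h₁ h₂ hj hs one_ne_zero
      have e' : Q₂ = C (Q₂.coeff j₂) * X ^ j₂ :=
        eq_C_mul_X_pow fun i hi => coeff_eq_zero_of_support hQ.2.2.2 (hmono i hi)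
      have hbi : IsBigerm (model .same m₁ m₂ (C 1 * X ^ j) (C (Q₂.coeff j₂) * X ^ j₂)) := by
        rw [C_1, one_mul, ← e, ← e']; exact hQ.2.1.1
      obtain ⟨em, ej⟩ := hbi.eq_of_proportional hp
      subst em ej
      refine ⟨Q₁, Q₂, hQ, .inr (.inl ⟨_, e, .inr (.inr (.inl ⟨Q₂.coeff j₂, rfl, ?_, ?_, e'⟩))⟩)⟩
      · rw [← mem_support_iff, hQ.2.2.2]; exact mem_support_iff.mpr hl.1
      · intro h1
        rw [h1] at hbi
        exact IsBigerm.left_ne_right hbi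
  · obtain ⟨γ, hγ, eγ⟩ := exists_mul_pow_eq hp (div_ne_zero hl.1 hj)
    obtain ⟨Q₁, Q₂, hQ, e, c⟩ := exists_rescale_same hφ h₁ h₂ hj hs hγ
    obtain ⟨R, hR, e'⟩ := LowestTerm.exists_eq (P := Q₂) (j := j₂)
      fun i hi => coeff_eq_zero_of_support hQ.2.2.2 (hl.2 i hi)
    have ck : Q₂.coeff j₂ = 1 := by rw [c, eγ, div_self (pow_ne_zero _ hγ)]
    rw [ck, C_1, one_mul] at e'
    exact ⟨Q₁, Q₂, hQ, .inr (.inl ⟨j, e, .inl ⟨j₂, R, hp, hR, e'⟩⟩)⟩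

theorem exists_monic_left (hφ : model δ m₁ m₂ P₁ P₂ ∈ SigmaSet δ Γ Λ)
    (h₁ : Above m₁ P₁) (h₂ : Above m₂ P₂) {j : ℕ} (hj : P₁.coeff j ≠ 0)
    (hs : ∀ i ≠ j, P₁.coeff i = 0) :
    ∃ Q₁ Q₂, HomotheticIn δ Γ Λ m₁ m₂ P₁ P₂ Q₁ Q₂ ∧ Q₁ = X ^ j := by
  have hm := multiplicities_pos hφ.2.1
  obtain ⟨β, hβ, eβ⟩ := exists_pow_eq hm.2
    (pureWeight_ne_zero (δ := δ) (pow_ne_zero m₁ one_ne_zero) (inv_ne_zero hj))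
  obtain ⟨Q₁, Q₂, ht, hmem, s₁, s₂, c₁, -⟩ :=
    exists_rescale hφ h₁ h₂ one_ne_zero hβ (inv_ne_zero hj) rfl eβ.symm
  refine ⟨Q₁, Q₂, ⟨ht, hmem, s₁, s₂⟩,
    eq_X_pow (fun i hi => coeff_eq_zero_of_support s₁ (hs i hi)) ?_⟩
  rw [c₁, inv_mul_cancel₀ hj, one_pow, div_one]

/-- If the first branch is a line, the coefficients of the second branch can be rescaled by
`w / β ^ i` for arbitrary `w` and `β`. -/
theorem exists_rescale_line (hφ : model δ 1 m₂ P₁ P₂ ∈ SigmaSet δ Γ Λ)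
    (h₁ : Above 1 P₁) (h₂ : Above m₂ P₂) {w β : ℂ} (hw : w ≠ 0) (hβ : β ≠ 0) :
    ∃ Q₁ Q₂, HomotheticIn δ Γ Λ 1 m₂ P₁ P₂ Q₁ Q₂ ∧ ∀ i, Q₂.coeff i = w * P₂.coeff i / β ^ i := by
  cases δ with
  | distinct =>
    obtain ⟨Q₁, Q₂, ht, hmem, s₁, s₂, -, c₂⟩ :=
      exists_rescale hφ h₁ h₂ hw hβ (pow_ne_zero m₂ hβ) (pow_one w).symm rfl
    exact ⟨Q₁, Q₂, ⟨ht, hmem, s₁, s₂⟩, c₂⟩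
  | same =>
    obtain ⟨Q₁, Q₂, ht, hmem, s₁, s₂, -, c₂⟩ :=
      exists_rescale hφ h₁ h₂ (pow_ne_zero m₂ hβ) hβ hw (pow_one _).symm rfl
    exact ⟨Q₁, Q₂, ⟨ht, hmem, s₁, s₂⟩, c₂⟩

theorem eq_zero_of_support {P Q : ℂ[X]} (hs : Q.support = P.support) (h : P = 0) : Q = 0 := by
  rw [← support_eq_empty, hs, h, support_zero]

theorem exists_normalized_of_line (hφ : model δ m₁ m₂ 0 P₂ ∈ SigmaSet δ Γ Λ) (h₂ : Above m₂ P₂) :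
    ∃ Q₁ Q₂, HomotheticIn δ Γ Λ m₁ m₂ 0 P₂ Q₁ Q₂ ∧ Normalized δ m₁ m₂ Q₁ Q₂ := by
  obtain rfl := hφ.1.eq_one_left
  have h₁ : Above 1 0 := fun j hj => by simp at hj
  have wrap : ∀ {Q₁ Q₂ : ℂ[X]}, HomotheticIn δ Γ Λ 1 m₂ 0 P₂ Q₁ Q₂ →
      (TwoOnes Q₂ ∨ ∃ j₂ : ℕ, Q₂ = X ^ j₂) → Normalized δ 1 m₂ Q₁ Q₂ := by
    intro Q₁ Q₂ hQ hc
    have := eq_zero_of_support hQ.2.2.1 rfl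
    cases δ with
    | distinct =>
      rcases hc with hc | hc
      · exact .inr (.inr ⟨rfl, this, .inl hc⟩)
      · exact .inr (.inr ⟨rfl, this, .inr (.inl hc)⟩)
    | same => exact .inr (.inr ⟨rfl, this, hc⟩)
  by_cases hP₂ : P₂ = 0
  · subst hP₂
    obtain rfl := hφ.1.eq_one_right
    refine ⟨0, 0, ⟨tequiv_of_eventuallyEq .rfl .rfl, hφ, rfl, rfl⟩, ?_⟩
    cases δ with
    | distinct => exact .inr (.inr ⟨rfl, rfl, .inr (.inr ⟨rfl, rfl⟩)⟩)
    -- Both components would be the same parametrization `(t, 0)`.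
    | same => exact absurd hφ.1 IsBigerm.left_ne_right
  obtain ⟨j, hl, ⟨k, hk⟩ | hmono⟩ := exists_lowestTerm hP₂
  · obtain ⟨β, hβ, eβ⟩ := exists_pow_eq (n := k - j) (by have := hk.1; omega)
      (div_ne_zero hk.2.2.1 hl.1)
    obtain ⟨Q₁, Q₂, hQ, c⟩ :=
      exists_rescale_line hφ h₁ h₂ (div_ne_zero (pow_ne_zero j hβ) hl.1) hβ
    obtain ⟨R, hR, e⟩ := (hk.congr_support hQ.2.2.2).exists_eq
    have hj := hl.1
    have hk' := hk.2.2.1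
    have hkβ : β ^ k = β ^ j * (P₂.coeff k / P₂.coeff j) := by
      rw [← eβ, ← pow_add]; congr 1; have := hk.1; omega
    have e1 : Q₂.coeff j = 1 := by rw [c]; field_simp
    have e2 : Q₂.coeff k = 1 := by rw [c, hkβ]; field_simp
    rw [e1, e2, C_1, one_mul, one_mul] at e
    exact ⟨Q₁, Q₂, hQ, wrap hQ (.inl ⟨j, k, R, hk.1, hR, e⟩)⟩
  · obtain ⟨Q₁, Q₂, hQ, c⟩ := exists_rescale_line hφ h₁ h₂ (inv_ne_zero hl.1) one_ne_zero
    refine ⟨Q₁, Q₂, hQ, wrap hQ (.inr ⟨j,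
      eq_X_pow (fun i hi => coeff_eq_zero_of_support hQ.2.2.2 (hmono i hi)) ?_⟩)⟩
    rw [c, inv_mul_cancel₀ hl.1, one_pow, div_one]

theorem exists_normalized (hφ : model δ m₁ m₂ P₁ P₂ ∈ SigmaSet δ Γ Λ)
    (h₁ : Above m₁ P₁) (h₂ : Above m₂ P₂) :
    ∃ Q₁ Q₂, HomotheticIn δ Γ Λ m₁ m₂ P₁ P₂ Q₁ Q₂ ∧ Normalized δ m₁ m₂ Q₁ Q₂ := by
  by_cases hP₁ : P₁ = 0
  · subst hP₁
    exact exists_normalized_of_line hφ h₂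
  obtain ⟨j, hl, ⟨k, hk⟩ | hmono⟩ := exists_lowestTerm hP₁
  · obtain ⟨Q₁, Q₂, R, hQ, hR, e⟩ := exists_twoOnes_left hφ h₁ h₂ hk
    refine ⟨Q₁, Q₂, hQ, ?_⟩
    cases δ <;> exact .inl ⟨j, k, R, hk.1, hR, e⟩
  by_cases hP₂ : P₂ = 0
  · subst hP₂
    obtain rfl := hφ.1.eq_one_right
    obtain ⟨Q₁, Q₂, hQ, e⟩ := exists_monic_left hφ h₁ h₂ hl.1 hmono
    have e0 := eq_zero_of_support hQ.2.2.2 rfl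
    refine ⟨Q₁, Q₂, hQ, ?_⟩
    cases δ with
    | distinct => exact .inr (.inl ⟨j, e, .inr ⟨rfl, e0⟩⟩)
    | same => exact .inr (.inl ⟨j, e, .inr (.inr (.inr ⟨rfl, e0⟩))⟩)
  cases δ with
  | distinct =>
    obtain ⟨j₂, hl₂, -⟩ := exists_lowestTerm hP₂
    obtain ⟨Q₁, Q₂, hQ, e, R, hR, e'⟩ :=
      exists_normalized_of_monomial_distinct hφ h₁ h₂ hl.1 hmono hl₂
    exact ⟨Q₁, Q₂, hQ, .inr (.inl ⟨j, e, .inl ⟨j₂, R, hR, e'⟩⟩)⟩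
  | same => exact exists_normalized_of_monomial_same hφ h₁ h₂ hl.1 hmono hP₂

end Normalization

/-- Reduction and normalization for a fixed numbering of the branches. -/
theorem exists_tail_normalized {δ : Tangents} {Γ Λ : Set (ℕ × ℕ)} {φ : Bigerm}
    (hφ : φ ∈ SigmaSet δ Γ Λ) :
    ∃ (m₁ m₂ : ℕ) (P₁ P₂ : ℂ[X]),
      AEquiv φ (model δ m₁ m₂ P₁ P₂) ∧ model δ m₁ m₂ P₁ P₂ ∈ SigmaSet δ Γ Λ ∧
      Tail₁ Λ m₁ P₁ ∧ Tail₂ Λ m₂ P₂ ∧ Normalized δ m₁ m₂ P₁ P₂ := by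
  obtain ⟨m₁, m₂, y₁, y₂, h₁, h₂, hm, ht⟩ := exists_puiseux_of_mem hφ
  obtain ⟨P₁, P₂, hP, a₁, a₂, ht', -, hred⟩ := exists_reduced_polynomial h₁ h₂ hm 0
  -- Homotheties do not change supports, so normalization keeps the conditions just obtained on the
  -- exponents.
  obtain ⟨Q₁, Q₂, ⟨ht'', hQ, s₁, s₂⟩, hn⟩ := exists_normalized hP a₁ a₂
  refine ⟨m₁, m₂, Q₁, Q₂, ((ht.trans ht').trans ht'').aequiv, hQ, fun j hj => ?_, fun j hj => ?_, hn⟩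
  · rw [s₁] at hj
    exact ⟨a₁ j hj, (hred j (Nat.zero_le j)).1
      (by rw [Polynomial.coeff_coe]; exact mem_support_iff.mp hj)⟩
  · rw [s₂] at hj
    exact ⟨a₂ j hj, (hred j (Nat.zero_le j)).2
      (by rw [Polynomial.coeff_coe]; exact mem_support_iff.mp hj)⟩

/-! ### Exchanging the branches -/

theorem IsBigerm.swap {φ : Bigerm} (h : IsBigerm φ) : IsBigerm φ.swap := by
  obtain ⟨h₁, h₂, U, hU, hd⟩ := h
  exact ⟨h₂, h₁, U, hU, fun s hs t ht e => (hd t ht s hs e.symm).symm⟩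

theorem AEquiv.swap {φ ψ : Bigerm} (h : AEquiv φ ψ) : AEquiv φ.swap ψ.swap := by
  obtain ⟨ρ₁, ρ₂, σ, h₁, h₂, hσ, hc⟩ := h
  exact ⟨ρ₂, ρ₁, σ, h₂, h₁, hσ, hc.2, hc.1⟩

theorem semigroupOfValues_swap (φ : Bigerm) :
    semigroupOfValues φ.swap = Prod.swap '' semigroupOfValues φ := by
  ext v
  rw [Set.image_swap_eq_preimage_swap]
  constructor
  · rintro ⟨η, h, h₁, h₂⟩
    exact ⟨η, h, h₂, h₁⟩
  · rintro ⟨η, h, h₁, h₂⟩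
    exact ⟨η, h, h₂, h₁⟩

theorem valuesOfDifferentials_swap (δ : Tangents) (φ : Bigerm) :
    valuesOfDifferentials δ φ.swap = Prod.swap '' valuesOfDifferentials δ φ := by
  ext v
  rw [Set.image_swap_eq_preimage_swap]
  constructor
  · rintro ⟨A, B, h, h₁, h₂⟩
    exact ⟨A, B, h, h₂, h₁⟩
  · rintro ⟨A, B, h, h₁, h₂⟩
    exact ⟨A, B, h, h₂, h₁⟩

/-- For distinct tangents, exchanging the branches must be followed by exchanging `x` and `y` to
recover Puiseux form. -/
theorem tequiv_swap_model (δ : Tangents) (m₁ m₂ : ℕ) (P₁ P₂ : ℂ[X]) :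
    TEquiv δ (model δ m₁ m₂ P₁ P₂).swap (model δ m₂ m₁ P₂ P₁) := by
  cases δ with
  | distinct =>
    have hσ : IsGermAut fun p : ℂ × ℂ => (0 * p.1 + 1 * p.2, 1 * p.1 + 0 * p.2) :=
      isGermAut_linear (by norm_num)
    refine ⟨_, _, _, isGermAut_id, isGermAut_id, hσ, (fun h => by cases h), ?_, ?_⟩ <;>
    · refine Eventually.of_forall fun t => ?_
      simp [model]
  | same => exact tequiv_of_eventuallyEq .rfl .rfl

theorem model_swap_mem_sigmaSet {δ : Tangents} {Γ Λ : Set (ℕ × ℕ)} {m₁ m₂ : ℕ} {P₁ P₂ : ℂ[X]}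
    (h : model δ m₁ m₂ P₁ P₂ ∈ SigmaSet δ Γ Λ) (h₁ : Above m₁ P₁) (h₂ : Above m₂ P₂) :
    model δ m₂ m₁ P₂ P₁ ∈ SigmaSet δ (Prod.swap '' Γ) (Prod.swap '' Λ) := by
  obtain ⟨p₁, p₂⟩ := multiplicities_pos h.2.1
  have ht := tequiv_swap_model δ m₁ m₂ P₁ P₂
  have hs := h.1.swap
  have hb := ht.isBigerm hs
  have c₁ := h₁.puiseuxCoord p₁
  have c₂ := h₂.puiseuxCoord p₂
  have e₁ : mult (model δ m₂ m₁ P₂ P₁).1 = mult (model δ m₁ m₂ P₁ P₂).swap.1 := by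
    rw [Prod.fst_swap, model_eq_puiseux, model_eq_puiseux, mult_puiseux₁ δ c₂, mult_puiseux₂ δ c₂]
  have e₂ : mult (model δ m₂ m₁ P₂ P₁).2 = mult (model δ m₁ m₂ P₁ P₂).swap.2 := by
    rw [Prod.snd_swap, model_eq_puiseux, model_eq_puiseux, mult_puiseux₁ δ c₁, mult_puiseux₂ δ c₁]
  refine ⟨hb, ?_, ?_, ?_⟩
  · rw [model_eq_puiseux]
    exact inPuiseuxForm_puiseux δ c₂ c₁
  · rw [← h.2.2.1, ← semigroupOfValues_swap]
    exact Set.Subset.antisymm (semigroupOfValues_subset ht.aequiv)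
      (semigroupOfValues_subset (ht.symm hs).aequiv)
  · rw [← h.2.2.2, ← valuesOfDifferentials_swap]
    exact Set.Subset.antisymm (valuesOfDifferentials_subset hs ht e₁ e₂)
      (valuesOfDifferentials_subset hb (ht.symm hs) e₁.symm e₂.symm)

theorem fibre₁_swap_eq_empty {Λ : Set (ℕ × ℕ)} {j : ℕ} :
    fibre₁ (Prod.swap '' Λ) (j, j) = ∅ ↔ fibre₂ Λ (j, j) = ∅ := by
  simp only [Set.eq_empty_iff_forall_notMem]
  rw [Set.image_swap_eq_preimage_swap]
  exact ⟨fun h b hb => h b.swap ⟨by simpa using hb.1, hb.2⟩,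
    fun h b hb => h b.swap ⟨by simpa using hb.1, hb.2⟩⟩

theorem fibre₂_swap_eq_empty {Λ : Set (ℕ × ℕ)} {j : ℕ} :
    fibre₂ (Prod.swap '' Λ) (j, j) = ∅ ↔ fibre₁ Λ (j, j) = ∅ := by
  rw [← fibre₁_swap_eq_empty, ← Set.image_comp]
  simp

/-! ### The list of normal forms -/

theorem Tail₁.above {Λ : Set (ℕ × ℕ)} {k : ℕ} {P : ℂ[X]} (h : Tail₁ Λ k P) : Above k P :=
  fun j hj => (h j hj).1

theorem Tail₂.above {Λ : Set (ℕ × ℕ)} {k : ℕ} {P : ℂ[X]} (h : Tail₂ Λ k P) : Above k P :=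
  fun j hj => (h j hj).1

section

variable {δ : Tangents} {Γ Λ : Set (ℕ × ℕ)} {m₁ m₂ : ℕ} {P₁ P₂ : ℂ[X]}

/-- Reduction treats the branches asymmetrically, so after an exchange the new first branch may
carry exponents with `(j, j) ∈ M`. A second reduction, started in degree `k + 1`, clears them from
the tail; started lower, it could destroy the two leading terms. -/
theorem exists_formA (hφ : model δ m₁ m₂ P₁ P₂ ∈ SigmaSet δ Γ Λ)
    (h₁ : ∀ j ∈ P₁.support, Adm₁ Λ m₁ j) (h₂ : Tail₂ Λ m₂ P₂) {j k : ℕ}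
    (hP : LowestTerms P₁ j k) :
    ∃ Q₁ Q₂, TEquiv δ (model δ m₁ m₂ P₁ P₂) (model δ m₁ m₂ Q₁ Q₂) ∧
      model δ m₁ m₂ Q₁ Q₂ ∈ SigmaSet δ Γ Λ ∧ FormA Λ m₁ m₂ Q₁ Q₂ := by
  obtain ⟨p₁, p₂⟩ := multiplicities_pos hφ.2.1
  have a₁ : Above m₁ P₁ := fun j hj => (h₁ j hj).1
  have tp : ∀ (P : ℂ[X]) (j : ℕ), PowerSeries.coeff j (taylor fun t => P.eval t) = P.coeff j :=
    fun P j => by rw [taylor_polynomial, coeff_coe]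
  have hφ' := hφ
  rw [model_eq_puiseux] at hφ'
  obtain ⟨R₁, R₂, hR, b₁, b₂, ht, hlow, hred⟩ :=
    exists_reduced_polynomial (a₁.puiseuxCoord p₁) (h₂.above.puiseuxCoord p₂) hφ' (k + 1)
  simp only [tp] at hlow
  rw [← model_eq_puiseux] at ht
  have hlt : LowestTerms R₁ j k := by
    obtain ⟨hjk, hj, hk, hz⟩ := hP
    refine ⟨hjk, ?_, ?_, fun i hi hne => ?_⟩
    · rwa [(hlow j (by omega)).1]
    · rwa [(hlow k (by omega)).1]
    · rw [(hlow i (by omega)).1, hz i hi hne]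
  obtain ⟨Q₁, Q₂, R, ⟨ht', hQ, s₁, s₂⟩, hR', e⟩ := exists_twoOnes_left hR b₁ b₂ hlt
  refine ⟨Q₁, Q₂, ht.trans ht', hQ, j, k, R, hP.1, h₁ j (mem_support_iff.mpr hP.2.1),
    h₁ k (mem_support_iff.mpr hP.2.2.1), fun i hi => ?_, e, fun i hi => ?_⟩
  · have hki := hR' i hi
    have hjk := hP.1
    refine ⟨hki, (hred i hki).1 ?_⟩
    rw [coeff_coe, ← mem_support_iff, ← s₁, mem_support_iff, e, coeff_add, coeff_add, coeff_X_pow,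
      coeff_X_pow, if_neg (by omega), if_neg (by omega), zero_add, zero_add]
    exact mem_support_iff.mp hi
  · rw [s₂] at hi
    refine ⟨b₂ i hi, ?_⟩
    -- Up to degree `k` the second branch is unchanged and its exponents are admissible by
    -- hypothesis; beyond `k` the new reduction applies.
    rcases Nat.lt_or_ge i (k + 1) with hlt | hge
    · rw [mem_support_iff, (hlow i hlt).2, ← mem_support_iff] at hi
      exact (h₂ i hi).2
    · exact (hred i hge).2 (by rw [coeff_coe]; exact mem_support_iff.mp hi)

theorem Listed.of_formA (h : FormA Λ m₁ m₂ P₁ P₂) : Listed δ Λ m₁ m₂ P₁ P₂ := by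
  cases δ <;> exact .inl h

theorem exists_formA_swap (hφ : model δ m₁ m₂ P₁ P₂ ∈ SigmaSet δ Γ Λ) (h₁ : Tail₁ Λ m₁ P₁)
    (h₂ : Tail₂ Λ m₂ P₂) {j k : ℕ} (hP : LowestTerms P₂ j k) :
    ∃ Q₁ Q₂, TEquiv δ (model δ m₁ m₂ P₁ P₂).swap (model δ m₂ m₁ Q₁ Q₂) ∧
      model δ m₂ m₁ Q₁ Q₂ ∈ SigmaSet δ (Prod.swap '' Γ) (Prod.swap '' Λ) ∧
      FormA (Prod.swap '' Λ) m₂ m₁ Q₁ Q₂ := by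
  obtain ⟨Q₁, Q₂, ht, hQ, hA⟩ := exists_formA (model_swap_mem_sigmaSet hφ h₁.above h₂.above)
    (fun j hj => ⟨(h₂ j hj).1, fibre₁_swap_eq_empty.mpr (h₂ j hj).2⟩)
    (fun j hj => ⟨(h₁ j hj).1, fibre₂_swap_eq_empty.mpr (h₁ j hj).2.2⟩) hP
  exact ⟨Q₁, Q₂, (tequiv_swap_model δ m₁ m₂ P₁ P₂).trans ht, hQ, hA⟩

theorem coeff_eq_zero_of_above {k i : ℕ} {R : ℂ[X]} (hR : Above k R) (h : i ≤ k) :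
    R.coeff i = 0 := by
  by_contra hn
  have := hR i (mem_support_iff.mpr hn)
  omega

theorem lowestTerms_of_eq {a : ℂ} {j k : ℕ} {R : ℂ[X]} (ha : a ≠ 0) (hjk : j < k)
    (hR : Above k R) : LowestTerms (C a * X ^ j + X ^ k + R) j k := by
  have hc : ∀ i ≤ k, (C a * X ^ j + X ^ k + R).coeff i =
      (if i = j then a else 0) + if i = k then 1 else 0 := fun i hi => by
    rw [coeff_add, coeff_add, coeff_C_mul_X_pow, coeff_X_pow, coeff_eq_zero_of_above hR hi, add_zero]
  refine ⟨hjk, ?_, ?_, fun i hi hne => ?_⟩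
  · rw [hc j hjk.le]; simp [ha, hjk.ne]
  · rw [hc k le_rfl]; simp [hjk.ne']
  · rw [hc i hi.le]; simp [hne, hi.ne]

theorem TwoOnes.lowestTerms (h : TwoOnes P₁) : ∃ j k, LowestTerms P₁ j k := by
  obtain ⟨j, k, R, hjk, hR, rfl⟩ := h
  refine ⟨j, k, ?_⟩
  simpa using lowestTerms_of_eq one_ne_zero hjk hR

theorem lowestTerms_or_eq {j : ℕ} {R : ℂ[X]} (hR : Above j R) :
    (∃ k, LowestTerms (X ^ j + R) j k) ∨ R = 0 := by
  by_cases h0 : R = 0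
  · exact .inr h0
  obtain ⟨k, hk, -⟩ := exists_lowestTerm h0
  have hjk := hR k (mem_support_iff.mpr hk.1)
  have hc : ∀ i, (X ^ j + R).coeff i = (if i = j then 1 else 0) + R.coeff i := fun i => by
    rw [coeff_add, coeff_X_pow]
  refine .inl ⟨k, hjk, ?_, ?_, fun i hi hne => ?_⟩
  · rw [hc, coeff_eq_zero_of_above hR le_rfl]; simp
  · rw [hc, if_neg hjk.ne', zero_add]; exact hk.1
  · rw [hc, if_neg hne, hk.2 i hi, zero_add]

theorem mem_support_C_mul_X_pow {a : ℂ} (ha : a ≠ 0) (j : ℕ) :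
    j ∈ (C a * X ^ j : ℂ[X]).support := by
  rw [mem_support_iff, coeff_C_mul_X_pow, if_pos rfl]
  exact ha

theorem mem_support_X_pow (j : ℕ) : j ∈ (X ^ j : ℂ[X]).support := by
  rw [mem_support_iff, coeff_X_pow, if_pos rfl]
  exact one_ne_zero

/-- A normalized pair is listed, or becomes listed after exchanging the branches, unless one of
the polynomials has at least two terms. -/
theorem listed_or_lowestTerms (hφ : model δ m₁ m₂ P₁ P₂ ∈ SigmaSet δ Γ Λ) (h₁ : Tail₁ Λ m₁ P₁)
    (h₂ : Tail₂ Λ m₂ P₂) (hn : Normalized δ m₁ m₂ P₁ P₂) :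
    (∃ j k, LowestTerms P₁ j k) ∨ (∃ j k, LowestTerms P₂ j k) ∨ Listed δ Λ m₁ m₂ P₁ P₂ ∨
      Listed δ (Prod.swap '' Λ) m₂ m₁ P₂ P₁ := by
  have adm₁ : ∀ j, P₁ = X ^ j → Adm₁ Λ m₁ j := fun j e =>
    have := h₁ j (by rw [e]; exact mem_support_X_pow j)
    ⟨this.1, this.2.2⟩
  have adm₂ : ∀ (j : ℕ) (a : ℂ), a ≠ 0 → P₂ = C a * X ^ j → Adm₂ Λ m₂ j := fun j a ha e =>
    h₂ j (by rw [e]; exact mem_support_C_mul_X_pow ha j)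
  have adm₂' : ∀ j : ℕ, P₂ = X ^ j → Adm₂ Λ m₂ j := fun j e => adm₂ j 1 one_ne_zero (by simpa using e)
  cases δ with
  | distinct =>
    rcases hn with hn | ⟨j, e, ⟨j₂, R, hR, e'⟩ | ⟨hm, e'⟩⟩ | ⟨hm, e, h | ⟨j₂, e'⟩ | ⟨hm', e'⟩⟩
    · exact .inl hn.lowestTerms
    · rcases lowestTerms_or_eq hR with ⟨k, hk⟩ | rfl
      · exact .inr (.inl ⟨j₂, k, by rwa [e']⟩)
      · rw [add_zero] at e'
        exact .inr (.inr (.inl (.inr (.inl ⟨j, j₂, adm₁ j e, adm₂' j₂ e', e, e'⟩))))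
    · exact .inr (.inr (.inl (.inr (.inr (.inl ⟨j, adm₁ j e, e, hm, e'⟩)))))
    · exact .inr (.inl h.lowestTerms)
    · have := adm₂' j₂ e'
      exact .inr (.inr (.inr (.inr (.inr (.inl ⟨j₂, ⟨this.1, fibre₁_swap_eq_empty.mpr this.2⟩, e',
        hm, e⟩)))))
    · exact .inr (.inr (.inl (.inr (.inr (.inr ⟨hm, e, hm', e'⟩)))))
  | same =>
    rcases hn with hn | ⟨j, e, ⟨j₂, R, hne, hR, e'⟩ | ⟨j₂, k, a, R, -, ha, hjk, hR, e'⟩ |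
      ⟨a, hm, ha, ha', e'⟩ | ⟨hm, e'⟩⟩ | ⟨hm, e, h | ⟨j₂, e'⟩⟩
    · exact .inl hn.lowestTerms
    · rcases lowestTerms_or_eq hR with ⟨k, hk⟩ | rfl
      · exact .inr (.inl ⟨j₂, k, by rwa [e']⟩)
      · rw [add_zero] at e'
        refine .inr (.inr (.inl (.inr (.inl ⟨j, j₂, adm₁ j e, adm₂' j₂ e', e, e', ?_⟩))))
        by_contra! h
        rw [h.1, h.2] at hne
        exact hne rfl
    · exact .inr (.inl ⟨j₂, k, by rw [e']; exact lowestTerms_of_eq ha hjk hR⟩)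
    · exact .inr (.inr (.inl (.inr (.inr (.inl ⟨j, a, adm₁ j e, adm₂ j a ha e', hm, ha, ha', e,
        e'⟩)))))
    · exact .inr (.inr (.inl (.inr (.inr (.inr ⟨j, adm₁ j e, e, hm, e'⟩)))))
    · exact .inr (.inl h.lowestTerms)
    · have := adm₂' j₂ e'
      exact .inr (.inr (.inr (.inr (.inr (.inr ⟨j₂, ⟨this.1, fibre₁_swap_eq_empty.mpr this.2⟩, e',
        hm, e⟩)))))

end

/-- A branch with two terms is taken as the first one, giving form a) or a'). If neither branch has
two terms, the normalized pair is already in the list, at worst after an exchange when the first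
branch is a line. -/
theorem exists_listed {δ : Tangents} {Γ Λ : Set (ℕ × ℕ)} {φ : Bigerm} (hφ : φ ∈ SigmaSet δ Γ Λ) :
    ∃ (m₁ m₂ : ℕ) (P₁ P₂ : ℂ[X]),
      (AEquiv φ (model δ m₁ m₂ P₁ P₂) ∧
        model δ m₁ m₂ P₁ P₂ ∈ SigmaSet δ Γ Λ ∧ Listed δ Λ m₁ m₂ P₁ P₂) ∨
      (AEquiv φ.swap (model δ m₁ m₂ P₁ P₂) ∧
        model δ m₁ m₂ P₁ P₂ ∈ SigmaSet δ (Prod.swap '' Γ) (Prod.swap '' Λ) ∧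
        Listed δ (Prod.swap '' Λ) m₁ m₂ P₁ P₂) := by
  obtain ⟨m₁, m₂, P₁, P₂, he, hm, h₁, h₂, hn⟩ := exists_tail_normalized hφ
  rcases listed_or_lowestTerms hm h₁ h₂ hn with ⟨j, k, h⟩ | ⟨j, k, h⟩ | h | h
  · obtain ⟨Q₁, Q₂, ht, hQ, hA⟩ := exists_formA hm (fun i hi => ⟨(h₁ i hi).1, (h₁ i hi).2.2⟩) h₂ h
    exact ⟨m₁, m₂, Q₁, Q₂, .inl ⟨he.trans ht.aequiv, hQ, .of_formA hA⟩⟩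
  · obtain ⟨Q₁, Q₂, ht, hQ, hA⟩ := exists_formA_swap hm h₁ h₂ h
    exact ⟨m₂, m₁, Q₁, Q₂, .inr ⟨he.swap.trans ht.aequiv, hQ, .of_formA hA⟩⟩
  · exact ⟨m₁, m₂, P₁, P₂, .inl ⟨he, hm, h⟩⟩
  · exact ⟨m₂, m₁, P₂, P₁, .inr ⟨he.swap.trans (tequiv_swap_model δ m₁ m₂ P₁ P₂).aequiv,
      model_swap_mem_sigmaSet hm h₁.above h₂.above, h⟩⟩

/-! ### Truncated logarithms of tangent-to-identity automorphisms -/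

/-- `g ∘ σ - g`. -/
def shift (σ : ℂ × ℂ → ℂ × ℂ) (g : ℂ × ℂ → ℂ) (p : ℂ × ℂ) : ℂ := g (σ p) - g p

/-- The truncated logarithm of `g ↦ g ∘ σ`, applied to `g`. -/
def logSum (σ : ℂ × ℂ → ℂ × ℂ) (K : ℕ) (g : ℂ × ℂ → ℂ) (p : ℂ × ℂ) : ℂ :=
  ∑ n ∈ Finset.range (K + 1), logCoeff n * (shift σ)^[n] g p

section Shift

variable {σ : ℂ × ℂ → ℂ × ℂ} (hσ : IsGermAut σ) (hd : ∀ v, fderiv ℂ σ 0 v = v)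

include hσ

theorem analyticAt_shift {g : ℂ × ℂ → ℂ} (hg : AnalyticAt ℂ g 0) : AnalyticAt ℂ (shift σ g) 0 :=
  (AnalyticAt.fun_comp (by rwa [hσ.2.1]) hσ.1).sub hg

theorem analyticAt_shift_iterate {g : ℂ × ℂ → ℂ} (hg : AnalyticAt ℂ g 0) (n : ℕ) :
    AnalyticAt ℂ ((shift σ)^[n] g) 0 := by
  induction n with
  | zero => exact hg
  | succ n ih =>
    rw [Function.iterate_succ_apply']
    exact analyticAt_shift hσ ih

include hd

theorem inMaxSq_shift {g : ℂ × ℂ → ℂ} (hg : AnalyticAt ℂ g 0) : InMaxSq (shift σ g) := by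
  refine ⟨analyticAt_shift hσ hg, by simp [shift, hσ.2.1], ?_⟩
  have h1 : AnalyticAt ℂ g (σ 0) := by rwa [hσ.2.1]
  have h2 : HasFDerivAt σ (ContinuousLinearMap.id ℂ (ℂ × ℂ)) 0 := by
    have := hσ.1.differentiableAt.hasFDerivAt
    rwa [show fderiv ℂ σ 0 = ContinuousLinearMap.id ℂ (ℂ × ℂ) from
      ContinuousLinearMap.ext hd] at this
  have h3 := (h1.differentiableAt.hasFDerivAt.comp 0 h2).sub hg.differentiableAt.hasFDerivAt
  have h4 : HasFDerivAt (shift σ g) (0 : ℂ × ℂ →L[ℂ] ℂ) 0 := by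
    rw [hσ.2.1, ContinuousLinearMap.comp_id, sub_self] at h3
    exact h3
  exact h4.fderiv

theorem inMaxSq_shift_iterate {g : ℂ × ℂ → ℂ} (hg : AnalyticAt ℂ g 0) (n : ℕ) :
    InMaxSq ((shift σ)^[n + 1] g) := by
  rw [Function.iterate_succ_apply']
  exact inMaxSq_shift hσ hd (analyticAt_shift_iterate hσ hg n)

theorem inMaxSq_logSum {g : ℂ × ℂ → ℂ} (hg : AnalyticAt ℂ g 0) (K : ℕ) :
    InMaxSq (logSum σ K g) := by
  have e : logSum σ K g = fun p => ∑ n ∈ Finset.range K,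
      logCoeff (n + 1) * (shift σ)^[n + 1] g p := by
    funext p
    rw [logSum, Finset.sum_range_succ', logCoeff_zero, zero_mul, add_zero]
  rw [e]
  exact inMaxSq_sum _ fun n _ => (inMaxSq_shift_iterate hσ hd hg n).const_mul _

end Shift

theorem isBigO_sub_of_X_pow_dvd {f g : ℂ → ℂ × ℂ} (hf : AnalyticAt ℂ f 0) (hg : AnalyticAt ℂ g 0)
    {j : ℕ} (h₁ : PowerSeries.X ^ j ∣ taylor (fun t => (g t).1) - taylor fun t => (f t).1)
    (h₂ : PowerSeries.X ^ j ∣ taylor (fun t => (g t).2) - taylor fun t => (f t).2) :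
    (fun t => g t - f t) =O[𝓝 0] fun t : ℂ => t ^ j := by
  rw [← taylor_sub (analyticAt_fst_comp hg) (analyticAt_fst_comp hf)] at h₁
  rw [← taylor_sub (analyticAt_snd_comp hg) (analyticAt_snd_comp hf)] at h₂
  exact (isBigO_of_X_pow_dvd ((analyticAt_fst_comp hg).sub (analyticAt_fst_comp hf)) h₁).prod_left
    (isBigO_of_X_pow_dvd ((analyticAt_snd_comp hg).sub (analyticAt_snd_comp hf)) h₂)

/-- First order expansion of `h ∘ g - h ∘ f`. -/
theorem X_pow_dvd_taylor_comp_sub {h : ℂ × ℂ → ℂ} (hh : AnalyticAt ℂ h 0) {f g : ℂ → ℂ × ℂ}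
    (hf : AnalyticAt ℂ f 0) (hf0 : f 0 = 0) (hg : AnalyticAt ℂ g 0) (hg0 : g 0 = 0) {j : ℕ}
    (h₁ : PowerSeries.X ^ j ∣ taylor (fun t => (g t).1) - taylor fun t => (f t).1)
    (h₂ : PowerSeries.X ^ j ∣ taylor (fun t => (g t).2) - taylor fun t => (f t).2) :
    PowerSeries.X ^ (j + 1) ∣ (taylor (fun t => h (g t)) - taylor fun t => h (f t)) -
      (pdx h 0 • (taylor (fun t => (g t).1) - taylor fun t => (f t).1) +
        pdy h 0 • (taylor (fun t => (g t).2) - taylor fun t => (f t).2)) := by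
  have c₁ : AnalyticAt ℂ (fun t => h (g t)) 0 := AnalyticAt.fun_comp (by rwa [hg0]) hg
  have c₂ : AnalyticAt ℂ (fun t => h (f t)) 0 := AnalyticAt.fun_comp (by rwa [hf0]) hf
  have d₁ := (analyticAt_fst_comp hg).sub (analyticAt_fst_comp hf)
  have d₂ := (analyticAt_snd_comp hg).sub (analyticAt_snd_comp hf)
  -- Strict differentiability controls `h (g t) - h (f t)` by `o(‖g t - f t‖)`, hence by `o(t ^ j)`;
  -- differentiability at `0` alone would compare only with `f` and `g` themselves.
  have key := hh.hasStrictFDerivAt.isLittleO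
  have ht : Tendsto (fun t => (g t, f t)) (𝓝 0) (𝓝 ((0 : ℂ × ℂ), (0 : ℂ × ℂ))) := by
    have := hg.continuousAt.tendsto.prodMk_nhds hf.continuousAt.tendsto
    rwa [hg0, hf0] at this
  have key' := (key.comp_tendsto ht).trans_isBigO (isBigO_sub_of_X_pow_dvd hf hg h₁ h₂)
  have key'' : (fun t => (h (g t) - h (f t)) -
      (pdx h 0 * ((g t).1 - (f t).1) + pdy h 0 * ((g t).2 - (f t).2))) =o[𝓝 0]
      fun t : ℂ => t ^ j := by
    refine key'.congr_left fun t => ?_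
    simp only [Function.comp_apply, fderiv_apply_eq, Prod.fst_sub, Prod.snd_sub]
  have lin₁ : AnalyticAt ℂ (fun t => pdx h 0 * ((g t).1 - (f t).1)) 0 := analyticAt_const.mul d₁
  have lin₂ : AnalyticAt ℂ (fun t => pdy h 0 * ((g t).2 - (f t).2)) 0 := analyticAt_const.mul d₂
  have := X_pow_dvd_taylor_of_isLittleO
    ((c₁.fun_sub c₂).fun_sub (lin₁.fun_add lin₂)) key''
  rwa [taylor_sub (c₁.fun_sub c₂) (lin₁.fun_add lin₂), taylor_sub c₁ c₂, taylor_add lin₁ lin₂,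
    taylor_const_mul, taylor_const_mul, taylor_sub (analyticAt_fst_comp hg) (analyticAt_fst_comp hf),
    taylor_sub (analyticAt_snd_comp hg) (analyticAt_snd_comp hf)] at this

section Log

variable {σ : ℂ × ℂ → ℂ × ℂ} (hσ : IsGermAut σ) (hd : ∀ v, fderiv ℂ σ 0 v = v)
  {ρ : ℂ → ℂ} (hρ : IsGermAut ρ) (hρ1 : deriv ρ 0 = 1) {f g : ℂ → ℂ × ℂ}
  (hf : AnalyticAt ℂ f 0) (hf0 : f 0 = 0) (hg : AnalyticAt ℂ g 0) (hg0 : g 0 = 0)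
  (hc : σ ∘ f =ᶠ[𝓝 0] g ∘ ρ) {j : ℕ}
  (h₁ : PowerSeries.X ^ j ∣ taylor (fun t => (g t).1) - taylor fun t => (f t).1)
  (h₂ : PowerSeries.X ^ j ∣ taylor (fun t => (g t).2) - taylor fun t => (f t).2)

include hσ hd hρ hρ1 hf hf0 hg hg0 hc h₁ h₂

/-- From `σ ∘ f = g ∘ ρ`, the operator `h ↦ h ∘ σ - h` restricts along `f` to substitution by `ρ`
minus the identity, perturbed by the difference between `g` and `f`. The perturbation formula with
logarithmic weights yields a derivation `l d/dt`, the logarithm of `ρ`, plus the first order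
difference of the branches. -/
theorem exists_taylor_logSum :
    ∃ l : PowerSeries ℂ, ∀ h : ℂ × ℂ → ℂ, AnalyticAt ℂ h 0 → PowerSeries.X ^ (j + 1) ∣
      taylor (fun t => logSum σ (j + 1) h (f t)) -
        (l * PowerSeries.derivative ℂ (taylor fun t => h (f t)) +
          (pdx h 0 • (taylor (fun t => (g t).1) - taylor fun t => (f t).1) +
            pdy h 0 • (taylor (fun t => (g t).2) - taylor fun t => (f t).2))) := by
  have hs := hasSubst_taylor hρ.2.1
  have ha : PowerSeries.X ^ 2 ∣ taylor ρ - PowerSeries.X := by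
    rw [PowerSeries.X_pow_dvd_iff]
    intro i hi
    rw [map_sub]
    interval_cases i
    · rw [PowerSeries.coeff_zero_eq_constantCoeff_apply, constantCoeff_taylor, hρ.2.1]
      simp
    · rw [coeff_one_taylor, hρ1]
      simp
  have hR := subst_sub_self_raises ha hs
  obtain ⟨l, hl⟩ := opSum_log_eq_vecField ha hs (j + 1)
  set R : Module.End ℂ (PowerSeries ℂ) :=
    (PowerSeries.substAlgHom hs).toLinearMap - 1 with hRdef
  have hRapp : ∀ F : PowerSeries ℂ, R F = F.subst (taylor ρ) - F := by
    intro F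
    simp [hRdef, PowerSeries.coe_substAlgHom]
  have hsub : ∀ F G : PowerSeries ℂ,
      (F - G).subst (taylor ρ) = F.subst (taylor ρ) - G.subst (taylor ρ) := fun F G => by
    simp only [← PowerSeries.coe_substAlgHom hs, map_sub]
  refine ⟨l, fun h hh => ?_⟩
  set H : ℕ → ℂ × ℂ → ℂ := fun n => (shift σ)^[n] h with hH
  have hHa : ∀ n, AnalyticAt ℂ (H n) 0 := analyticAt_shift_iterate hσ hh
  have anf : ∀ {k : ℂ × ℂ → ℂ}, AnalyticAt ℂ k 0 → AnalyticAt ℂ (fun t => k (f t)) 0 := fun hk =>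
    AnalyticAt.fun_comp (by rwa [hf0]) hf
  have ang : ∀ {k : ℂ × ℂ → ℂ}, AnalyticAt ℂ k 0 → AnalyticAt ℂ (fun t => k (g t)) 0 := fun hk =>
    AnalyticAt.fun_comp (by rwa [hg0]) hg
  set u : ℕ → PowerSeries ℂ := fun n => taylor fun t => H n (f t) with hu
  set D : ℕ → PowerSeries ℂ := fun n => taylor (fun t => H n (g t)) - u n with hD
  set r : ℕ → PowerSeries ℂ := fun n => (D n).subst (taylor ρ) with hr
  set E : (ℂ × ℂ → ℂ) → PowerSeries ℂ := fun k =>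
    pdx k 0 • (taylor (fun t => (g t).1) - taylor fun t => (f t).1) +
      pdy k 0 • (taylor (fun t => (g t).2) - taylor fun t => (f t).2) with hE
  have hDE : ∀ n, PowerSeries.X ^ (j + 1) ∣ D n - E (H n) := fun n =>
    X_pow_dvd_taylor_comp_sub (hHa n) hf hf0 hg hg0 h₁ h₂
  have hEj : ∀ k, PowerSeries.X ^ j ∣ E k := fun k =>
    dvd_add (dvd_smul_of_dvd _ h₁) (dvd_smul_of_dvd _ h₂)
  have hDj : ∀ n, PowerSeries.X ^ j ∣ D n := fun n => by
    simpa using dvd_add ((pow_dvd_pow _ (Nat.le_succ j)).trans (hDE n)) (hEj (H n))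
  -- Shifted functions lie in `(x, y)²`, so the linear part of their variation from `f` to `g`
  -- vanishes and only `r 0` survives modulo `X ^ (j + 1)`.
  have hDs : ∀ n, PowerSeries.X ^ (j + 1) ∣ D (n + 1) := fun n => by
    have hin := inMaxSq_shift_iterate hσ hd hh n
    have hz : E (H (n + 1)) = 0 := by
      simp only [hE, hH]
      rw [hin.pdx_zero, hin.pdy_zero, zero_smul, zero_smul, add_zero]
    simpa [hz] using hDE (n + 1)
  have hrD : ∀ n, r n = D n + R (D n) := fun n => by rw [hRapp]; simp [hr]
  have hrec : ∀ n, u (n + 1) = R (u n) + r n := by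
    intro n
    have e1 : u (n + 1) = taylor (fun t => H n (g (ρ t))) - u n := by
      have a1 : AnalyticAt ℂ (fun t => H n (σ (f t))) 0 :=
        AnalyticAt.fun_comp (g := fun p => H n (σ p))
          (by rw [hf0]; exact AnalyticAt.fun_comp (by rw [hσ.2.1]; exact hHa n) hσ.1) hf
      have e2 : taylor (fun t => H n (σ (f t))) = taylor fun t => H n (g (ρ t)) := by
        refine taylor_congr ?_
        filter_upwards [hc] with t ht
        simp only [Function.comp_apply] at ht
        rw [ht]
      rw [← e2, ← taylor_sub a1 (anf (hHa n))]
      simp only [hu, hH]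
      rw [Function.iterate_succ_apply']
      rfl
    rw [e1, taylor_comp (f := fun t => H n (g t)) (ang (hHa n)) hρ.1 hρ.2.1, hRapp]
    simp only [hr, hD]
    rw [hsub]
    ring
  have hR0 : PowerSeries.X ^ (j + 1) ∣ R (D 0) := hR j _ (hDj 0)
  have key := perturbed_sum_succ hR hrec (p := j)
    (by rw [hrD]; exact dvd_add (hDj 0) ((pow_dvd_pow _ (Nat.le_succ j)).trans hR0))
    (fun n => by
      rw [hrD]
      exact dvd_add (hDs n) ((pow_dvd_pow _ (Nat.le_succ _)).trans (hR _ _ (hDs n))))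
    logCoeff_one (K := j + 1) (Nat.succ_pos j)
  have hsum : taylor (fun t => logSum σ (j + 1) h (f t)) =
      ∑ n ∈ Finset.range (j + 1 + 1), logCoeff n • u n := by
    simp only [logSum]
    rw [taylor_sum (f := fun n t => logCoeff n * (shift σ)^[n] h (f t))]
    · exact Finset.sum_congr rfl fun n _ => taylor_const_mul _ _
    · intro n _
      exact analyticAt_const.mul (anf (hHa n))
  have hl0 := (pow_dvd_pow PowerSeries.X (Nat.le_succ (j + 1))).trans (hl (u 0))
  have := dvd_add (dvd_add key hl0) (dvd_add (hDE 0) hR0)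
  rw [hsum]
  convert this using 1
  rw [hrD]
  simp only [hu, hH, hE, Function.iterate_zero, id_eq]
  ring

/-- In the determinant of the logarithmic field with the tangent vector the component `l` cancels,
leaving the difference of the branches. The error `X ^ (j + 1)` gains the order `m - 1` of the
tangent vector. -/
theorem X_pow_dvd_pullback_logSum {m : ℕ} (hm : 0 < m)
    (hm₁ : PowerSeries.X ^ m ∣ taylor fun t => (f t).1)
    (hm₂ : PowerSeries.X ^ m ∣ taylor fun t => (f t).2) :
    PowerSeries.X ^ (j + m) ∣
      taylor (pullback (logSum σ (j + 1) fun q => q.2) (fun p => -logSum σ (j + 1) (fun q => q.1) p) f) -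
        ((taylor (fun t => (g t).2) - taylor fun t => (f t).2) *
            PowerSeries.derivative ℂ (taylor fun t => (f t).1) -
          (taylor (fun t => (g t).1) - taylor fun t => (f t).1) *
            PowerSeries.derivative ℂ (taylor fun t => (f t).2)) := by
  obtain ⟨l, hl⟩ := exists_taylor_logSum hσ hd hρ hρ1 hf hf0 hg hg0 hc h₁ h₂
  have ex := hl (fun q => q.1) analyticAt_fst
  have ey := hl (fun q => q.2) analyticAt_snd
  rw [pdx_fst, pdy_fst, one_smul, zero_smul, add_zero] at ex
  rw [pdx_snd, pdy_snd, one_smul, zero_smul, zero_add] at ey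
  have hA := (inMaxSq_logSum hσ hd (g := fun q => q.2) analyticAt_snd (j + 1)).1
  have hB : AnalyticAt ℂ (fun p => -logSum σ (j + 1) (fun q => q.1) p) 0 :=
    (inMaxSq_logSum hσ hd (g := fun q => q.1) analyticAt_fst (j + 1)).neg.1
  obtain ⟨k, rfl⟩ : ∃ k, m = k + 1 := ⟨m - 1, by omega⟩
  have d₁ := mul_dvd_mul ey (X_pow_dvd_derivative hm₁)
  have d₂ := mul_dvd_mul ex (X_pow_dvd_derivative hm₂)
  rw [← pow_add] at d₁ d₂
  have e : j + 1 + k = j + (k + 1) := by ring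
  rw [e] at d₁ d₂
  rw [taylor_pullback hA hB hf hf0, taylor_neg]
  convert dvd_sub d₁ d₂ using 1
  ring

end Log

/-! ### Orders of pull-backs and points of `Λ` -/

/-- Adding a form of high finite order makes the orders of a form along two branches finite. -/
theorem exists_finite_order {δ : Tangents} {A B : ℂ × ℂ → ℂ} (h : InOmega δ A B)
    {f₁ f₂ : ℂ → ℂ × ℂ} (hf₁ : AnalyticAt ℂ f₁ 0) (hf₂ : AnalyticAt ℂ f₂ 0) {m₁ m₂ : ℕ} (p₁ : 0 < m₁) (p₂ : 0 < m₂)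
    (w₁ : ord (fun t => (f₁ t).1 + (f₁ t).2) = m₁) (w₂ : ord (fun t => (f₂ t).1 + (f₂ t).2) = m₂)
    {j : ℕ} (o₁ : ord (pullback A B f₁) + 1 = (j : ℕ∞) + m₁)
    (o₂ : ((j + m₂ : ℕ) : ℕ∞) ≤ ord (pullback A B f₂)) :
    ∃ A' B', InOmega δ A' B' ∧ ord (pullback A' B' f₁) + 1 = (j : ℕ∞) + m₁ ∧
      ∃ v : ℕ, j < v ∧ ord (pullback A' B' f₂) + 1 = (v : ℕ∞) + m₂ := by
  have fin : ∀ {o : ℕ∞}, o ≠ ⊤ → ((j + m₂ : ℕ) : ℕ∞) ≤ o →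
      ∃ v : ℕ, j < v ∧ o + 1 = (v : ℕ∞) + m₂ := by
    intro o ho hle
    obtain ⟨n, rfl⟩ := ENat.ne_top_iff_exists.mp ho
    have hn : j + m₂ ≤ n := by exact_mod_cast hle
    refine ⟨n + 1 - m₂, by omega, ?_⟩
    have : n + 1 = (n + 1 - m₂) + m₂ := by omega
    exact_mod_cast this
  by_cases ht : ord (pullback A B f₂) = ⊤
  -- The added form is `(x + y) ^ (j + 2) (dx + dy)`. Since `x + y` has order `mᵢ` on branch `i`,
  -- its pull-back has finite order there; the exponent `j + 2` is large enough to leave the order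
  -- on the first branch unchanged and to exceed `j` on the second.
  · set E : ℂ × ℂ → ℂ := fun p => (p.1 + p.2) ^ (j + 2) with hE
    have hlin : AnalyticAt ℂ (fun p : ℂ × ℂ => p.1 + p.2) 0 := analyticAt_fst.add analyticAt_snd
    have hEm : InMaxSq E := by
      have h2 := (inMaxSq_mul hlin hlin (by simp) (by simp)).mul (hlin.fun_pow j)
      convert h2 using 1
      funext p
      simp only [hE]
      ring
    obtain ⟨hA, β, η, hη, hβ, rfl⟩ := h
    have ordE : ∀ {f : ℂ → ℂ × ℂ} {m : ℕ}, AnalyticAt ℂ f 0 → 0 < m →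
        ord (fun t => (f t).1 + (f t).2) = m →
        ord (pullback E E f) = ((j + 2) * m + (m - 1) : ℕ) := by
      intro f m hf hm hw
      have hw' : AnalyticAt ℂ (fun t => (f t).1 + (f t).2) 0 :=
        (analyticAt_fst_comp hf).fun_add (analyticAt_snd_comp hf)
      have e : pullback E E f =ᶠ[𝓝 0] (fun t => (f t).1 + (f t).2) ^ (j + 2) *
          deriv fun t => (f t).1 + (f t).2 := by
        filter_upwards [hf.eventually_analyticAt] with t ht
        simp only [pullback, hE, Pi.mul_apply, Pi.pow_apply]
        rw [deriv_fun_add (analyticAt_fst_comp ht).differentiableAt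
          (analyticAt_snd_comp ht).differentiableAt]
        ring
      have hdw : ord (deriv fun t => (f t).1 + (f t).2) = (m - 1 : ℕ) := by
        refine analyticOrderAt_deriv_of_pos hw' (n := m - 1) ?_
        have : m - 1 + 1 = m := by omega
        rw [← Nat.cast_add_one, this]
        exact hw
      rw [ord_congr e, ord, analyticOrderAt_mul (hw'.pow _) hw'.deriv, analyticOrderAt_pow hw']
      change (j + 2) • ord (fun t => (f t).1 + (f t).2) + ord (deriv fun t => (f t).1 + (f t).2) = _
      rw [hdw, hw, nsmul_eq_mul]
      push_cast
      rfl
    have hadd : ∀ f : ℂ → ℂ × ℂ, pullback (fun p => A p + E p)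
        (fun p => β * p.2 + (η p + E p)) f = pullback A (fun p => β * p.2 + η p) f + pullback E E f := by
      intro f
      funext t
      simp only [pullback, Pi.add_apply]
      ring
    refine ⟨_, _, ⟨hA.add hEm, β, fun p => η p + E p, hη.add hEm, hβ, rfl⟩, ?_, ?_⟩
    · have : ord (pullback A (fun p => β * p.2 + η p) f₁) < ord (pullback E E f₁) := by
        rw [ordE hf₁ p₁ w₁]
        by_contra hge
        rw [not_lt] at hge
        have h1 : (((j + 2) * m₁ + (m₁ - 1) : ℕ) : ℕ∞) + 1 ≤ (j : ℕ∞) + m₁ := by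
          rw [← o₁]; gcongr
        have h2 : (j + 2) * m₁ + (m₁ - 1) + 1 ≤ j + m₁ := by exact_mod_cast h1
        have h3 : j + 2 ≤ (j + 2) * m₁ := Nat.le_mul_of_pos_right _ p₁
        omega
      rw [hadd, ord, analyticOrderAt_add_eq_left_of_lt this]
      exact o₁
    · have e2 : ord (pullback (fun p => A p + E p) (fun p => β * p.2 + (η p + E p)) f₂) =
          ((j + 2) * m₂ + (m₂ - 1) : ℕ) := by
        rw [hadd, ord, analyticOrderAt_add_eq_right_of_lt]
        · exact ordE hf₂ p₂ w₂
        · change ord (pullback E E f₂) < ord _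
          rw [ht, ordE hf₂ p₂ w₂]
          exact ENat.natCast_lt_top _
      rw [e2]
      refine fin (ENat.natCast_ne_top _) ?_
      have h3 : j + 1 ≤ (j + 1) * m₂ := Nat.le_mul_of_pos_right _ p₂
      have h4 : (j + 2) * m₂ = (j + 1) * m₂ + m₂ := by ring
      have : j + m₂ ≤ (j + 2) * m₂ + (m₂ - 1) := by omega
      exact_mod_cast this
  · exact ⟨A, B, h, o₁, fin ht o₂⟩

/-- The factor `d(X ^ m)` has order `m - 1`, so `coeff j b` governs degree `j + m - 1`, just below
the error term. -/
theorem ord_pullback_of_dvd {F : ℂ → ℂ} (hF : AnalyticAt ℂ F 0) {m j : ℕ} (hm : 0 < m) {s : ℂ}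
    (hs : s ≠ 0) {b : PowerSeries ℂ} (hb : PowerSeries.X ^ j ∣ b)
    (h : PowerSeries.X ^ (j + m) ∣ taylor F - s • (PowerSeries.derivative ℂ (PowerSeries.X ^ m) * b)) :
    (PowerSeries.coeff j b ≠ 0 → ord F + 1 = (j : ℕ∞) + m) ∧
      (PowerSeries.coeff j b = 0 → ((j + m : ℕ) : ℕ∞) ≤ ord F) := by
  obtain ⟨k, rfl⟩ : ∃ k, m = k + 1 := ⟨m - 1, by omega⟩
  have hk : (k : ℂ) + 1 ≠ 0 := by exact_mod_cast k.succ_ne_zero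
  rw [derivative_X_pow] at h
  have e : s • (PowerSeries.C ((k : ℂ) + 1) * PowerSeries.X ^ k * b) =
      PowerSeries.X ^ k * ((s * ((k : ℂ) + 1)) • b) := by
    rw [PowerSeries.smul_eq_C_mul, PowerSeries.smul_eq_C_mul, map_mul]
    ring
  rw [e] at h
  refine ⟨fun hc => ?_, fun hc => ?_⟩
  · have : ord F = ((k + j : ℕ) : ℕ∞) := by
      rw [ord_eq_iff hF]
      constructor
      · have h1 := mul_dvd_mul (dvd_refl (PowerSeries.X ^ k))
          (dvd_smul_of_dvd (s * ((k : ℂ) + 1)) hb)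
        rw [← pow_add] at h1
        simpa using dvd_add ((pow_dvd_pow _ (by omega : k + j ≤ j + (k + 1))).trans h) h1
      · rw [coeff_eq_of_X_pow_dvd_sub h (by omega), add_comm k j, PowerSeries.coeff_X_pow_mul,
          PowerSeries.coeff_smul, smul_eq_mul]
        exact mul_ne_zero (mul_ne_zero hs hk) hc
    rw [this]
    push_cast
    ring
  · rw [le_ord_iff hF]
    have hb' : PowerSeries.X ^ (j + 1) ∣ b := by
      rw [PowerSeries.X_pow_dvd_iff]
      intro i hi
      rcases Nat.lt_or_ge i j with hlt | hge
      · exact PowerSeries.X_pow_dvd_iff.mp hb i hlt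
      · obtain rfl : i = j := by omega
        exact hc
    have h1 := mul_dvd_mul (dvd_refl (PowerSeries.X ^ k)) (dvd_smul_of_dvd (s * ((k : ℂ) + 1)) hb')
    rw [← pow_add] at h1
    simpa using dvd_add h ((pow_dvd_pow _ (by omega : j + (k + 1) ≤ k + (j + 1))).trans h1)

theorem PuiseuxCoord.ord_add {m : ℕ} {y : ℂ → ℂ} (h : PuiseuxCoord m y) :
    ord (fun t => t ^ m + y t) = m := by
  have hp : AnalyticAt ℂ (fun t : ℂ => t ^ m) 0 := by fun_prop
  rw [ord_eq_iff (hp.fun_add h.2.1), taylor_add hp h.2.1, taylor_id_pow]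
  refine ⟨dvd_add dvd_rfl ((pow_dvd_pow _ (Nat.le_succ m)).trans h.2.2), ?_⟩
  rw [map_add, PowerSeries.coeff_X_pow_self,
    PowerSeries.X_pow_dvd_iff.mp h.2.2 m (Nat.lt_succ_self m), add_zero]
  exact one_ne_zero

section Puiseux

variable {δ : Tangents} {m₁ m₂ : ℕ} {y₁ y₂ : ℂ → ℂ}

theorem puiseux_zero₁ (h₁ : PuiseuxCoord m₁ y₁) : (puiseux δ m₁ m₂ y₁ y₂).1 0 = 0 := by
  cases δ <;> simp [puiseux, h₁.apply_zero, h₁.1.ne']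

theorem puiseux_zero₂ (h₂ : PuiseuxCoord m₂ y₂) : (puiseux δ m₁ m₂ y₁ y₂).2 0 = 0 := by
  cases δ <;> simp [puiseux, h₂.apply_zero, h₂.1.ne']

theorem ord_add_puiseux₁ (h₁ : PuiseuxCoord m₁ y₁) :
    ord (fun t => ((puiseux δ m₁ m₂ y₁ y₂).1 t).1 + ((puiseux δ m₁ m₂ y₁ y₂).1 t).2) = m₁ := by
  cases δ <;> exact h₁.ord_add

theorem ord_add_puiseux₂ (h₂ : PuiseuxCoord m₂ y₂) :
    ord (fun t => ((puiseux δ m₁ m₂ y₁ y₂).2 t).1 + ((puiseux δ m₁ m₂ y₁ y₂).2 t).2) = m₂ := by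
  cases δ with
  | distinct =>
    have := h₂.ord_add
    simp only [add_comm (_ ^ m₂)] at this
    exact this
  | same => exact h₂.ord_add

/-- Bigerms carried into each other by a germ tangent to the identity, whose coefficients first
differ in degree `j`, produce points of `Λ`. -/
theorem exists_mem_values (h₁ : PuiseuxCoord m₁ y₁) (h₂ : PuiseuxCoord m₂ y₂) {z₁ z₂ : ℂ → ℂ}
    (h₁' : PuiseuxCoord m₁ z₁) (h₂' : PuiseuxCoord m₂ z₂) {ρ₁ ρ₂ : ℂ → ℂ} {σ : ℂ × ℂ → ℂ × ℂ}
    (hρ₁ : IsGermAut ρ₁) (hρ₂ : IsGermAut ρ₂) (e₁ : deriv ρ₁ 0 = 1) (e₂ : deriv ρ₂ 0 = 1)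
    (hσ : IsGermAut σ) (hd : ∀ v, fderiv ℂ σ 0 v = v)
    (hc : Carries ρ₁ ρ₂ σ (puiseux δ m₁ m₂ y₁ y₂) (puiseux δ m₁ m₂ z₁ z₂)) {j : ℕ}
    (d₁ : PowerSeries.X ^ j ∣ taylor z₁ - taylor y₁)
    (d₂ : PowerSeries.X ^ j ∣ taylor z₂ - taylor y₂) :
    (PowerSeries.coeff j (taylor z₁ - taylor y₁) ≠ 0 →
      PowerSeries.coeff j (taylor z₂ - taylor y₂) ≠ 0 →
      (j, j) ∈ valuesOfDifferentials δ (puiseux δ m₁ m₂ y₁ y₂)) ∧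
    (PowerSeries.coeff j (taylor z₁ - taylor y₁) ≠ 0 →
      PowerSeries.coeff j (taylor z₂ - taylor y₂) = 0 →
      (fibre₁ (valuesOfDifferentials δ (puiseux δ m₁ m₂ y₁ y₂)) (j, j)).Nonempty) ∧
    (PowerSeries.coeff j (taylor z₁ - taylor y₁) = 0 →
      PowerSeries.coeff j (taylor z₂ - taylor y₂) ≠ 0 →
      (fibre₂ (valuesOfDifferentials δ (puiseux δ m₁ m₂ y₁ y₂)) (j, j)).Nonempty) := by
  set A : ℂ × ℂ → ℂ := logSum σ (j + 1) fun q => q.2 with hA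
  set B : ℂ × ℂ → ℂ := fun p => -logSum σ (j + 1) (fun q => q.1) p with hB
  have hAm : InMaxSq A := inMaxSq_logSum hσ hd analyticAt_snd _
  have hBm : InMaxSq B := (inMaxSq_logSum hσ hd analyticAt_fst _).neg
  -- Since `σ` is tangent to the identity both coefficients lie in `(x, y)²`; the term `β y dy` is
  -- not needed even for a common tangent.
  have hΩ : InOmega δ A B := ⟨hAm, 0, B, hBm, fun _ => rfl, by simp⟩
  have hf := analyticAt_puiseux δ h₁ h₂
  have hf' := analyticAt_puiseux δ h₁' h₂'
  have pw : ∀ m : ℕ, (taylor fun t : ℂ => t ^ m) = PowerSeries.X ^ m := fun m => taylor_id_pow m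
  have le : ∀ {m : ℕ} {y : ℂ → ℂ}, PuiseuxCoord m y → PowerSeries.X ^ m ∣ taylor y := fun hy =>
    (pow_dvd_pow _ (Nat.le_succ _)).trans hy.2.2
  have pull₁ : PowerSeries.X ^ (j + m₁) ∣ taylor (pullback A B (puiseux δ m₁ m₂ y₁ y₂).1) -
      (1 : ℂ) • (PowerSeries.derivative ℂ (PowerSeries.X ^ m₁) * (taylor z₁ - taylor y₁)) := by
    rw [one_smul]
    have aux : ∀ {f g : ℂ → ℂ × ℂ}, f = (fun t => (t ^ m₁, y₁ t)) → g = (fun t => (t ^ m₁, z₁ t)) →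
        AnalyticAt ℂ f 0 → f 0 = 0 → AnalyticAt ℂ g 0 → g 0 = 0 → σ ∘ f =ᶠ[𝓝 0] g ∘ ρ₁ →
        PowerSeries.X ^ (j + m₁) ∣ taylor (pullback A B f) -
          (PowerSeries.derivative ℂ (PowerSeries.X ^ m₁) * (taylor z₁ - taylor y₁)) := by
      rintro f g rfl rfl a1 a2 a3 a4 a5
      have := X_pow_dvd_pullback_logSum hσ hd hρ₁ e₁ a1 a2 a3 a4 a5 (by simp) d₁ h₁.1
        (by rw [pw]) (le h₁)
      rw [pw, sub_self, zero_mul, sub_zero, mul_comm] at this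
      exact this
    refine aux (g := (puiseux δ m₁ m₂ z₁ z₂).1) ?_ ?_ hf.1 (puiseux_zero₁ h₁) hf'.1
      (puiseux_zero₁ h₁') hc.1 <;> cases δ <;> rfl
  have pull₂ : PowerSeries.X ^ (j + m₂) ∣ taylor (pullback A B (puiseux δ m₁ m₂ y₁ y₂).2) -
      branchSign δ • (PowerSeries.derivative ℂ (PowerSeries.X ^ m₂) * (taylor z₂ - taylor y₂)) := by
    cases δ with
    | distinct =>
      have := X_pow_dvd_pullback_logSum hσ hd hρ₂ e₂ hf.2 (puiseux_zero₂ h₂) hf'.2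
        (puiseux_zero₂ h₂') hc.2 d₂ (by simp [puiseux]) h₂.1 (le h₂)
        (by simp only [puiseux]; rw [pw])
      simp only [puiseux] at this ⊢
      rw [pw, sub_self, zero_mul, zero_sub, mul_comm] at this
      rw [branchSign, neg_one_smul]
      exact this
    | same =>
      have := X_pow_dvd_pullback_logSum hσ hd hρ₂ e₂ hf.2 (puiseux_zero₂ h₂) hf'.2
        (puiseux_zero₂ h₂') hc.2 (by simp [puiseux]) d₂ h₂.1 (by simp only [puiseux]; rw [pw])
        (le h₂)
      simp only [puiseux] at this ⊢
      rw [pw, sub_self, zero_mul, sub_zero, mul_comm] at this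
      rw [branchSign, one_smul]
      exact this
  obtain ⟨o₁, o₁'⟩ := ord_pullback_of_dvd
    (analyticAt_pullback hAm.1 hBm.1 hf.1 (puiseux_zero₁ h₁)) h₁.1 one_ne_zero d₁ pull₁
  obtain ⟨o₂, o₂'⟩ := ord_pullback_of_dvd
    (analyticAt_pullback hAm.1 hBm.1 hf.2 (puiseux_zero₂ h₂)) h₂.1 (branchSign_ne_zero δ) d₂ pull₂
  refine ⟨fun c₁ c₂ => ⟨A, B, hΩ, ?_, ?_⟩, fun c₁ c₂ => ?_, fun c₁ c₂ => ?_⟩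
  · rw [mult_puiseux₁ δ h₁]; exact o₁ c₁
  · rw [mult_puiseux₂ δ h₂]; exact o₂ c₂
  · obtain ⟨A', B', hΩ', q₁, v, hv, q₂⟩ := exists_finite_order hΩ hf.1 hf.2 h₁.1 h₂.1 (ord_add_puiseux₁ h₁) (ord_add_puiseux₂ h₂) (o₁ c₁) (o₂' c₂)
    refine ⟨(j, v), ⟨A', B', hΩ', ?_, ?_⟩, rfl, hv⟩
    · rw [mult_puiseux₁ δ h₁]; exact q₁
    · rw [mult_puiseux₂ δ h₂]; exact q₂
  · obtain ⟨A', B', hΩ', q₂, v, hv, q₁⟩ := exists_finite_order hΩ hf.2 hf.1 h₂.1 h₁.1 (ord_add_puiseux₂ h₂) (ord_add_puiseux₁ h₁) (o₂ c₂) (o₁' c₁)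
    refine ⟨(v, j), ⟨A', B', hΩ', ?_, ?_⟩, rfl, hv⟩
    · rw [mult_puiseux₁ δ h₁]; exact q₁
    · rw [mult_puiseux₂ δ h₂]; exact q₂

end Puiseux

/-! ### Uniqueness up to homotheties -/

section Uniqueness

variable {δ : Tangents} {Γ Λ : Set (ℕ × ℕ)} {m₁ m₂ : ℕ} {P₁ P₂ Q₁ Q₂ : ℂ[X]}

/-- In the first degree `j` where the bigerms differ, the logarithm of `σ` gives a point of `Λ`. A
difference on one branch only makes `F₁(j, j)` or `F₂(j, j)` nonempty, while a nonzero coefficient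
there required it to be empty. -/
theorem eq_of_carries_unipotent (hφ : model δ m₁ m₂ P₁ P₂ ∈ SigmaSet δ Γ Λ) (hP₁ : Tail₁ Λ m₁ P₁)
    (hP₂ : Tail₂ Λ m₂ P₂) (hQ₁ : Tail₁ Λ m₁ Q₁) (hQ₂ : Tail₂ Λ m₂ Q₂)
    {ρ₁ ρ₂ : ℂ → ℂ} {σ : ℂ × ℂ → ℂ × ℂ}
    (hρ₁ : IsGermAut ρ₁) (hρ₂ : IsGermAut ρ₂) (e₁ : deriv ρ₁ 0 = 1) (e₂ : deriv ρ₂ 0 = 1)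
    (hσ : IsGermAut σ) (hd : ∀ v, fderiv ℂ σ 0 v = v)
    (hc : Carries ρ₁ ρ₂ σ (model δ m₁ m₂ P₁ P₂) (model δ m₁ m₂ Q₁ Q₂)) : P₁ = Q₁ ∧ P₂ = Q₂ := by
  classical
  obtain ⟨p₁, p₂⟩ := multiplicities_pos hφ.2.1
  have hΛ := hφ.2.2.2
  rw [model_eq_puiseux] at hΛ hc
  rw [model_eq_puiseux] at hc
  by_contra hne
  have hex : ∃ j, P₁.coeff j ≠ Q₁.coeff j ∨ P₂.coeff j ≠ Q₂.coeff j := by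
    by_contra! h
    exact hne ⟨Polynomial.ext fun j => (h j).1, Polynomial.ext fun j => (h j).2⟩
  set j := Nat.find hex with hj
  have hmin : ∀ i < j, P₁.coeff i = Q₁.coeff i ∧ P₂.coeff i = Q₂.coeff i := fun i hi => by
    have := Nat.find_min hex hi
    push Not at this
    exact this
  have tp : ∀ (P Q : ℂ[X]) (i : ℕ), PowerSeries.coeff i
      (taylor (fun t => Q.eval t) - taylor fun t => P.eval t) = Q.coeff i - P.coeff i :=
    fun P Q i => by rw [map_sub, taylor_polynomial, taylor_polynomial, coeff_coe, coeff_coe]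
  obtain ⟨k₁₂, k₁, k₂⟩ := exists_mem_values (hP₁.above.puiseuxCoord p₁) (hP₂.above.puiseuxCoord p₂)
    (hQ₁.above.puiseuxCoord p₁) (hQ₂.above.puiseuxCoord p₂) hρ₁ hρ₂ e₁ e₂ hσ hd hc (j := j)
    (PowerSeries.X_pow_dvd_iff.mpr fun i hi => by rw [tp, (hmin i hi).1, sub_self])
    (PowerSeries.X_pow_dvd_iff.mpr fun i hi => by rw [tp, (hmin i hi).2, sub_self])
  rw [tp, tp, hΛ] at k₁₂ k₁ k₂
  have f₁ : Q₁.coeff j - P₁.coeff j ≠ 0 → (j, j) ∉ maximalPoints Λ ∧ fibre₁ Λ (j, j) = ∅ := by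
    intro h
    by_cases h0 : P₁.coeff j = 0
    · rw [h0, sub_zero] at h
      exact (hQ₁ j (mem_support_iff.mpr h)).2
    · exact (hP₁ j (mem_support_iff.mpr h0)).2
  have f₂ : Q₂.coeff j - P₂.coeff j ≠ 0 → fibre₂ Λ (j, j) = ∅ := by
    intro h
    by_cases h0 : P₂.coeff j = 0
    · rw [h0, sub_zero] at h
      exact (hQ₂ j (mem_support_iff.mpr h)).2
    · exact (hP₂ j (mem_support_iff.mpr h0)).2
  by_cases c₁ : Q₁.coeff j - P₁.coeff j = 0
  · have c₂ : Q₂.coeff j - P₂.coeff j ≠ 0 := by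
      intro h
      rcases Nat.find_spec hex with h' | h'
      · exact h' (sub_eq_zero.mp c₁).symm
      · exact h' (sub_eq_zero.mp h).symm
    exact (k₂ c₁ c₂).ne_empty (f₂ c₂)
  · by_cases c₂ : Q₂.coeff j - P₂.coeff j = 0
    · exact (k₁ c₁ c₂).ne_empty (f₁ c₁).2
    -- When both branches differ, `(j, j)` lies in `Λ` with both fibres empty, so it is a maximal
    -- point, which is excluded on the first branch.
    · exact (f₁ c₁).1 ⟨k₁₂ c₁ c₂, (f₁ c₁).2, f₂ c₂⟩

theorem germAut_fderiv_homothety_ne_zero {σ : ℂ × ℂ → ℂ × ℂ} (hσ : IsGermAut σ) {a b : ℂ}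
    (hd : ∀ v : ℂ × ℂ, fderiv ℂ σ 0 v = (a * v.1, b * v.2)) : a ≠ 0 ∧ b ≠ 0 := by
  obtain ⟨e, he⟩ := hσ.2.2
  have hinj : ∀ v : ℂ × ℂ, fderiv ℂ σ 0 v = 0 → v = 0 := fun v hv => by
    rw [← he] at hv
    exact e.map_eq_zero_iff.mp hv
  constructor
  · rintro rfl
    have := hinj (1, 0) (by rw [hd]; simp)
    simp at this
  · rintro rfl
    have := hinj (0, 1) (by rw [hd]; simp)
    simp at this

/-- The leading coefficient in `x ∘ σ ∘ f = ρ ^ m` for a linear form `x`. -/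
theorem leading_coeff_eq {g : ℂ × ℂ → ℂ} (hg : AnalyticAt ℂ g 0) (hg0 : g 0 = 0) {f : ℂ → ℂ × ℂ}
    (hf : AnalyticAt ℂ f 0) (hf0 : f 0 = 0) {m : ℕ}
    (h₁ : PowerSeries.X ^ m ∣ taylor fun t => (f t).1)
    (h₂ : PowerSeries.X ^ m ∣ taylor fun t => (f t).2) {ρ : ℂ → ℂ} (hρ : IsGermAut ρ)
    (he : (fun t => g (f t)) =ᶠ[𝓝 0] fun t => ρ t ^ m) :
    pdx g 0 * PowerSeries.coeff m (taylor fun t => (f t).1) +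
      pdy g 0 * PowerSeries.coeff m (taylor fun t => (f t).2) = deriv ρ 0 ^ m := by
  have key := X_pow_dvd_taylor_comp_sub hg (f := fun _ => 0) analyticAt_const rfl hf hf0 (j := m)
    (by simpa [taylor_const] using h₁) (by simpa [taylor_const] using h₂)
  have hz : (taylor fun _ : ℂ => g 0) = 0 := by rw [taylor_const, hg0, map_zero]
  have hz1 : (taylor fun _ : ℂ => ((0 : ℂ × ℂ)).1) = 0 := by rw [taylor_const]; simp
  have hz2 : (taylor fun _ : ℂ => ((0 : ℂ × ℂ)).2) = 0 := by rw [taylor_const]; simp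
  rw [hz, hz1, hz2, sub_zero, sub_zero, sub_zero] at key
  have h3 := coeff_eq_of_X_pow_dvd_sub key (Nat.lt_succ_self m)
  rw [map_add, PowerSeries.coeff_smul, PowerSeries.coeff_smul, smul_eq_mul, smul_eq_mul] at h3
  rw [← h3, taylor_congr he, taylor_pow hρ.1]
  obtain ⟨v, hv⟩ := X_dvd_taylor hρ.2.1
  have hv0 : PowerSeries.coeff 0 v = deriv ρ 0 := by
    rw [← coeff_one_taylor, hv]
    exact (PowerSeries.coeff_succ_X_mul 0 v).symm
  have := PowerSeries.coeff_X_pow_mul (v ^ m) m 0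
  rw [zero_add] at this
  rw [hv, mul_pow, this, ← hv0]
  simp

/-- Bigerms with reduced coordinates are `ℋ`-equivalent only through homotheties. -/
theorem HEquiv.exists_homothety (hP : model δ m₁ m₂ P₁ P₂ ∈ SigmaSet δ Γ Λ) (hP₁ : Tail₁ Λ m₁ P₁)
    (hP₂ : Tail₂ Λ m₂ P₂) (hQ₁ : Tail₁ Λ m₁ Q₁) (hQ₂ : Tail₂ Λ m₂ Q₂)
    (h : HEquiv (model δ m₁ m₂ P₁ P₂) (model δ m₁ m₂ Q₁ Q₂)) :
    ∃ α β a b : ℂ, α ≠ 0 ∧ β ≠ 0 ∧ a ≠ 0 ∧ b ≠ 0 ∧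
      Carries (fun t => α * t) (fun t => β * t) (fun p => (a * p.1, b * p.2))
        (model δ m₁ m₂ P₁ P₂) (model δ m₁ m₂ Q₁ Q₂) := by
  obtain ⟨ρ₁, ρ₂, σ, hρ₁, hρ₂, hσ, ⟨a, b, hd⟩, hc⟩ := h
  obtain ⟨p₁, p₂⟩ := multiplicities_pos hP.2.1
  obtain ⟨ha, hb⟩ := germAut_fderiv_homothety_ne_zero hσ hd
  have hα := (isGermAut_iff_deriv.mp hρ₁).2.2
  have hβ := (isGermAut_iff_deriv.mp hρ₂).2.2
  set α := deriv ρ₁ 0 with hαdef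
  set β := deriv ρ₂ 0 with hβdef
  have c₁ := hP₁.above.puiseuxCoord p₁
  have c₂ := hP₂.above.puiseuxCoord p₂
  have pw : ∀ m : ℕ, (taylor fun t : ℂ => t ^ m) = PowerSeries.X ^ m := fun m => taylor_id_pow m
  have le : ∀ {m : ℕ} {y : ℂ → ℂ}, PuiseuxCoord m y → PowerSeries.X ^ m ∣ taylor y := fun hy =>
    (pow_dvd_pow _ (Nat.le_succ _)).trans hy.2.2
  have co : ∀ {m : ℕ} {y : ℂ → ℂ}, PuiseuxCoord m y → PowerSeries.coeff m (taylor y) = 0 :=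
    fun hy => PowerSeries.X_pow_dvd_iff.mp hy.2.2 _ (Nat.lt_succ_self _)
  have s₁ : AnalyticAt ℂ (fun p => (σ p).1) 0 := analyticAt_fst_comp hσ.1
  have s₂ : AnalyticAt ℂ (fun p => (σ p).2) 0 := analyticAt_snd_comp hσ.1
  have fd₁ : ∀ v, fderiv ℂ (fun p => (σ p).1) 0 v = a * v.1 := fun v => by
    rw [show fderiv ℂ (fun p => (σ p).1) 0 = (ContinuousLinearMap.fst ℂ ℂ ℂ).comp (fderiv ℂ σ 0) from
      (hσ.1.differentiableAt.hasFDerivAt.fst).fderiv, ContinuousLinearMap.comp_apply, hd]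
    rfl
  have fd₂ : ∀ v, fderiv ℂ (fun p => (σ p).2) 0 v = b * v.2 := fun v => by
    rw [show fderiv ℂ (fun p => (σ p).2) 0 = (ContinuousLinearMap.snd ℂ ℂ ℂ).comp (fderiv ℂ σ 0) from
      (hσ.1.differentiableAt.hasFDerivAt.snd).fderiv, ContinuousLinearMap.comp_apply, hd]
    rfl
  -- The lowest coefficient of the monomial coordinate, taken before and after `σ`, ties the
  -- diagonal entry of its linear part to the derivative of the reparametrization.
  have leadX : ∀ {f g : ℂ → ℂ × ℂ} {m : ℕ} {y z : ℂ → ℂ} {ρ : ℂ → ℂ}, PuiseuxCoord m y →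
      f = (fun t => (t ^ m, y t)) → g = (fun t => (t ^ m, z t)) → IsGermAut ρ →
      σ ∘ f =ᶠ[𝓝 0] g ∘ ρ → a = deriv ρ 0 ^ m := by
    rintro f g m y z ρ hy rfl rfl hρ he
    have hpow : AnalyticAt ℂ (fun t : ℂ => t ^ m) 0 := by fun_prop
    have := leading_coeff_eq s₁ (by simp [hσ.2.1]) (f := fun t => (t ^ m, y t)) (hpow.prod hy.2.1)
      (by simp [hy.apply_zero, hy.1.ne']) (m := m) (by rw [pw]) (le hy) hρ
      (by filter_upwards [he] with t ht; exact congrArg Prod.fst ht)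
    rw [pw, PowerSeries.coeff_X_pow_self, co hy, pdx, fd₁] at this
    simpa using this
  have leadY : ∀ {f g : ℂ → ℂ × ℂ} {m : ℕ} {y z : ℂ → ℂ} {ρ : ℂ → ℂ}, PuiseuxCoord m y →
      f = (fun t => (y t, t ^ m)) → g = (fun t => (z t, t ^ m)) → IsGermAut ρ →
      σ ∘ f =ᶠ[𝓝 0] g ∘ ρ → b = deriv ρ 0 ^ m := by
    rintro f g m y z ρ hy rfl rfl hρ he
    have hpow : AnalyticAt ℂ (fun t : ℂ => t ^ m) 0 := by fun_prop
    have := leading_coeff_eq s₂ (by simp [hσ.2.1]) (f := fun t => (y t, t ^ m)) (hy.2.1.prod hpow)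
      (by simp [hy.apply_zero, hy.1.ne']) (m := m) (le hy) (by rw [pw]) hρ
      (by filter_upwards [he] with t ht; exact congrArg Prod.snd ht)
    rw [pw, PowerSeries.coeff_X_pow_self, co hy, pdy, fd₂] at this
    simpa using this
  have ea : a = α ^ m₁ := by
    cases δ <;> exact leadX c₁ rfl rfl hρ₁ hc.1
  have ew : pureWeight δ a b = β ^ m₂ := by
    cases δ with
    | distinct => exact leadY c₂ rfl rfl hρ₂ hc.2
    | same => exact leadX c₂ rfl rfl hρ₂ hc.2
  have hw := coordWeight_ne_zero (δ := δ) ha hb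
  -- undo the homothety on the target side
  set R₁ := rescale b⁻¹ α⁻¹ Q₁ with hR₁
  set R₂ := rescale (coordWeight δ a b)⁻¹ β⁻¹ Q₂ with hR₂
  have hinv : Carries (fun t => α⁻¹ * t) (fun t => β⁻¹ * t) (fun p => (a⁻¹ * p.1, b⁻¹ * p.2))
      (model δ m₁ m₂ Q₁ Q₂) (model δ m₁ m₂ R₁ R₂) := by
    refine carries_homothety_iff.mpr ⟨⟨by rw [ea, inv_pow], fun i => ?_⟩, ?_, fun i => ?_⟩
    · rw [hR₁, coeff_rescale, div_mul_cancel₀ _ (pow_ne_zero _ (inv_ne_zero hα))]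
    · rw [inv_pow, ← ew]
      cases δ <;> rfl
    · rw [hR₂, coeff_rescale, div_mul_cancel₀ _ (pow_ne_zero _ (inv_ne_zero hβ))]
      cases δ <;> rfl
  have hR₁' : Tail₁ Λ m₁ R₁ := by
    rwa [Tail₁, support_rescale (inv_ne_zero hb) (inv_ne_zero hα)]
  have hR₂' : Tail₂ Λ m₂ R₂ := by
    rwa [Tail₂, support_rescale (inv_ne_zero hw) (inv_ne_zero hβ)]
  have hlin := isGermAut_homothety (inv_ne_zero ha) (inv_ne_zero hb)
  have hder : ∀ {ρ : ℂ → ℂ}, IsGermAut ρ → deriv ρ 0 ≠ 0 →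
      deriv ((fun t => (deriv ρ 0)⁻¹ * t) ∘ ρ) 0 = 1 := by
    intro ρ hρ h0
    have : HasDerivAt ((fun t => (deriv ρ 0)⁻¹ * t) ∘ ρ) ((deriv ρ 0)⁻¹ * deriv ρ 0) 0 :=
      hρ.1.differentiableAt.hasDerivAt.const_mul _
    rw [this.deriv, inv_mul_cancel₀ h0]
  have hfd : ∀ v, fderiv ℂ ((fun p : ℂ × ℂ => (a⁻¹ * p.1, b⁻¹ * p.2)) ∘ σ) 0 v = v := by
    intro v
    rw [fderiv_comp 0 (by rw [hσ.2.1]; exact hlin.1.differentiableAt) hσ.1.differentiableAt, hσ.2.1,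
      ContinuousLinearMap.comp_apply, hd, fderiv_homothety]
    simp [ha, hb]
  obtain ⟨q₁, q₂⟩ := eq_of_carries_unipotent hP hP₁ hP₂ hR₁' hR₂'
    ((isGermAut_mul (inv_ne_zero hα)).comp hρ₁) ((isGermAut_mul (inv_ne_zero hβ)).comp hρ₂)
    (hder hρ₁ hα) (hder hρ₂ hβ) (hlin.comp hσ) hfd (carries_comp hρ₁ hρ₂ hc hinv)
  refine ⟨α, β, a, b, hα, hβ, ha, hb, carries_homothety_iff.mpr ⟨⟨ea, fun i => ?_⟩, ew, fun i => ?_⟩⟩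
  · rw [q₁, hR₁, coeff_rescale, inv_pow]
    field_simp
  · rw [q₂, hR₂, coeff_rescale, inv_pow]
    field_simp

end Uniqueness

/-! ### Residual homotheties -/

section Residual

variable {δ : Tangents} {m₁ m₂ j₁ k : ℕ} {R P R' P' : ℂ[X]}

theorem coeff_formA {j k : ℕ} (R : ℂ[X]) (i : ℕ) : (X ^ j + X ^ k + R : ℂ[X]).coeff i =
    (if i = j then 1 else 0) + (if i = k then 1 else 0) + R.coeff i := by
  rw [coeff_add, coeff_add, coeff_X_pow, coeff_X_pow]

theorem rescale_coeff_iff {x y w β : ℂ} (hβ : β ≠ 0) (j : ℕ) :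
    w * x = y * β ^ j ↔ x * (w * β ^ (-(j : ℤ))) = y := by
  rw [zpow_neg, zpow_natCast, ← div_eq_mul_inv, mul_div_assoc', div_eq_iff (pow_ne_zero _ hβ),
    mul_comm x]

/-- The unit coefficients in degrees `j₁` and `k`, where the tails vanish, give `b = α ^ j₁ = α ^
k`; the other degrees relate the tails. -/
theorem rescale_formA_iff (hjk : j₁ < k) (hR : Above k R) (hR' : Above k R') {α b : ℂ}
    (hα : α ≠ 0) :
    (∀ j, b * (X ^ j₁ + X ^ k + R : ℂ[X]).coeff j =
        (X ^ j₁ + X ^ k + R' : ℂ[X]).coeff j * α ^ j) ↔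
      b = α ^ j₁ ∧ α ^ (k - j₁) = 1 ∧ ∀ j : ℕ, R.coeff j * α ^ ((j₁ : ℤ) - j) = R'.coeff j := by
  have hrel : ∀ j : ℕ, α ^ j₁ * R.coeff j = R'.coeff j * α ^ j ↔
      R.coeff j * α ^ ((j₁ : ℤ) - j) = R'.coeff j := fun j => by
    rw [rescale_coeff_iff hα, sub_eq_add_neg, zpow_add₀ hα, zpow_natCast]
  have hk : α ^ k = α ^ (k - j₁) * α ^ j₁ := by rw [← pow_add, Nat.sub_add_cancel hjk.le]
  simp only [coeff_formA]
  constructor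
  · intro h
    have e1 : b = α ^ j₁ := by
      simpa [hjk.ne, coeff_eq_zero_of_above hR hjk.le, coeff_eq_zero_of_above hR' hjk.le] using h j₁
    have e2 : b = α ^ k := by
      simpa [hjk.ne', coeff_eq_zero_of_above hR le_rfl, coeff_eq_zero_of_above hR' le_rfl] using h k
    refine ⟨e1, ?_, fun j => (hrel j).mp ?_⟩
    · rw [e1, hk] at e2
      exact (mul_eq_right₀ (pow_ne_zero j₁ hα)).mp e2.symm
    · rw [← e1]
      rcases Nat.lt_or_ge k j with hlt | hge
      · simpa [(hjk.trans hlt).ne', hlt.ne'] using h j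
      · rw [coeff_eq_zero_of_above hR hge, coeff_eq_zero_of_above hR' hge]
        simp
  · rintro ⟨e1, e2, h⟩ j
    have h3 := (hrel j).mpr (h j)
    rw [e2, one_mul] at hk
    rw [e1, mul_add, mul_add, add_mul, add_mul, h3]
    congr 2
    · split_ifs with e
      · rw [e]; ring
      · simp
    · split_ifs with e
      · rw [e, hk]; ring
      · simp

theorem carries_formA_iff (hjk : j₁ < k) (hR : Above k R) (hR' : Above k R') {α β a b : ℂ}
    (hα : α ≠ 0) (hβ : β ≠ 0) :
    Carries (fun t => α * t) (fun t => β * t) (fun p => (a * p.1, b * p.2))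
        (model δ m₁ m₂ (X ^ j₁ + X ^ k + R) P) (model δ m₁ m₂ (X ^ j₁ + X ^ k + R') P') ↔
      a = α ^ m₁ ∧ b = α ^ j₁ ∧ Residual δ m₁ m₂ j₁ k α β ∧ CoeffRel δ m₁ j₁ α β R P R' P' := by
  rw [carries_homothety_iff, rescale_formA_iff hjk hR hR' hα]
  simp only [rescale_coeff_iff hβ]
  cases δ with
  | distinct =>
    simp only [pureWeight, coordWeight, Residual, CoeffRel]
    constructor
    · rintro ⟨⟨rfl, rfl, h1, h2⟩, h3, h4⟩
      exact ⟨rfl, rfl, ⟨h1, h3.symm⟩, fun j => ⟨h2 j, h4 j⟩⟩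
    · rintro ⟨rfl, rfl, ⟨h1, h3⟩, h⟩
      exact ⟨⟨rfl, rfl, h1, fun j => (h j).1⟩, h3.symm, fun j => (h j).2⟩
  | same =>
    simp only [pureWeight, coordWeight, Residual, CoeffRel]
    constructor
    · rintro ⟨⟨rfl, rfl, h1, h2⟩, h3, h4⟩
      exact ⟨rfl, rfl, ⟨h1, h3.symm⟩, fun j => ⟨h2 j, h4 j⟩⟩
    · rintro ⟨rfl, rfl, ⟨h1, h3⟩, h⟩
      exact ⟨⟨rfl, rfl, h1, fun j => (h j).1⟩, h3.symm, fun j => (h j).2⟩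

theorem Residual.ne_zero (hjk : j₁ < k) (hm : 0 < m₂) {α β : ℂ}
    (h : Residual δ m₁ m₂ j₁ k α β) : α ≠ 0 ∧ β ≠ 0 := by
  have key : ∀ n : ℕ, α ^ (k - j₁) = 1 → β ^ m₂ = α ^ n → α ≠ 0 ∧ β ≠ 0 := by
    intro n h1 h2
    have hα : α ≠ 0 := by
      rintro rfl
      rw [zero_pow (by omega)] at h1
      exact zero_ne_one h1
    refine ⟨hα, ?_⟩
    rintro rfl
    rw [zero_pow hm.ne'] at h2
    exact pow_ne_zero n hα h2.symm
  cases δ <;> exact key _ h.1 h.2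

/-- By rigidity of reduced forms an `ℋ`-equivalence can be replaced by a homothety. Conversely, the
residual data define such a homothety, and the relation `α ^ (k - j₁) = 1` guarantees that its
multipliers are nonzero. -/
theorem hequiv_formA_iff {Γ Λ : Set (ℕ × ℕ)} (hjk : j₁ < k) (hR : Above k R) (hR' : Above k R')
    (hP₁ : Tail₁ Λ m₁ (X ^ j₁ + X ^ k + R)) (hP₁' : Tail₁ Λ m₁ (X ^ j₁ + X ^ k + R'))
    (hP₂ : Tail₂ Λ m₂ P) (hP₂' : Tail₂ Λ m₂ P')
    (hψ : model δ m₁ m₂ (X ^ j₁ + X ^ k + R) P ∈ SigmaSet δ Γ Λ) :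
    HEquiv (model δ m₁ m₂ (X ^ j₁ + X ^ k + R) P) (model δ m₁ m₂ (X ^ j₁ + X ^ k + R') P') ↔
      ∃ α β : ℂ, Residual δ m₁ m₂ j₁ k α β ∧ CoeffRel δ m₁ j₁ α β R P R' P' := by
  constructor
  · intro h
    obtain ⟨α, β, a, b, hα, hβ, -, -, hc⟩ := h.exists_homothety hψ hP₁ hP₂ hP₁' hP₂'
    obtain ⟨-, -, h⟩ := (carries_formA_iff hjk hR hR' hα hβ).mp hc
    exact ⟨α, β, h⟩
  · rintro ⟨α, β, hres, hrel⟩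
    obtain ⟨hα, hβ⟩ := hres.ne_zero hjk (multiplicities_pos hψ.2.1).2
    exact ⟨_, _, _, isGermAut_mul hα, isGermAut_mul hβ,
      isGermAut_homothety (pow_ne_zero m₁ hα) (pow_ne_zero j₁ hα),
      ⟨_, _, fderiv_homothety _ _⟩,
      (carries_formA_iff hjk hR hR' hα hβ).mpr ⟨rfl, rfl, hres, hrel⟩⟩

end Residual

end

end TwoBranch

open TwoBranch Polynomial in
theorem theorem8 :
    -- every bigerm is equivalent to one in Puiseux form
    (∀ φ : Bigerm, IsBigerm φ →
      ∃ (δ : Tangents) (Γ Λ : Set (ℕ × ℕ)), ∃ φ' ∈ SigmaSet δ Γ Λ, AEquiv φ φ') ∧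
    -- the list of normal forms, for a suitable numbering of the two branches
    (∀ (δ : Tangents) (Γ Λ : Set (ℕ × ℕ)), ∀ φ ∈ SigmaSet δ Γ Λ,
      ∃ (m₁ m₂ : ℕ) (P₁ P₂ : ℂ[X]),
        (AEquiv φ (model δ m₁ m₂ P₁ P₂) ∧
          model δ m₁ m₂ P₁ P₂ ∈ SigmaSet δ Γ Λ ∧ Listed δ Λ m₁ m₂ P₁ P₂) ∨
        (AEquiv φ.swap (model δ m₁ m₂ P₁ P₂) ∧
          model δ m₁ m₂ P₁ P₂ ∈ SigmaSet δ (Prod.swap '' Γ) (Prod.swap '' Λ) ∧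
          Listed δ (Prod.swap '' Λ) m₁ m₂ P₁ P₂)) ∧
    -- the form for the given numbering, with no exponent of the first branch in `M`
    (∀ (δ : Tangents) (Γ Λ : Set (ℕ × ℕ)), ∀ φ ∈ SigmaSet δ Γ Λ,
      ∃ (m₁ m₂ : ℕ) (P₁ P₂ : ℂ[X]),
        AEquiv φ (model δ m₁ m₂ P₁ P₂) ∧ model δ m₁ m₂ P₁ P₂ ∈ SigmaSet δ Γ Λ ∧
        Tail₁ Λ m₁ P₁ ∧ Tail₂ Λ m₂ P₂ ∧ Normalized δ m₁ m₂ P₁ P₂) ∧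
    -- residual homotheties in the cases a) and a')
    (∀ (δ : Tangents) (Γ Λ : Set (ℕ × ℕ)) (m₁ m₂ j₁ k : ℕ) (R P R' P' : ℂ[X]), j₁ < k →
      Above k R → Above k R' →
      Tail₁ Λ m₁ (X ^ j₁ + X ^ k + R) → Tail₁ Λ m₁ (X ^ j₁ + X ^ k + R') →
      Tail₂ Λ m₂ P → Tail₂ Λ m₂ P' →
      model δ m₁ m₂ (X ^ j₁ + X ^ k + R) P ∈ SigmaSet δ Γ Λ →
      model δ m₁ m₂ (X ^ j₁ + X ^ k + R') P' ∈ SigmaSet δ Γ Λ →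
      (∀ α β a b : ℂ, α ≠ 0 → β ≠ 0 → a ≠ 0 → b ≠ 0 →
        (Carries (fun t => α * t) (fun t => β * t) (fun p => (a * p.1, b * p.2))
            (model δ m₁ m₂ (X ^ j₁ + X ^ k + R) P) (model δ m₁ m₂ (X ^ j₁ + X ^ k + R') P') ↔
          a = α ^ m₁ ∧ b = α ^ j₁ ∧ Residual δ m₁ m₂ j₁ k α β ∧
            CoeffRel δ m₁ j₁ α β R P R' P')) ∧
      (HEquiv (model δ m₁ m₂ (X ^ j₁ + X ^ k + R) P)
          (model δ m₁ m₂ (X ^ j₁ + X ^ k + R') P') ↔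
        ∃ α β : ℂ, Residual δ m₁ m₂ j₁ k α β ∧ CoeffRel δ m₁ j₁ α β R P R' P')) := by
  exact ⟨fun φ hφ => exists_aequiv_mem_sigmaSet hφ, fun δ Γ Λ φ hφ => exists_listed hφ,
    fun δ Γ Λ φ hφ => exists_tail_normalized hφ,
    fun δ Γ Λ m₁ m₂ j₁ k R P R' P' hjk hR hR' hT hT' hP hP' hψ hψ' =>
      ⟨fun α β a b hα hβ ha hb => carries_formA_iff hjk hR hR' hα hβ,
        hequiv_formA_iff hjk hR hR' hT hT' hP hP' hψ⟩⟩
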